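/- **Conventions.** Let $B$ be a smooth (Hausdorff, second countable) surface. A *lattice of rank $2$* on $B$ is a family $P$ of subgroups $P_x\subset T^*_xB$ which locally is generated over $\mathbb Z$ by a smooth frame of $T^*B$; it is *closed* if all its local sections are closed $1$-forms. For example, $\mathbb Z\,dx+\mathbb Z\,dy$ is the *standard lattice* on $\mathbb R^2$. A closed lattice $P$ of rank $2$ is *complete* if, for the universal cover $p\colon U\to B$, there is a diffeomorphism $f\colon U\to\mathbb R^2$ onto the whole plane that takes $p^*P$ to the standard lattice, i.e. $f^*(\mathbb Z\,dx+\mathbb Z\,dy)=p^*P$. $H^2(B,P)$ is the cohomology of $B$ with coefficients in the local system of groups $\{P_x\}$. $H^2(B,\mathbb R)$ is de Rham cohomology. A *latticed $1$-form* is a smooth section $\alpha$ of $T^*B/P$; if $P$ is closed, $d\alpha$ is the well-defined $2$-form that equals the differential of any local representative of $\alpha$. $H^2_P(B)\subset H^2(B,\mathbb R)$ is the subgroup of the classes of the closed $2$-forms $d\alpha$, where $\alpha$ is a latticed $1$-form. The quotient $H^2(B,\mathbb R)/H^2_P(B)$ is the group of *nontrivial twistings*. For integers $k$, $\varepsilon=\pm1$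 and real $c,d$ write $\bigl(\begin{smallmatrix}1&k\\0&\varepsilon\end{smallmatrix}\bigr)\bigl(\begin{smallmatrix}c\\d\end{smallmatrix}\bigr)$ for the affine map $(X,Y)\mapsto(X+kY+c,\ \varepsilon Y+d)$. If a group $G$ generated by such maps acts freely on $\mathbb R^2$ with quotient a manifold, then the standard lattice induces a complete lattice on $\mathbb R^2/G$. We say that $P$ belongs to one of the following series if $(B,P)$ is isomorphic to $\mathbb R^2/G$ with the induced lattice, where $G$ is generated by * $\mathbb T^2_{u,v;w,z}$ ($uz-vw\neq0$): $\bigl(\begin{smallmatrix}1&0\\0&1\end{smallmatrix}\bigr)\bigl(\begin{smallmatrix}u\\v\end{smallmatrix}\bigr)$ and $\bigl(\begin{smallmatrix}1&0\\0&1\end{smallmatrix}\bigr)\bigl(\begin{smallmatrix}w\\z\end{smallmatrix}\bigr)$; * $\mathbb T^2_{n,y;x}$ ($n\ge0$ an integer, $x,y>0$): $\bigl(\begin{smallmatrix}1&n\\0&1\end{smallmatrix}\bigr)\bigl(\begin{smallmatrix}0\\y\end{smallmatrix}\bigr)$ and $\bigl(\begin{smallmatrix}1&0\\0&1\end{smallmatrix}\bigr)\bigl(\begin{smallmatrix}x\\0\end{smallmatrix}\bigr)$;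 * $\mathbb K^2_{m,y;\delta,x}$ ($m\ge0$ an integer, $\delta\in\{0,1\}$, $m$ even if $\delta=1$, $x,y>0$): $\bigl(\begin{smallmatrix}1&\delta\\0&-1\end{smallmatrix}\bigr)\bigl(\begin{smallmatrix}x\\0\end{smallmatrix}\bigr)$ and $\bigl(\begin{smallmatrix}1&m\\0&1\end{smallmatrix}\bigr)\bigl(\begin{smallmatrix}(m-\delta)y/2\\y\end{smallmatrix}\bigr)$. Put $\mathbb Z_n=\mathbb Z/n\mathbb Z$, $\mathbb Z_0=\mathbb Z$. **Theorem.** 1) If $B$ is homeomorphic neither to the torus nor to the Klein bottle, then for every complete lattice $P$ of rank $2$ on $B$ the groups $H^2(B,P)$ and $H^2(B,\mathbb R)/H^2_P(B)$ are trivial. 2) If $P$ is from the series $\mathbb T^2_{u,v;w,z}$, then $H^2(B,P)\simeq\mathbb Z\oplus\mathbb Z$. Integration over $B$ (that is, integration of the pull-back to $\mathbb R^2$ over the parallelogram spanned by $(u,v)$ and $(w,z)$) is a linear isomorphism $H^2(B,\mathbb R)\simeq\mathbb R$, and it maps $H^2_P(B)$ onto the subgroup of $\mathbb R$ generated by $u,v,w,z$.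 3) If $P$ is from the series $\mathbb T^2_{n,y;x}$, then $H^2(B,P)\simeq\mathbb Z\oplus\mathbb Z_n$. Integration over $B$ (of the pull-back, over the rectangle spanned by $(x,0)$ and $(0,y)$) is a linear isomorphism $H^2(B,\mathbb R)\simeq\mathbb R$, and it maps $H^2_P(B)$ onto the subgroup of $\mathbb R$ generated by $x$ and $y$. 4) If $P$ is from the series $\mathbb K^2_{m,y;0,x}$, $m\ge0$, then $H^2(B,P)\simeq\mathbb Z_2\oplus\mathbb Z_m$, and $H^2_P(B)$ and $H^2(B,\mathbb R)/H^2_P(B)$ are trivial. 5) If $P$ is from the series $\mathbb K^2_{2m,y;1,x}$, $m\ge0$, then $H^2(B,P)\simeq\mathbb Z_{4m}$, and $H^2_P(B)$ and $H^2(B,\mathbb R)/H^2_P(B)$ are trivial. -/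

import Mathlib

open scoped Manifold ContDiff Topology

noncomputable section

namespace LagrangianFibration

/-- The coordinate plane `ℝ²`. -/
abbrev Plane : Type := EuclideanSpace ℝ (Fin 2)

/-! ### Differential forms on a surface -/

section Forms

variable {B : Type*} [TopologicalSpace B] [ChartedSpace Plane B]

/-- The cotangent space `T*_x B`. -/
abbrev Cotangent (x : B) : Type := TangentSpace 𝓘(ℝ, Plane) x →L[ℝ] ℝ

variable (B) in
/-- Fields of covectors on `B`, with no regularity. -/
abbrev CovectorField : Type _ := ∀ x : B, Cotangent x

variable (B) in
/-- Fields of alternating `k`-forms on `B`, with no regularity. -/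
def FormField (k : ℕ) : Type _ := ∀ x : B, (TangentSpace 𝓘(ℝ, Plane) x) [⋀^Fin k]→L[ℝ] ℝ

instance (k : ℕ) : AddCommGroup (FormField B k) :=
  inferInstanceAs (AddCommGroup (∀ x : B, (TangentSpace 𝓘(ℝ, Plane) x) [⋀^Fin k]→L[ℝ] ℝ))

instance (k : ℕ) : Module ℝ (FormField B k) :=
  inferInstanceAs (Module ℝ (∀ x : B, (TangentSpace 𝓘(ℝ, Plane) x) [⋀^Fin k]→L[ℝ] ℝ))

/-- A field of covectors as a field of alternating forms of degree one. -/
def toForm (α : CovectorField B) : FormField B 1 := fun x =>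
  ContinuousAlternatingMap.ofSubsingleton ℝ (TangentSpace 𝓘(ℝ, Plane) x) ℝ (0 : Fin 1) (α x)

/-- The pull-back `f^*η` under a map `f` from the plane (for instance an inverse chart). -/
def pullbackForm {k : ℕ} (f : Plane → B) (η : FormField B k) : Plane → Plane [⋀^Fin k]→L[ℝ] ℝ :=
  fun e => (η (f e)).compContinuousLinearMap (mfderiv 𝓘(ℝ, Plane) 𝓘(ℝ, Plane) f e)

/-- `η` is smooth on the open set `V`: in every chart its coefficients are smooth. -/
def SmoothOn {k : ℕ} (η : FormField B k) (V : Set B) : Prop :=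
  ∀ φ ∈ atlas Plane B, ContDiffOn ℝ ∞ (pullbackForm φ.symm η) (φ.target ∩ φ.symm ⁻¹' V)

/-- `dθ = η` on the open set `V`, computed in charts. -/
def IsDiffOn {k : ℕ} (θ : FormField B k) (η : FormField B (k + 1)) (V : Set B) : Prop :=
  ∀ φ ∈ atlas Plane B, ∀ e ∈ φ.target ∩ φ.symm ⁻¹' V,
    extDeriv (pullbackForm φ.symm θ) e = pullbackForm φ.symm η e

theorem pullbackForm_add {k : ℕ} (f : Plane → B) (η θ : FormField B k) :
    pullbackForm f (η + θ) = pullbackForm f η + pullbackForm f θ := by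
  funext e; ext v; rfl

theorem pullbackForm_smul {k : ℕ} (f : Plane → B) (c : ℝ) (η : FormField B k) :
    pullbackForm f (c • η) = c • pullbackForm f η := by
  funext e; ext v; rfl

theorem pullbackForm_zero {k : ℕ} (f : Plane → B) :
    pullbackForm f (0 : FormField B k) = 0 := by
  funext e; ext v; rfl

theorem toForm_add (α β : CovectorField B) : toForm (α + β) = toForm α + toForm β := by
  funext x; ext v; rfl

theorem toForm_smul (c : ℝ) (α : CovectorField B) : toForm (c • α) = c • toForm α := by
  funext x; ext v; rfl

theorem toForm_neg (α : CovectorField B) : toForm (-α) = (-1 : ℝ) • toForm α := by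
  funext x; ext v; exact (neg_one_mul _).symm

theorem toForm_zero : toForm (0 : CovectorField B) = 0 := by
  funext x; ext v; rfl

theorem SmoothOn.mono {k : ℕ} {η : FormField B k} {V W : Set B} (h : SmoothOn η V)
    (hWV : W ⊆ V) : SmoothOn η W := fun φ hφ =>
  (h φ hφ).mono fun _ he => ⟨he.1, hWV he.2⟩

theorem SmoothOn.add {k : ℕ} {η θ : FormField B k} {V : Set B} (h : SmoothOn η V)
    (h' : SmoothOn θ V) : SmoothOn (η + θ) V := fun φ hφ => by
  rw [pullbackForm_add]; exact (h φ hφ).add (h' φ hφ)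

theorem SmoothOn.smul {k : ℕ} {η : FormField B k} {V : Set B} (c : ℝ) (h : SmoothOn η V) :
    SmoothOn (c • η) V := fun φ hφ => by
  rw [pullbackForm_smul]; exact (h φ hφ).const_smul c

theorem smoothOn_zero {k : ℕ} (V : Set B) : SmoothOn (0 : FormField B k) V := fun φ _ => by
  rw [pullbackForm_zero]; exact contDiffOn_const

theorem SmoothOn.differentiableAt {k : ℕ} {η : FormField B k} {V : Set B} (h : SmoothOn η V)
    (hV : IsOpen V) {φ : OpenPartialHomeomorph B Plane} (hφ : φ ∈ atlas Plane B) {e : Plane}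
    (he : e ∈ φ.target ∩ φ.symm ⁻¹' V) : DifferentiableAt ℝ (pullbackForm φ.symm η) e :=
  ((h φ hφ).contDiffAt ((φ.isOpen_inter_preimage_symm hV).mem_nhds he)).differentiableAt
    (by simp)

theorem IsDiffOn.mono {k : ℕ} {θ : FormField B k} {η : FormField B (k + 1)} {V W : Set B}
    (h : IsDiffOn θ η V) (hWV : W ⊆ V) : IsDiffOn θ η W := fun φ hφ e he =>
  h φ hφ e ⟨he.1, hWV he.2⟩

theorem IsDiffOn.add {k : ℕ} {θ θ' : FormField B k} {η η' : FormField B (k + 1)} {V : Set B}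
    (hV : IsOpen V) (hθ : SmoothOn θ V) (hθ' : SmoothOn θ' V)
    (h : IsDiffOn θ η V) (h' : IsDiffOn θ' η' V) :
    IsDiffOn (θ + θ') (η + η') V := fun φ hφ e he => by
  rw [pullbackForm_add, pullbackForm_add,
    extDeriv_add (hθ.differentiableAt hV hφ he) (hθ'.differentiableAt hV hφ he),
    h φ hφ e he, h' φ hφ e he]
  rfl

theorem IsDiffOn.smul {k : ℕ} {θ : FormField B k} {η : FormField B (k + 1)} {V : Set B} (c : ℝ)
    (h : IsDiffOn θ η V) : IsDiffOn (c • θ) (c • η) V := fun φ hφ e he => by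
  rw [pullbackForm_smul, pullbackForm_smul, extDeriv_smul, h φ hφ e he]
  rfl

theorem isDiffOn_zero {k : ℕ} (V : Set B) :
    IsDiffOn (0 : FormField B k) (0 : FormField B (k + 1)) V := fun φ hφ e he => by
  have h := extDeriv_smul (x := e) (0 : ℝ) (pullbackForm φ.symm (0 : FormField B k))
  rw [pullbackForm_zero] at h ⊢
  simpa [pullbackForm_zero] using h

variable (B)

/-- The space `Z²(B, ℝ)` of closed smooth `2`-forms. -/
def closedTwoForms : Submodule ℝ (FormField B 2) where
  carrier := {η | SmoothOn η Set.univ ∧ IsDiffOn η 0 Set.univ}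
  add_mem' {η θ} h h' := ⟨h.1.add h'.1, by
    simpa using IsDiffOn.add isOpen_univ h.1 h'.1 h.2 h'.2⟩
  zero_mem' := ⟨smoothOn_zero _, isDiffOn_zero _⟩
  smul_mem' c η h := ⟨h.1.smul c, by simpa using h.2.smul c⟩

/-- The space `dΩ¹(B)` of differentials of smooth `1`-forms. -/
def exactTwoForms : Submodule ℝ (FormField B 2) where
  carrier := {η | SmoothOn η Set.univ ∧ ∃ α : CovectorField B,
    SmoothOn (toForm α) Set.univ ∧ IsDiffOn (toForm α) η Set.univ}
  add_mem' := by
    rintro η θ ⟨h, α, hα, hd⟩ ⟨h', β, hβ, hd'⟩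
    refine ⟨h.add h', α + β, ?_, ?_⟩ <;> rw [toForm_add]
    exacts [hα.add hβ, IsDiffOn.add isOpen_univ hα hβ hd hd']
  zero_mem' := by
    refine ⟨smoothOn_zero _, 0, ?_, ?_⟩ <;> rw [toForm_zero]
    exacts [smoothOn_zero _, isDiffOn_zero _]
  smul_mem' := by
    rintro c η ⟨h, α, hα, hd⟩
    refine ⟨h.smul c, c • α, ?_, ?_⟩ <;> rw [toForm_smul]
    exacts [hα.smul c, hd.smul c]

/-- The de Rham cohomology `H²(B, ℝ)`. -/
abbrev DeRhamH2 : Type _ :=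
  closedTwoForms B ⧸ (exactTwoForms B).submoduleOf (closedTwoForms B)

end Forms

/-! ### Lattices in the cotangent bundle -/

/-- A lattice of rank `2` on the surface `B`: a lattice `ℤ²` in every cotangent space `T*_x B`,
varying smoothly with `x`. -/
structure CotangentLattice (B : Type*) [TopologicalSpace B] [ChartedSpace Plane B] where
  fiber : ∀ x : B, AddSubgroup (Cotangent x)
  exists_frame : ∀ x : B, ∃ V : Set B, IsOpen V ∧ x ∈ V ∧ ∃ b : Fin 2 → CovectorField B,
    (∀ i, SmoothOn (toForm (b i)) V) ∧
    ∀ y ∈ V, LinearIndependent ℝ (fun i => b i y) ∧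
      fiber y = AddSubgroup.closure (Set.range fun i => b i y)

/-- The standard lattice `ℤ² = ℤ dx + ℤ dy` in the space of covectors of the plane. -/
def stdLattice : AddSubgroup (Plane →L[ℝ] ℝ) :=
  AddSubgroup.closure {EuclideanSpace.proj (0 : Fin 2), EuclideanSpace.proj (1 : Fin 2)}

section Lattices

variable {B : Type*} [TopologicalSpace B] [ChartedSpace Plane B]

/-- The codifferential `df^* : T*_{f u} N → T*_u M` of a map `f : M → N` of surfaces. -/
def codiff {M N : Type*} [TopologicalSpace M] [ChartedSpace Plane M] [TopologicalSpace N]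
    [ChartedSpace Plane N] (f : M → N) (u : M) : Cotangent (f u) →+ Cotangent u where
  toFun α := α.comp (mfderiv 𝓘(ℝ, Plane) 𝓘(ℝ, Plane) f u)
  map_zero' := ContinuousLinearMap.zero_comp _
  map_add' α β := ContinuousLinearMap.add_comp α β _

/-- A lattice is closed if all its local sections are closed `1`-forms. -/
def CotangentLattice.IsClosed (P : CotangentLattice B) : Prop :=
  ∀ (V : Set B) (α : CovectorField B), IsOpen V → SmoothOn (toForm α) V →
    (∀ y ∈ V, α y ∈ P.fiber y) → IsDiffOn (toForm α) 0 V

/-- A closed lattice is complete if the universal cover `p : U → B`, with the lattice `p^*P`,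
admits a developing map `f : U → ℝ²` (that is, `f^*ℤ² = p^*P`) which is a diffeomorphism onto the
whole plane. -/
def CotangentLattice.IsComplete (P : CotangentLattice B) : Prop :=
  P.IsClosed ∧
  ∃ (U : Type) (_ : TopologicalSpace U) (_ : ChartedSpace Plane U)
    (_ : IsManifold 𝓘(ℝ, Plane) ∞ U) (_ : SimplyConnectedSpace U)
    (p : U → B) (f : Diffeomorph 𝓘(ℝ, Plane) 𝓘(ℝ, Plane) U Plane ∞),
    IsCoveringMap p ∧ Function.Surjective p ∧
    IsLocalDiffeomorph 𝓘(ℝ, Plane) 𝓘(ℝ, Plane) ∞ p ∧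
    ∀ u : U, stdLattice.map (codiff f u) = (P.fiber (p u)).map (codiff p u)

/-! ### Latticed `1`-forms and nontrivial twistings -/

/-- `s` is a smooth section of `T*B/P` (a latticed `1`-form) and `η = ds`: near every point
`s` is represented by a smooth `1`-form `α` with `dα = η`. -/
def HasLatticedDiff (P : CotangentLattice B) (s : ∀ x : B, Cotangent x ⧸ P.fiber x)
    (η : FormField B 2) : Prop :=
  ∀ x : B, ∃ V : Set B, IsOpen V ∧ x ∈ V ∧ ∃ α : CovectorField B,
    SmoothOn (toForm α) V ∧ (∀ y ∈ V, (QuotientAddGroup.mk (α y) : Cotangent y ⧸ P.fiber y) = s y) ∧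
    IsDiffOn (toForm α) η V

/-- The group of those closed `2`-forms that are differentials of latticed `1`-forms. -/
def latticedDiffs (P : CotangentLattice B) : AddSubgroup (closedTwoForms B) where
  carrier := {η | ∃ s, HasLatticedDiff P s η}
  zero_mem' := ⟨0, fun x => ⟨Set.univ, isOpen_univ, trivial, 0, by
    rw [toForm_zero]; exact smoothOn_zero _, fun _ _ => rfl, by
    rw [toForm_zero]; exact isDiffOn_zero _⟩⟩
  add_mem' := by
    rintro η θ ⟨s, hs⟩ ⟨t, ht⟩
    refine ⟨s + t, fun x => ?_⟩
    obtain ⟨V, hV, hxV, α, hα, hαs, hdα⟩ := hs x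
    obtain ⟨W, hW, hxW, β, hβ, hβt, hdβ⟩ := ht x
    have hα' := hα.mono (Set.inter_subset_left (s := V) (t := W))
    have hβ' := hβ.mono (Set.inter_subset_right (s := V) (t := W))
    refine ⟨V ∩ W, hV.inter hW, ⟨hxV, hxW⟩, α + β, ?_, fun y hy => ?_, ?_⟩
    · rw [toForm_add]; exact hα'.add hβ'
    · rw [Pi.add_apply, Pi.add_apply, ← hαs y hy.1, ← hβt y hy.2]; rfl
    · rw [toForm_add]
      exact IsDiffOn.add (hV.inter hW) hα' hβ' (hdα.mono Set.inter_subset_left)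
        (hdβ.mono Set.inter_subset_right)
  neg_mem' := by
    rintro η ⟨s, hs⟩
    refine ⟨-s, fun x => ?_⟩
    obtain ⟨V, hV, hxV, α, hα, hαs, hdα⟩ := hs x
    refine ⟨V, hV, hxV, -α, ?_, fun y hy => ?_, ?_⟩
    · rw [toForm_neg]; exact hα.smul _
    · rw [Pi.neg_apply, Pi.neg_apply, ← hαs y hy]; rfl
    · have h := hdα.smul (-1)
      rw [neg_one_smul ℝ (η : FormField B 2)] at h
      rw [toForm_neg]; exact h

/-- `H²_P(B)`: the classes in `H²(B, ℝ)` of differentials of latticed `1`-forms. -/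
def latticedH2 (P : CotangentLattice B) : AddSubgroup (DeRhamH2 B) :=
  (latticedDiffs P).map
    ((exactTwoForms B).submoduleOf (closedTwoForms B)).mkQ.toAddMonoidHom

/-! ### Cohomology with local coefficients in the lattice -/

/-- The group of continuous sections of `P` along a continuous map `σ : X → B`, that is, of
continuous lifts of `σ` to `P ⊂ T*B`. Near each point such a lift is the composition of `σ` with a
smooth local section of `P`. -/
def sectionsAlong (P : CotangentLattice B) {X : Type*} [TopologicalSpace X] (σ : C(X, B)) :
    AddSubgroup (∀ t : X, Cotangent (σ t)) where
  carrier := {c | ∀ t₀ : X, ∃ V : Set B, IsOpen V ∧ σ t₀ ∈ V ∧ ∃ β : CovectorField B,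
    SmoothOn (toForm β) V ∧ (∀ y ∈ V, β y ∈ P.fiber y) ∧ ∀ᶠ t in 𝓝 t₀, c t = β (σ t)}
  zero_mem' t₀ := ⟨Set.univ, isOpen_univ, trivial, 0, by
    rw [toForm_zero]; exact smoothOn_zero _, fun y _ => (P.fiber y).zero_mem,
    Filter.Eventually.of_forall fun _ => rfl⟩
  add_mem' := by
    intro a b ha hb t₀
    obtain ⟨V, hV, hxV, α, hα, hαP, hαe⟩ := ha t₀
    obtain ⟨W, hW, hxW, β, hβ, hβP, hβe⟩ := hb t₀
    refine ⟨V ∩ W, hV.inter hW, ⟨hxV, hxW⟩, α + β, ?_,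
      fun y hy => (P.fiber y).add_mem (hαP y hy.1) (hβP y hy.2), ?_⟩
    · rw [toForm_add]
      exact (hα.mono Set.inter_subset_left).add (hβ.mono Set.inter_subset_right)
    · filter_upwards [hαe, hβe] with t h1 h2
      rw [Pi.add_apply, Pi.add_apply, h1, h2]
  neg_mem' := by
    intro a ha t₀
    obtain ⟨V, hV, hxV, α, hα, hαP, hαe⟩ := ha t₀
    refine ⟨V, hV, hxV, -α, ?_, fun y hy => (P.fiber y).neg_mem (hαP y hy), ?_⟩
    · rw [toForm_neg]; exact hα.smul _
    · filter_upwards [hαe] with t h1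
      rw [Pi.neg_apply, Pi.neg_apply, h1]

/-- The standard simplex `Δᵏ`. -/
abbrev Simplex (k : ℕ) : Type := stdSimplex ℝ (Fin (k + 1))

/-- The inclusion of the face of `Δᵏ⁺¹` opposite to the vertex `i`. -/
def face (k : ℕ) (i : Fin (k + 2)) : C(Simplex k, Simplex (k + 1)) :=
  ⟨stdSimplex.map i.succAbove, stdSimplex.continuous_map _⟩

/-- Singular `k`-cochains on `B` with local coefficients in `P`: a cochain assigns to each singular
simplex `σ : Δᵏ → B` an element of `P` over `σ`, that is, a section of `P` along `σ` (the fibres of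
`P` over the points of a simplex are canonically identified by continuation). -/
abbrev Cochain (P : CotangentLattice B) (k : ℕ) : Type _ :=
  ∀ σ : C(Simplex k, B), sectionsAlong P σ

/-- `δb = c`: for every `σ : Δᵏ⁺¹ → B`, if `τ i` denotes the continuation to the whole simplex of
the section that `b` assigns to the `i`-th face of `σ`, then `c σ = ∑ (-1)ⁱ τ i`. -/
def IsCoboundaryOf (P : CotangentLattice B) {k : ℕ} (b : Cochain P k) (c : Cochain P (k + 1)) :
    Prop :=
  ∀ σ : C(Simplex (k + 1), B), ∃ τ : Fin (k + 2) → sectionsAlong P σ,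
    (∀ (i : Fin (k + 2)) (t : Simplex k),
      (τ i).1 (face k i t) = (b (σ.comp (face k i))).1 t) ∧
    ∀ t, (c σ).1 t = ∑ i : Fin (k + 2), (-1 : ℤ) ^ (i : ℕ) • (τ i).1 t

theorem IsCoboundaryOf.zero (P : CotangentLattice B) (k : ℕ) :
    IsCoboundaryOf P (0 : Cochain P k) 0 := fun σ =>
  ⟨0, fun _ _ => rfl, fun t => by simp⟩

theorem IsCoboundaryOf.add {P : CotangentLattice B} {k : ℕ} {b b' : Cochain P k}
    {c c' : Cochain P (k + 1)} (h : IsCoboundaryOf P b c) (h' : IsCoboundaryOf P b' c') :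
    IsCoboundaryOf P (b + b') (c + c') := fun σ => by
  obtain ⟨τ, hτ, hc⟩ := h σ
  obtain ⟨τ', hτ', hc'⟩ := h' σ
  refine ⟨τ + τ', fun i t => congrArg₂ (· + ·) (hτ i t) (hτ' i t), fun t => ?_⟩
  have h1 : ((c + c') σ).1 t = (c σ).1 t + (c' σ).1 t := rfl
  have h2 : ∀ i, ((τ + τ') i).1 t = (τ i).1 t + (τ' i).1 t := fun _ => rfl
  simp only [h1, h2, hc, hc', smul_add, Finset.sum_add_distrib]

theorem IsCoboundaryOf.neg {P : CotangentLattice B} {k : ℕ} {b : Cochain P k}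
    {c : Cochain P (k + 1)} (h : IsCoboundaryOf P b c) :
    IsCoboundaryOf P (-b) (-c) := fun σ => by
  obtain ⟨τ, hτ, hc⟩ := h σ
  refine ⟨-τ, fun i t => congrArg (fun z => -z) (hτ i t), fun t => ?_⟩
  have h1 : ((-c) σ).1 t = -(c σ).1 t := rfl
  have h2 : ∀ i, ((-τ) i).1 t = -(τ i).1 t := fun _ => rfl
  simp only [h1, h2, hc, smul_neg, Finset.sum_neg_distrib]

/-- The group `Z²(B, P)` of cocycles. -/
def cocycles (P : CotangentLattice B) : AddSubgroup (Cochain P 2) where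
  carrier := {c | IsCoboundaryOf P c 0}
  zero_mem' := IsCoboundaryOf.zero P 2
  add_mem' h h' := by simpa using IsCoboundaryOf.add h h'
  neg_mem' h := by simpa using IsCoboundaryOf.neg h

/-- The group `B²(B, P)` of coboundaries. -/
def coboundaries (P : CotangentLattice B) : AddSubgroup (Cochain P 2) where
  carrier := {c | ∃ b : Cochain P 1, IsCoboundaryOf P b c}
  zero_mem' := ⟨0, IsCoboundaryOf.zero P 1⟩
  add_mem' := fun ⟨b, h⟩ ⟨b', h'⟩ => ⟨b + b', h.add h'⟩
  neg_mem' := fun ⟨b, h⟩ => ⟨-b, h.neg⟩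

/-- The group of primary obstruction classes `H²(B, P)`. -/
abbrev LatticeH2 (P : CotangentLattice B) : Type _ :=
  cocycles P ⧸ (coboundaries P).addSubgroupOf (cocycles P)

end Lattices

/-! ### The series of lattices -/

/-- The integral affine transformation `z ↦ A z + b` of the plane, with linear part
`A = (1 k; 0 ε)`, `ε = ±1`, and translation part `b = (c, d)`. -/
def upperAff (k : ℤ) (ε : ℤˣ) (c d : ℝ) : Equiv.Perm Plane where
  toFun z := !₂[z 0 + k * z 1 + c, ((ε : ℤ) : ℝ) * z 1 + d]
  invFun z := !₂[z 0 - c - k * (((ε : ℤ) : ℝ) * (z 1 - d)), ((ε : ℤ) : ℝ) * (z 1 - d)]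
  left_inv z := by
    rcases Int.units_eq_one_or ε with rfl | rfl <;> ext i <;> fin_cases i <;> simp
  right_inv z := by
    rcases Int.units_eq_one_or ε with rfl | rfl <;> ext i <;> fin_cases i <;> simp

/-- The group of the series `𝕋²_{u,v;w,z}`. -/
def torusGroup (u v w z : ℝ) : Subgroup (Equiv.Perm Plane) :=
  Subgroup.closure {upperAff 0 1 u v, upperAff 0 1 w z}

/-- The group of the series `𝕋²_{n,y;x}`. -/
def shearTorusGroup (n : ℕ) (y x : ℝ) : Subgroup (Equiv.Perm Plane) :=
  Subgroup.closure {upperAff n 1 0 y, upperAff 0 1 x 0}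

/-- The group of the series `𝕂²_{m,y;δ,x}`. -/
def kleinGroup (m : ℕ) (y : ℝ) (δ : ℕ) (x : ℝ) : Subgroup (Equiv.Perm Plane) :=
  Subgroup.closure {upperAff δ (-1) x 0, upperAff m 1 (((m : ℝ) - δ) / 2 * y) y}

/-- `q : ℝ² → B` is a smooth covering which identifies `B` with `ℝ²/G` and `P` with the lattice on
`ℝ²/G` induced by the standard lattice `ℤ²`. -/
structure IsPresentation {B : Type*} [TopologicalSpace B] [ChartedSpace Plane B]
    (P : CotangentLattice B) (G : Subgroup (Equiv.Perm Plane)) (q : Plane → B) : Prop where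
  isCoveringMap : IsCoveringMap q
  surjective : Function.Surjective q
  isLocalDiffeomorph : IsLocalDiffeomorph 𝓘(ℝ, Plane) 𝓘(ℝ, Plane) ∞ q
  fibers : ∀ z z' : Plane, q z = q z' ↔ ∃ g ∈ G, g z = z'
  lattice : ∀ z : Plane, stdLattice = (P.fiber (q z)).map (codiff q z)

/-- The half-open parallelogram spanned by `a` and `b`. -/
def parallelogram (a b : Plane) : Set Plane :=
  {z | ∃ s ∈ Set.Ico (0 : ℝ) 1, ∃ t ∈ Set.Ico (0 : ℝ) 1, z = s • a + t • b}

/-- The integral over `D ⊂ ℝ²` of the pull-back `q^*η` of a `2`-form on `B`. If `q` maps `D`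
bijectively onto `B = ℝ²/G`, where `G` preserves orientation, this is the integral of `η` over `B`
with the orientation induced from the plane. -/
def integralOver {B : Type*} [TopologicalSpace B] [ChartedSpace Plane B]
    (q : Plane → B) (D : Set Plane) (η : FormField B 2) : ℝ :=
  ∫ e in D, pullbackForm q η e ![EuclideanSpace.single 0 1, EuclideanSpace.single 1 1]

/-- The torus. -/
abbrev Torus : Type := Circle × Circle

/-- The Klein bottle: the quotient of the plane by the group generated by
`(x, y) ↦ (x + 1, -y)` and `(x, y) ↦ (x, y + 1)`. -/
abbrev KleinBottle : Type :=
  Quotient (MulAction.orbitRel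
    (Subgroup.closure {upperAff 0 (-1) 1 0, upperAff 0 1 0 1} : Subgroup (Equiv.Perm Plane)) Plane)

end LagrangianFibration

end

open LagrangianFibration

/-!
A surface `B` with a complete lattice is a quotient `ℝ²/G`: the inverse of the developing map,
composed with the universal covering, is a smooth covering `q : ℝ² → B` that pulls the lattice
back to the standard one (`IsLatticeCover`). All the groups in question are therefore computed on
the plane, with `G`-equivariant objects.

*Cohomology with coefficients in `P`.* Along a singular simplex of the plane, sections of `q^*P`
are constant integral covectors. So cochains on `B` with values in `P` are the cochains of the
plane with values in `ℤ²` that are equivariant under `G`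
(`IsLatticeCover.exists_liftCochain_eq_iff`). Without equivariance the complex is contracted by
coning off to the origin. Equivariance is regained by solving difference equations `T u - u = r`,
where `T` is the action of an element `t` of `G`: this is possible whenever there is an integer
valued function that `t` raises by one (`exists_act_sub_eq`), for instance the integral part of a
coordinate. If `G` is cyclic, then every cocycle has an equivariant primitive. If `G` is generated
by two elements `s` and `t` that behave like the generators of the fundamental group of a torus or
of a Klein bottle (`ShiftPair`), then the same procedure leaves a constant `κ ∈ ℤ²` as the only
obstruction, which is well defined up to the image of `σ - 1` and the image of a homomorphism `D`
found from the relation between `s` and `t` (`ShiftPair.obstruction_mem_iff`). Hence `H²(B, P)` is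
the quotient of `ℤ²` by these images, which is computed for each series.

*De Rham cohomology.* A quadratic shear of the plane turns the groups of the series into the
standard groups of the torus and of the Klein bottle, and it maps rectangles to regions with the
same integrals of invariant forms. On the torus, a `2`-form with integral zero has an explicit
invariant primitive, obtained by subtracting its horizontal mean and integrating
(`exact_of_squareIntegral_eq_zero`), so integration is an isomorphism `H²(B, ℝ) ≃ ℝ`. On the Klein
bottle a glide reflection changes the sign of the area form, and the same construction works for
every `2`-form.

*Latticed forms.* A latticed `1`-form lifts to a `1`-form on the plane, because its components
modulo `ℤ` lift through `ℝ → ℝ/ℤ`, and the lift changes by a constant integral covector under each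
element of `G` (`IsLatticeCover.exists_lift_latticed`). By Stokes' theorem on a fundamental
domain, the integral of its differential is an integral combination of the periods of the torus;
conversely, linear and quadratic `1`-forms realize all the generators
(`IsLatticeCover.exists_hasLatticedDiff`).

*All other surfaces.* The deck group of `q` acts freely and properly, and since the standard
lattice is discrete, it consists of affine maps with integral linear parts. An affine map without
fixed points has the eigenvalue `1`. It follows that some diffeomorphism of the plane conjugates
the group to the trivial group, to the group generated by one map `(x, y) ↦ (x + c, ±y)`, or to a
torus or Klein bottle group (`ActsProperly.isNormalizable`). In the last two cases `B` is
homeomorphic to the torus or to the Klein bottle. In the first two cases the group is trivial or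
cyclic, so `H²(B, P) = 0`, and `h dx ∧ dy` has the invariant primitive `-(∫₀^y h) dx`, so
`H²(B, ℝ) = 0`.
-/

open scoped Manifold ContDiff Topology

noncomputable section

namespace LagrangianFibration

open Set Filter MeasureTheory

/-! ### Smoothness of fields of alternating forms on the plane -/

section Alternating

variable {k : ℕ} {X : Type*} [NormedAddCommGroup X] [NormedSpace ℝ X]

/-- The alternating forms on the plane are determined by their values on tuples of basis vectors. -/
theorem alternating_ext_basis {f g : Plane [⋀^Fin k]→L[ℝ] ℝ}
    (h : ∀ r : Fin k → Fin 2, f (fun i => EuclideanSpace.single (r i) 1) =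
      g (fun i => EuclideanSpace.single (r i) 1)) : f = g := by
  have := Module.Basis.ext_multilinear (f := f.toMultilinearMap) (g := g.toMultilinearMap)
    (fun _ => (EuclideanSpace.basisFun (Fin 2) ℝ).toBasis) (fun r => by simpa using h r)
  ext v
  exact congrArg (fun m => m v) this

theorem contDiffAt_alternating {n : ℕ∞ω} {f : X → Plane [⋀^Fin k]→L[ℝ] ℝ} {x : X}
    (h : ∀ r : Fin k → Fin 2,
      ContDiffAt ℝ n (fun y => f y (fun i => EuclideanSpace.single (r i) 1)) x) :
    ContDiffAt ℝ n f x := by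
  let φ : (Plane [⋀^Fin k]→L[ℝ] ℝ) →ₗ[ℝ] ((Fin k → Fin 2) → ℝ) :=
    { toFun := fun f r => f (fun i => EuclideanSpace.single (r i) 1)
      map_add' := fun _ _ => rfl
      map_smul' := fun _ _ => rfl }
  have hφ : Function.Injective φ := fun f g hfg => alternating_ext_basis fun r => congrFun hfg r
  obtain ⟨ψ, hψ⟩ := φ.exists_leftInverse_of_injective (LinearMap.ker_eq_bot.2 hφ)
  have h2 : ContDiffAt ℝ n (fun y => φ (f y)) x := contDiffAt_pi.2 h
  have h3 := (LinearMap.toContinuousLinearMap ψ).contDiff.contDiffAt.comp (n := n) x h2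
  refine h3.congr_of_eventuallyEq (Eventually.of_forall fun y => ?_)
  exact (LinearMap.congr_fun hψ (f y)).symm

theorem contDiffAt_alternating_apply {n : ℕ∞ω} {f : X → Plane [⋀^Fin k]→L[ℝ] ℝ} {x : X}
    (h : ContDiffAt ℝ n f x) (v : Fin k → Plane) : ContDiffAt ℝ n (fun y => f y v) x :=
  (ContinuousAlternatingMap.apply ℝ Plane ℝ v).contDiff.contDiffAt.comp (n := n) x h

/-- The pull-back of a smooth field of forms by a smooth field of linear maps is smooth. -/
theorem contDiffAt_alternating_pullback {n : ℕ∞ω} {f : X → Plane [⋀^Fin k]→L[ℝ] ℝ}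
    {g : X → Plane →L[ℝ] Plane} {x : X} (hf : ContDiffAt ℝ n f x) (hg : ContDiffAt ℝ n g x) :
    ContDiffAt ℝ n (fun y => (f y).compContinuousLinearMap (g y)) x := by
  refine contDiffAt_alternating fun r => ?_
  have key : ∀ y, (f y).compContinuousLinearMap (g y) (fun i => EuclideanSpace.single (r i) 1) =
      ∑ s : Fin k → Fin 2, (∏ i, (g y (EuclideanSpace.single (r i) 1)) (s i)) *
        f y (fun i => EuclideanSpace.single (s i) 1) := fun y => by
    have h0 : ∀ i, g y (EuclideanSpace.single (r i) 1) =
        ∑ j, (g y (EuclideanSpace.single (r i) 1)) j • EuclideanSpace.single j (1 : ℝ) :=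
            fun i => by
      ext j; fin_cases j <;> simp
    rw [ContinuousAlternatingMap.compContinuousLinearMap_apply]
    have : (⇑(g y) ∘ fun i => EuclideanSpace.single (r i) (1 : ℝ)) = fun i =>
        ∑ j, (g y (EuclideanSpace.single (r i) 1)) j • EuclideanSpace.single j (1 : ℝ) :=
      funext h0
    rw [this]
    have e := (f y).toMultilinearMap.map_sum
      (fun i j => (g y (EuclideanSpace.single (r i) 1)) j • EuclideanSpace.single j (1 : ℝ))
    refine e.trans (Finset.sum_congr rfl fun s _ => ?_)
    exact (f y).toMultilinearMap.map_smul_univ _ _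
  simp_rw [key]
  refine ContDiffAt.sum fun s _ => ?_
  refine ContDiffAt.mul (contDiffAt_prod fun i _ => ?_) (contDiffAt_alternating_apply hf _)
  exact (EuclideanSpace.proj (𝕜 := ℝ) (s i)).contDiff.contDiffAt.comp (n := n) x
    (hg.clm_apply contDiffAt_const)

end Alternating

/-! ### Differential forms and local diffeomorphisms -/

section LocalDiffeo

variable {B : Type*} [TopologicalSpace B] [ChartedSpace Plane B] {k : ℕ}

theorem pullbackForm_comp (η : FormField B k) {f : Plane → B} {g : Plane → Plane} {e : Plane}
    (hf : MDifferentiableAt 𝓘(ℝ, Plane) 𝓘(ℝ, Plane) f (g e)) (hg : DifferentiableAt ℝ g e) :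
    pullbackForm (f ∘ g) η e = (pullbackForm f η (g e)).compContinuousLinearMap (fderiv ℝ g e) := by
  have h := mfderiv_comp e hf hg.mdifferentiableAt
  rw [mfderiv_eq_fderiv] at h
  unfold pullbackForm
  ext v
  simp only [ContinuousAlternatingMap.compContinuousLinearMap_apply, Function.comp_def]
  rw [show mfderiv 𝓘(ℝ, Plane) 𝓘(ℝ, Plane) (fun x => f (g x)) e = _ from h]
  rfl

theorem pullbackForm_congr (η : FormField B k) {f f' : Plane → B} {e : Plane}
    (h : f =ᶠ[𝓝 e] f') : pullbackForm f η e = pullbackForm f' η e := by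
  have h1 := h.mfderiv_eq (I := 𝓘(ℝ, Plane)) (I' := 𝓘(ℝ, Plane))
  have h2 := h.self_of_nhds
  unfold pullbackForm
  ext v
  have h3 : ∀ (a b : B) (_ : a = b) (w : Fin k → Plane), (η a) w = (η b) w := by
    rintro a _ rfl w; rfl
  exact (h3 _ _ h2 _).trans
    (congrArg (fun L : Plane →L[ℝ] Plane => η (f' e) (fun i => L (v i))) h1)

/-- If two local parametrizations of `B` differ by a smooth map of the plane, then so do the
pull-backs of any field of forms. -/
theorem pullbackForm_eventuallyEq (η : FormField B k) {f f' : Plane → B} {g : Plane → Plane}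
    {e : Plane} (h : f =ᶠ[𝓝 e] f' ∘ g) (hg : ContDiffAt ℝ ∞ g e)
    (hf : ∀ᶠ z in 𝓝 (g e), MDifferentiableAt 𝓘(ℝ, Plane) 𝓘(ℝ, Plane) f' z) :
    pullbackForm f η =ᶠ[𝓝 e]
      fun z => (pullbackForm f' η (g z)).compContinuousLinearMap (fderiv ℝ g z) := by
  have hg' : ∀ᶠ z in 𝓝 e, DifferentiableAt ℝ g z := by
    have := (hg.of_le (m := 1) (by simp)).eventually (by simp)
    exact this.mono fun z hz => hz.differentiableAt (by simp)
  filter_upwards [h.eventuallyEq_nhds, hg', hg.continuousAt.eventually hf] with z h1 h2 h3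
  rw [pullbackForm_congr η h1, pullbackForm_comp η h3 h2]

theorem contDiffAt_pullbackForm_of_comp {η : FormField B k} {f f' : Plane → B} {g : Plane → Plane}
    {e : Plane} (h : f =ᶠ[𝓝 e] f' ∘ g) (hg : ContDiffAt ℝ ∞ g e)
    (hf : ∀ᶠ z in 𝓝 (g e), MDifferentiableAt 𝓘(ℝ, Plane) 𝓘(ℝ, Plane) f' z)
    (hη : ContDiffAt ℝ ∞ (pullbackForm f' η) (g e)) : ContDiffAt ℝ ∞ (pullbackForm f η) e := by
  refine ContDiffAt.congr_of_eventuallyEq ?_ (pullbackForm_eventuallyEq η h hg hf)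
  exact contDiffAt_alternating_pullback (hη.comp e hg) (hg.fderiv_right (by simp))

/-- The relation `dθ = η` may be checked in any local parametrization of `B`. -/
theorem extDeriv_pullbackForm_of_comp {θ : FormField B k} {η : FormField B (k + 1)}
    {f f' : Plane → B} {g : Plane → Plane}
    {e : Plane} (h : f =ᶠ[𝓝 e] f' ∘ g) (hg : ContDiffAt ℝ ∞ g e)
    (hf : ∀ᶠ z in 𝓝 (g e), MDifferentiableAt 𝓘(ℝ, Plane) 𝓘(ℝ, Plane) f' z)
    (hθ : ContDiffAt ℝ ∞ (pullbackForm f' θ) (g e))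
    (hd : extDeriv (pullbackForm f' θ) (g e) = pullbackForm f' η (g e)) :
    extDeriv (pullbackForm f θ) e = pullbackForm f η e := by
  rw [(pullbackForm_eventuallyEq θ h hg hf).extDeriv_eq,
    (pullbackForm_eventuallyEq η h hg hf).self_of_nhds,
    extDeriv_pullback (hθ.differentiableAt (by simp)) hg (r := ∞) (by
      rw [minSmoothness_of_isRCLikeNormedField]; exact WithTop.coe_le_coe.2 le_top), hd]

/-- Every alternating `3`-form on the plane vanishes. -/
theorem alternating_three_eq_zero (f : Plane [⋀^Fin 3]→L[ℝ] ℝ) : f = 0 := by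
  ext v
  refine f.toAlternatingMap.map_linearDependent v fun h => ?_
  have := h.fintype_card_le_finrank
  simp at this

theorem isDiffOn_twoForm (η : FormField B 2) (V : Set B) : IsDiffOn η 0 V := fun _ _ _ _ =>
  (alternating_three_eq_zero _).trans (alternating_three_eq_zero _).symm

variable [IsManifold 𝓘(ℝ, Plane) ∞ B]

theorem mdifferentiableAt_chart_symm {φ : OpenPartialHomeomorph B Plane} (hφ : φ ∈ atlas Plane B)
    {e : Plane} (he : e ∈ φ.target) :
    ∀ᶠ z in 𝓝 e, MDifferentiableAt 𝓘(ℝ, Plane) 𝓘(ℝ, Plane) φ.symm z := by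
  have hs := contMDiffOn_symm_of_mem_maximalAtlas (I := 𝓘(ℝ, Plane)) (n := ∞)
    (IsManifold.subset_maximalAtlas hφ)
  filter_upwards [φ.open_target.mem_nhds he] with z hz
  exact (hs.contMDiffAt (φ.open_target.mem_nhds hz)).mdifferentiableAt (by simp)

/-- A local diffeomorphism `q` onto the surface is, near any point, a chart followed by a
smooth change of coordinates. -/
theorem exists_chart_factor {q : Plane → B} (hq : IsLocalDiffeomorph 𝓘(ℝ, Plane) 𝓘(ℝ, Plane) ∞ q)
    {φ : OpenPartialHomeomorph B Plane} (hφ : φ ∈ atlas Plane B) {z : Plane} (hz : q z ∈ φ.source) :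
    ContDiffAt ℝ ∞ (φ ∘ q) z ∧ q =ᶠ[𝓝 z] φ.symm ∘ (φ ∘ q) := by
  have hc := (contMDiffOn_of_mem_maximalAtlas (I := 𝓘(ℝ, Plane)) (n := ∞)
    (IsManifold.subset_maximalAtlas hφ)).contMDiffAt (φ.open_source.mem_nhds hz)
  refine ⟨contMDiffAt_iff_contDiffAt.1 (hc.comp z hq.contMDiff.contMDiffAt), ?_⟩
  filter_upwards [hq.contMDiff.continuous.continuousAt.eventually (φ.open_source.mem_nhds hz)]
    with w hw
  exact (φ.left_inv hw).symm

theorem exists_lift_factor {q : Plane → B} (hq : IsLocalDiffeomorph 𝓘(ℝ, Plane) 𝓘(ℝ, Plane) ∞ q)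
    {φ : OpenPartialHomeomorph B Plane} (hφ : φ ∈ atlas Plane B) {e z : Plane} (he : e ∈ φ.target)
    (hz : q z = φ.symm e) :
    ∃ g : Plane → Plane, ContDiffAt ℝ ∞ g e ∧ g e = z ∧ φ.symm =ᶠ[𝓝 e] q ∘ g := by
  have hs := (contMDiffOn_symm_of_mem_maximalAtlas (I := 𝓘(ℝ, Plane)) (n := ∞)
    (IsManifold.subset_maximalAtlas hφ)).contMDiffAt (φ.open_target.mem_nhds he)
  have hl := (hq z).localInverse_contMDiffAt
  rw [hz] at hl
  refine ⟨(hq z).localInverse ∘ φ.symm, contMDiffAt_iff_contDiffAt.1 (hl.comp e hs), ?_, ?_⟩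
  · change (hq z).localInverse (φ.symm e) = z
    rw [← hz]
    exact (hq z).localInverse_left_inv (hq z).localInverse_mem_target
  · have hr := (hq z).localInverse_eventuallyEq_right
    rw [hz] at hr
    filter_upwards [hs.continuousAt.eventually hr] with w hw
    exact hw.symm

theorem SmoothOn.contDiffAt_pullback {q : Plane → B}
    (hq : IsLocalDiffeomorph 𝓘(ℝ, Plane) 𝓘(ℝ, Plane) ∞ q) {η : FormField B k} {V : Set B}
    (hη : SmoothOn η V) (hV : IsOpen V) {z : Plane} (hz : q z ∈ V) :
    ContDiffAt ℝ ∞ (pullbackForm q η) z := by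
  have hφ := chart_mem_atlas Plane (q z)
  obtain ⟨h1, h2⟩ := exists_chart_factor hq hφ (mem_chart_source Plane (q z))
  have ht := (chartAt Plane (q z)).map_source (mem_chart_source Plane (q z))
  refine contDiffAt_pullbackForm_of_comp h2 h1 (mdifferentiableAt_chart_symm hφ ht) ?_
  refine (hη _ hφ).contDiffAt (((chartAt Plane (q z)).isOpen_inter_preimage_symm hV).mem_nhds
      ⟨ht, ?_⟩)
  change (chartAt Plane (q z)).symm (chartAt Plane (q z) (q z)) ∈ V
  rwa [(chartAt Plane (q z)).left_inv (mem_chart_source Plane (q z))]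

/-- A field of forms is smooth on `V` as soon as its pull-back under `q` is smooth at some point
over each point of `V`. -/
theorem smoothOn_of_pullback {q : Plane → B}
    (hq : IsLocalDiffeomorph 𝓘(ℝ, Plane) 𝓘(ℝ, Plane) ∞ q) {η : FormField B k} {V : Set B}
    (h : ∀ y ∈ V, ∃ z, q z = y ∧ ContDiffAt ℝ ∞ (pullbackForm q η) z) : SmoothOn η V := by
  rintro φ hφ e ⟨he, heV⟩
  obtain ⟨z, hz, hs⟩ := h _ heV
  obtain ⟨g, hg, hgz, hfac⟩ := exists_lift_factor hq hφ he hz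
  refine (contDiffAt_pullbackForm_of_comp hfac hg (Eventually.of_forall fun w =>
    hq.mdifferentiable (by simp) w) ?_).contDiffWithinAt
  rwa [hgz]

theorem isDiffOn_of_pullback {q : Plane → B}
    (hq : IsLocalDiffeomorph 𝓘(ℝ, Plane) 𝓘(ℝ, Plane) ∞ q) {θ : FormField B k}
    {η : FormField B (k + 1)} {V : Set B}
    (h : ∀ y ∈ V, ∃ z, q z = y ∧ ContDiffAt ℝ ∞ (pullbackForm q θ) z ∧
      extDeriv (pullbackForm q θ) z = pullbackForm q η z) : IsDiffOn θ η V := by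
  rintro φ hφ e ⟨he, heV⟩
  obtain ⟨z, hz, hs, hd⟩ := h _ heV
  obtain ⟨g, hg, rfl, hfac⟩ := exists_lift_factor hq hφ he hz
  exact extDeriv_pullbackForm_of_comp hfac hg (Eventually.of_forall fun w =>
    hq.mdifferentiable (by simp) w) hs hd

theorem IsDiffOn.extDeriv_pullback {q : Plane → B}
    (hq : IsLocalDiffeomorph 𝓘(ℝ, Plane) 𝓘(ℝ, Plane) ∞ q) {θ : FormField B k}
    {η : FormField B (k + 1)} {V : Set B} (hV : IsOpen V) (hθ : SmoothOn θ V)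
    (h : IsDiffOn θ η V) {z : Plane} (hz : q z ∈ V) :
    extDeriv (pullbackForm q θ) z = pullbackForm q η z := by
  have hφ := chart_mem_atlas Plane (q z)
  obtain ⟨h1, h2⟩ := exists_chart_factor hq hφ (mem_chart_source Plane (q z))
  have ht := (chartAt Plane (q z)).map_source (mem_chart_source Plane (q z))
  have hm : (chartAt Plane (q z) ∘ q) z ∈ (chartAt Plane (q z)).target ∩
      (chartAt Plane (q z)).symm ⁻¹' V := by
    refine ⟨ht, ?_⟩
    change (chartAt Plane (q z)).symm (chartAt Plane (q z) (q z)) ∈ V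
    rwa [(chartAt Plane (q z)).left_inv (mem_chart_source Plane (q z))]
  refine extDeriv_pullbackForm_of_comp h2 h1 (mdifferentiableAt_chart_symm hφ ht) ?_ (h _ hφ _ hm)
  exact (hθ _ hφ).contDiffAt (((chartAt Plane (q z)).isOpen_inter_preimage_symm hV).mem_nhds hm)

end LocalDiffeo

/-! ### Quotients of the plane and descent of invariant forms -/

section Descent

variable {B : Type*} [TopologicalSpace B] [ChartedSpace Plane B]

/-- `q : ℝ² → B` is a smooth covering of `B` by the plane whose fibres are the orbits of the
group `G`, so that `B = ℝ²/G`. -/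
structure IsQuotientBy (G : Subgroup (Equiv.Perm Plane)) (q : Plane → B) : Prop where
  isCoveringMap : IsCoveringMap q
  surjective : Function.Surjective q
  isLocalDiffeomorph : IsLocalDiffeomorph 𝓘(ℝ, Plane) 𝓘(ℝ, Plane) ∞ q
  fibers : ∀ z z' : Plane, q z = q z' ↔ ∃ g ∈ G, g z = z'

theorem IsPresentation.isQuotientBy {P : CotangentLattice B} {G : Subgroup (Equiv.Perm Plane)}
    {q : Plane → B} (h : IsPresentation P G q) : IsQuotientBy G q :=
  ⟨h.isCoveringMap, h.surjective, h.isLocalDiffeomorph, h.fibers⟩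

/-- The group of diffeomorphisms of the plane. -/
def smoothPerms : Subgroup (Equiv.Perm Plane) where
  carrier := {g | ContDiff ℝ ∞ g ∧ ContDiff ℝ ∞ g.symm}
  mul_mem' := fun ha hb => ⟨ha.1.comp hb.1, hb.2.comp ha.2⟩
  one_mem' := ⟨contDiff_id, contDiff_id⟩
  inv_mem' := fun h => ⟨h.2, h.1⟩

/-- The diffeomorphisms of the plane that preserve the field of forms `θ`. -/
def formStabilizer {k : ℕ} (θ : Plane → Plane [⋀^Fin k]→L[ℝ] ℝ) : Subgroup (Equiv.Perm Plane) where
  carrier := {g | g ∈ smoothPerms ∧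
    ∀ z, (θ (g z)).compContinuousLinearMap (fderiv ℝ g z) = θ z}
  mul_mem' := by
    rintro a b ⟨ha, ha'⟩ ⟨hb, hb'⟩
    refine ⟨mul_mem ha hb, fun z => ?_⟩
    have h1 : fderiv ℝ (⇑(a * b)) z = (fderiv ℝ a (b z)).comp (fderiv ℝ b z) :=
      fderiv_comp z (ha.1.differentiable (by simp) _) (hb.1.differentiable (by simp) _)
    rw [h1, ← hb' z, ← ha' (b z)]
    rfl
  one_mem' := by
    refine ⟨one_mem _, fun z => ?_⟩
    have h1 : fderiv ℝ (⇑(1 : Equiv.Perm Plane)) z = ContinuousLinearMap.id ℝ Plane := fderiv_id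
    rw [h1]; rfl
  inv_mem' := by
    rintro a ⟨ha, ha'⟩
    refine ⟨inv_mem ha, fun z => ?_⟩
    have h1 : (fderiv ℝ a (a⁻¹ z)).comp (fderiv ℝ (⇑(a⁻¹)) z) = ContinuousLinearMap.id ℝ Plane := by
      have h0 := fderiv_comp (𝕜 := ℝ) (g := ⇑a) (f := ⇑(a⁻¹)) z
        (ha.1.differentiable (by simp) _) (ha.2.differentiable (by simp) _)
      have : ⇑a ∘ ⇑(a⁻¹) = id := by ext1 w; simp
      rw [← h0, this]; exact fderiv_id
    have h2 := ha' (a⁻¹ z)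
    rw [show a (a⁻¹ z) = z by simp] at h2
    rw [← h2]
    have h3 : (θ z).compContinuousLinearMap ((fderiv ℝ a (a⁻¹ z)).comp (fderiv ℝ (⇑(a⁻¹)) z)) =
        θ z := by
      rw [h1]; rfl
    exact h3

/-- A `G`-invariant field of forms on the plane is the pull-back of a field of forms on `ℝ²/G`. -/
theorem IsQuotientBy.exists_pullbackForm_eq {G : Subgroup (Equiv.Perm Plane)} {q : Plane → B}
    (hq : IsQuotientBy G q) {k : ℕ} {θ : Plane → Plane [⋀^Fin k]→L[ℝ] ℝ}
    (hθ : G ≤ formStabilizer θ) : ∃ η : FormField B k, pullbackForm q η = θ := by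
  let E : ∀ z : Plane, Plane ≃L[ℝ] Plane := fun z =>
    (hq.isLocalDiffeomorph z).mfderivToContinuousLinearEquiv (by simp)
  have hE : ∀ z, (E z : Plane →L[ℝ] Plane) = mfderiv 𝓘(ℝ, Plane) 𝓘(ℝ, Plane) q z := fun z => rfl
  let s : B → Plane := Function.surjInv hq.surjective
  let η : FormField B k := fun x =>
    ((θ (s x)).compContinuousLinearMap ((E (s x)).symm : Plane →L[ℝ] Plane) :
      Plane [⋀^Fin k]→L[ℝ] ℝ)
  refine ⟨η, funext fun z => ?_⟩
  obtain ⟨g, hg, hgz⟩ := (hq.fibers z (s (q z))).1 (Function.surjInv_eq hq.surjective (q z)).symm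
  obtain ⟨hgs, hgθ⟩ := hθ hg
  have hqg : q ∘ g = q := funext fun w => ((hq.fibers w (g w)).2 ⟨g, hg, rfl⟩).symm
  have hd : (E z : Plane →L[ℝ] Plane) = (E (g z) : Plane →L[ℝ] Plane).comp (fderiv ℝ g z) := by
    have h1 := mfderiv_comp z (hq.isLocalDiffeomorph.mdifferentiable (by simp) (g z))
      ((hgs.1.differentiable (by simp) z).mdifferentiableAt)
    rw [mfderiv_eq_fderiv] at h1
    have h2 : mfderiv 𝓘(ℝ, Plane) 𝓘(ℝ, Plane) (q ∘ g) z = mfderiv 𝓘(ℝ, Plane) 𝓘(ℝ, Plane) q z := by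
      rw [hqg]
    rw [hE, hE]
    exact h2.symm.trans h1
  ext v
  have h3 : pullbackForm q η z v = θ (s (q z)) (fun i => (E (s (q z))).symm (E z (v i))) := rfl
  rw [h3, ← hgz, ← hgθ z]
  have h4 : ∀ w, (E (g z)).symm (E z w) = fderiv ℝ g z w := fun w => by
    have : E z w = E (g z) (fderiv ℝ g z w) := congrArg (fun L : Plane →L[ℝ] Plane => L w) hd
    rw [this, ContinuousLinearEquiv.symm_apply_apply]
  simp_rw [h4]
  rfl

/-- The pull-back of a form on `ℝ²/G` to the plane is `G`-invariant. -/
theorem IsQuotientBy.le_formStabilizer {G : Subgroup (Equiv.Perm Plane)} {q : Plane → B}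
    (hq : IsQuotientBy G q) (hG : G ≤ smoothPerms) {k : ℕ} (η : FormField B k) :
    G ≤ formStabilizer (pullbackForm q η) := by
  refine fun g hg => ⟨hG hg, fun z => ?_⟩
  have hqg : q ∘ g = q := funext fun w => ((hq.fibers w (g w)).2 ⟨g, hg, rfl⟩).symm
  rw [← pullbackForm_comp η (hq.isLocalDiffeomorph.mdifferentiable (by simp) _)
    ((hG hg).1.differentiable (by simp) z), hqg]

/-- Covector fields are the same as fields of alternating `1`-forms. -/
theorem exists_toForm_eq (η : FormField B 1) : ∃ α : CovectorField B, toForm α = η :=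
  ⟨fun x => (ContinuousAlternatingMap.ofSubsingleton ℝ (TangentSpace 𝓘(ℝ, Plane) x) ℝ
    (0 : Fin 1)).symm (η x), funext fun _ => Equiv.apply_symm_apply _ _⟩

end Descent

/-! ### Coordinate expressions of forms on the plane -/

section Coordinates

/-- The `1`-form `P dx + Q dy`. -/
def oneForm (P Q : Plane → ℝ) (z : Plane) : Plane [⋀^Fin 1]→L[ℝ] ℝ :=
  ContinuousAlternatingMap.ofSubsingleton ℝ Plane ℝ (0 : Fin 1)
    (P z • EuclideanSpace.proj (0 : Fin 2) + Q z • EuclideanSpace.proj (1 : Fin 2))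

/-- The area form `dx ∧ dy`. -/
def areaForm : Plane [⋀^Fin 2]→L[ℝ] ℝ :=
  ContinuousMultilinearMap.alternatization
    ((ContinuousMultilinearMap.mkPiAlgebra ℝ (Fin 2) ℝ).compContinuousLinearMap
      fun i => EuclideanSpace.proj i)

/-- The `2`-form `h dx ∧ dy`. -/
def twoForm (h : Plane → ℝ) (z : Plane) : Plane [⋀^Fin 2]→L[ℝ] ℝ := h z • areaForm

theorem oneForm_apply (P Q : Plane → ℝ) (z : Plane) (v : Fin 1 → Plane) :
    oneForm P Q z v = P z * v 0 0 + Q z * v 0 1 := by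
  simp [oneForm]

theorem areaForm_apply (v : Fin 2 → Plane) :
    areaForm v = v 0 0 * v 1 1 - v 1 0 * v 0 1 := by
  rw [areaForm, ContinuousMultilinearMap.alternatization_apply_apply]
  have : (Finset.univ : Finset (Equiv.Perm (Fin 2))) = {1, Equiv.swap 0 1} := by decide
  rw [this, Finset.sum_pair (by decide)]
  simp [Fin.prod_univ_two, sub_eq_add_neg, Units.smul_def]

theorem twoForm_apply (h : Plane → ℝ) (z : Plane) (v : Fin 2 → Plane) :
    twoForm h z v = h z * (v 0 0 * v 1 1 - v 1 0 * v 0 1) := by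
  rw [← areaForm_apply]; rfl

theorem eq_smul_areaForm (θ : Plane [⋀^Fin 2]→L[ℝ] ℝ) :
    θ = θ ![EuclideanSpace.single 0 1, EuclideanSpace.single 1 1] • areaForm := by
  refine alternating_ext_basis fun r => ?_
  rw [ContinuousAlternatingMap.smul_apply, areaForm_apply]
  obtain h | h : r 0 = r 1 ∨ r 0 ≠ r 1 := em _
  · have e : θ (fun i => EuclideanSpace.single (r i) 1) = 0 :=
      θ.map_eq_zero_of_eq _ (i := 0) (j := 1) (by simp [h]) (by simp)
    rw [e, h]; simp [mul_comm]
  · have hc : (r 0 = 0 ∧ r 1 = 1) ∨ (r 0 = 1 ∧ r 1 = 0) := by omega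
    rcases hc with ⟨h0, h1⟩ | ⟨h0, h1⟩
    · have : (fun i => EuclideanSpace.single (r i) (1 : ℝ)) =
          ![EuclideanSpace.single 0 1, EuclideanSpace.single 1 1] := by
        ext i; fin_cases i <;> simp [h0, h1]
      rw [this]; simp [h0, h1]
    · have : (fun i => EuclideanSpace.single (r i) (1 : ℝ)) =
          ![EuclideanSpace.single 0 (1 : ℝ), EuclideanSpace.single 1 1] ∘ Equiv.swap 0 1 := by
        ext i; fin_cases i <;> simp [h0, h1]
      rw [this]
      have h2 := θ.toAlternatingMap.map_swap
        ![EuclideanSpace.single 0 (1 : ℝ), EuclideanSpace.single 1 1] (i := 0) (j := 1) (by simp)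
      refine Eq.trans h2 ?_
      simp [h0, h1]

theorem eq_oneForm (θ : Plane → Plane [⋀^Fin 1]→L[ℝ] ℝ) :
    θ = oneForm (fun z => θ z fun _ => EuclideanSpace.single 0 1)
      (fun z => θ z fun _ => EuclideanSpace.single 1 1) := by
  funext z
  refine alternating_ext_basis fun r => ?_
  rw [oneForm_apply]
  have : (fun i => EuclideanSpace.single (r i) (1 : ℝ)) =
      fun _ => EuclideanSpace.single (r 0) 1 := by
    funext i; rw [Subsingleton.elim i 0]
  rw [this]
  obtain h | h : r 0 = 0 ∨ r 0 = 1 := by omega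
  all_goals simp [h]

theorem contDiff_coord (i : Fin 2) : ContDiff ℝ ∞ (fun z : Plane => z i) :=
  (EuclideanSpace.proj (𝕜 := ℝ) i).contDiff

theorem contDiff_mk {X : Type*} [NormedAddCommGroup X] [NormedSpace ℝ X] {n : ℕ∞ω} {f g : X → ℝ}
    (hf : ContDiff ℝ n f) (hg : ContDiff ℝ n g) : ContDiff ℝ n (fun x =>
        (!₂[f x, g x] : Plane)) := by
  rw [contDiff_euclidean]
  intro i; fin_cases i
  exacts [hf, hg]

theorem contDiff_oneForm {P Q : Plane → ℝ} (hP : ContDiff ℝ ∞ P) (hQ : ContDiff ℝ ∞ Q) :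
    ContDiff ℝ ∞ (oneForm P Q) := by
  refine contDiff_iff_contDiffAt.2 fun x => contDiffAt_alternating fun r => ?_
  simp_rw [oneForm_apply]
  exact ((hP.mul contDiff_const).add (hQ.mul contDiff_const)).contDiffAt

theorem contDiff_twoForm {h : Plane → ℝ} (hh : ContDiff ℝ ∞ h) : ContDiff ℝ ∞ (twoForm h) :=
  hh.smul contDiff_const

theorem extDeriv_oneForm {P Q : Plane → ℝ} (hP : ContDiff ℝ ∞ P) (hQ : ContDiff ℝ ∞ Q)
    (z : Plane) : extDeriv (oneForm P Q) z =
      (fderiv ℝ Q z (EuclideanSpace.single 0 1) - fderiv ℝ P z (EuclideanSpace.single 1 1)) •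
        areaForm := by
  rw [eq_smul_areaForm (extDeriv (oneForm P Q) z),
    extDeriv_apply ((contDiff_oneForm hP hQ).differentiable (by simp) z)]
  congr 1
  rw [Fin.sum_univ_two]
  have h0 : (fun x => oneForm P Q x ((0 : Fin 2).removeNth
      (![EuclideanSpace.single 0 1, EuclideanSpace.single 1 1] : Fin 2 → Plane))) = Q := by
    funext x; rw [oneForm_apply]; simp [Fin.removeNth]
  have h1 : (fun x => oneForm P Q x ((1 : Fin 2).removeNth
      (![EuclideanSpace.single 0 1, EuclideanSpace.single 1 1] : Fin 2 → Plane))) = P := by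
    funext x; rw [oneForm_apply]; simp [Fin.removeNth, Fin.succAbove]
  rw [h0, h1]
  simp [sub_eq_add_neg]

theorem units_coe_mul_self (ε : ℤˣ) : ((ε : ℤ) : ℝ) * ((ε : ℤ) : ℝ) = 1 := by
  rcases Int.units_eq_one_or ε with rfl | rfl <;> simp

/-- The linear part `(1 k; 0 ε)`. -/
def upperLin (k ε : ℝ) : Plane →L[ℝ] Plane :=
  LinearMap.toContinuousLinearMap
    { toFun := fun v => !₂[v 0 + k * v 1, ε * v 1]
      map_add' := fun v w => by ext i; fin_cases i <;> simp <;> ring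
      map_smul' := fun c v => by ext i; fin_cases i <;> simp <;> ring }

theorem upperLin_apply (k ε : ℝ) (v : Plane) : upperLin k ε v = !₂[v 0 + k * v 1, ε * v 1] := rfl

theorem upperAff_apply (k : ℤ) (ε : ℤˣ) (c d : ℝ) (z : Plane) :
    upperAff k ε c d z = !₂[z 0 + k * z 1 + c, ((ε : ℤ) : ℝ) * z 1 + d] := rfl

theorem fderiv_upperAff (k : ℤ) (ε : ℤˣ) (c d : ℝ) (z : Plane) :
    fderiv ℝ (upperAff k ε c d) z = upperLin k ((ε : ℤ) : ℝ) := by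
  have h : ⇑(upperAff k ε c d) = fun z => upperLin k ((ε : ℤ) : ℝ) z + !₂[c, d] := by
    funext z; ext i; fin_cases i <;> simp [upperAff_apply, upperLin_apply]
  rw [h]
  exact ((upperLin k ((ε : ℤ) : ℝ)).hasFDerivAt.add_const _).fderiv

theorem upperAff_mem_smoothPerms (k : ℤ) (ε : ℤˣ) (c d : ℝ) : upperAff k ε c d ∈ smoothPerms := by
  have h0 := contDiff_coord 0
  have h1 := contDiff_coord 1
  refine ⟨?_, ?_⟩
  · exact contDiff_mk ((h0.add (contDiff_const.mul h1)).add contDiff_const)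
      ((contDiff_const.mul h1).add contDiff_const)
  · exact contDiff_mk ((h0.sub contDiff_const).sub
      (contDiff_const.mul (contDiff_const.mul (h1.sub contDiff_const))))
      (contDiff_const.mul (h1.sub contDiff_const))

theorem upperAff_mem_formStabilizer_oneForm {ε : ℤˣ} {c d : ℝ} {P Q : Plane → ℝ}
    (hP : ∀ z, P (upperAff 0 ε c d z) = P z)
    (hQ : ∀ z, Q (upperAff 0 ε c d z) = ((ε : ℤ) : ℝ) * Q z) :
    upperAff 0 ε c d ∈ formStabilizer (oneForm P Q) := by
  refine ⟨upperAff_mem_smoothPerms _ _ _ _, fun z => ?_⟩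
  rw [fderiv_upperAff]
  ext v
  have hε := units_coe_mul_self ε
  rw [ContinuousAlternatingMap.compContinuousLinearMap_apply, oneForm_apply, oneForm_apply, hP, hQ]
  simp [upperLin_apply]
  linear_combination (Q z * v 0 1) * hε

/-- The map `upperAff k ε c d` has determinant `ε`. -/
theorem mem_formStabilizer_twoForm_iff {k : ℤ} {ε : ℤˣ} {c d : ℝ} {h : Plane → ℝ} :
    upperAff k ε c d ∈ formStabilizer (twoForm h) ↔
      ∀ z, h (upperAff k ε c d z) = ((ε : ℤ) : ℝ) * h z := by
  have hε := units_coe_mul_self ε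
  refine ⟨fun H z => ?_, fun H => ⟨upperAff_mem_smoothPerms _ _ _ _, fun z => ?_⟩⟩
  · have h1 := H.2 z
    rw [fderiv_upperAff] at h1
    have h2 := congrArg (fun f => f ![EuclideanSpace.single 0 1, EuclideanSpace.single 1 1]) h1
    simp only [ContinuousAlternatingMap.compContinuousLinearMap_apply, twoForm_apply] at h2
    simp [upperLin_apply] at h2
    linear_combination ((ε : ℤ) : ℝ) * h2 - h (upperAff k ε c d z) * hε
  · rw [fderiv_upperAff]
    ext v
    rw [ContinuousAlternatingMap.compContinuousLinearMap_apply, twoForm_apply, twoForm_apply, H]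
    simp [upperLin_apply]
    linear_combination (h z * (v 0 0 * v 1 1 - v 1 0 * v 0 1)) * hε

end Coordinates

/-! ### Primitives of smooth functions -/

section Primitives

/-- Differentiation under the integral sign. -/
theorem hasFDerivAt_integral {f : Plane × ℝ → ℝ} (hf : ContDiff ℝ 1 f) (z : Plane) :
    HasFDerivAt (fun z => ∫ t in (0 : ℝ)..1, f (z, t))
      (∫ t in (0 : ℝ)..1, (fderiv ℝ f (z, t)).comp (ContinuousLinearMap.inl ℝ Plane ℝ)) z := by
  have hc : Continuous (fun p : Plane × ℝ =>
      (fderiv ℝ f p).comp (ContinuousLinearMap.inl ℝ Plane ℝ)) :=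
    (hf.continuous_fderiv (by simp)).clm_comp continuous_const
  have hK : IsCompact (Metric.closedBall z 1 ×ˢ Icc (0 : ℝ) 1) :=
    (isCompact_closedBall z 1).prod isCompact_Icc
  obtain ⟨C, hC⟩ := hK.exists_bound_of_continuousOn hc.continuousOn
  refine intervalIntegral.hasFDerivAt_integral_of_dominated_of_fderiv_le
    (F := fun z t => f (z, t))
    (F' := fun z t => (fderiv ℝ f (z, t)).comp (ContinuousLinearMap.inl ℝ Plane ℝ))
    (s := Metric.closedBall z 1) (bound := fun _ => C) (Metric.closedBall_mem_nhds z one_pos)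
    ?_ ?_ ?_ ?_ ?_ ?_
  · exact Eventually.of_forall fun w =>
      (hf.continuous.comp (Continuous.prodMk_right w)).aestronglyMeasurable
  · exact (hf.continuous.comp (Continuous.prodMk_right z)).intervalIntegrable _ _
  · exact (hc.comp (Continuous.prodMk_right z)).aestronglyMeasurable
  · refine Eventually.of_forall fun t ht w hw => hC (w, t) ⟨hw, ?_⟩
    rw [uIoc_of_le zero_le_one] at ht
    exact ⟨ht.1.le, ht.2⟩
  · exact intervalIntegrable_const
  · refine Eventually.of_forall fun t _ w _ => ?_
    have h1 := (hf.differentiable (by simp) (w, t)).hasFDerivAt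
    exact h1.comp w (hasFDerivAt_prodMk_left w t)

theorem contDiff_integral_nat (n : ℕ) : ∀ {f : Plane × ℝ → ℝ}, ContDiff ℝ ∞ f →
    ContDiff ℝ n (fun z => ∫ t in (0 : ℝ)..1, f (z, t)) := by
  induction n with
  | zero =>
    intro f hf
    refine contDiff_zero.2 ?_
    exact continuous_iff_continuousAt.2 fun z =>
      (hasFDerivAt_integral (hf.of_le (by simp)) z).continuousAt
  | succ n ih =>
    intro f hf
    have h1 : ContDiff ℝ 1 f := hf.of_le (by simp)
    have h2 := contDiff_succ_iff_fderiv_apply (𝕜 := ℝ) (n := n)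
      (f := fun z => ∫ t in (0 : ℝ)..1, f (z, t))
    refine h2.2 ⟨fun z => (hasFDerivAt_integral h1 z).differentiableAt, by simp, fun y => ?_⟩
    have h3 : ∀ z, fderiv ℝ (fun z => ∫ t in (0 : ℝ)..1, f (z, t)) z y =
        ∫ t in (0 : ℝ)..1, fderiv ℝ f (z, t) (y, 0) := fun z => by
      rw [(hasFDerivAt_integral h1 z).fderiv, ContinuousLinearMap.intervalIntegral_apply]
      · rfl
      · exact (((h1.continuous_fderiv (by simp)).clm_comp continuous_const).comp
          (Continuous.prodMk_right z)).intervalIntegrable _ _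
    simp_rw [h3]
    exact ih (f := fun p => fderiv ℝ f p (y, 0))
      ((hf.fderiv_right (by simp)).clm_apply contDiff_const)

/-- Smooth dependence of an integral on parameters. -/
theorem contDiff_integral {f : Plane × ℝ → ℝ} (hf : ContDiff ℝ ∞ f) :
    ContDiff ℝ ∞ (fun z => ∫ t in (0 : ℝ)..1, f (z, t)) :=
  contDiff_infty.2 fun n => contDiff_integral_nat n hf

/-- The primitive of `f` along the first coordinate, vanishing on the second axis. -/
def primX (f : Plane → ℝ) (z : Plane) : ℝ := ∫ s in (0 : ℝ)..z 0, f !₂[s, z 1]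

/-- The primitive of `f` along the second coordinate, vanishing on the first axis. -/
def primY (f : Plane → ℝ) (z : Plane) : ℝ := ∫ s in (0 : ℝ)..z 1, f !₂[z 0, s]

theorem contDiff_primX {f : Plane → ℝ} (hf : ContDiff ℝ ∞ f) : ContDiff ℝ ∞ (primX f) := by
  have h : primX f = fun z => z 0 * ∫ t in (0 : ℝ)..1, f !₂[z 0 * t, z 1] := by
    funext z
    have := intervalIntegral.mul_integral_comp_mul_left (a := 0) (b := 1)
      (f := fun s => f !₂[s, z 1]) (c := z 0)
    rw [primX, this]; simp
  rw [h]
  refine (contDiff_coord 0).mul (contDiff_integral (f := fun p => f !₂[p.1 0 * p.2, p.1 1]) ?_)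
  exact hf.comp (contDiff_mk (((contDiff_coord 0).comp contDiff_fst).mul contDiff_snd)
    ((contDiff_coord 1).comp contDiff_fst))

theorem contDiff_primY {f : Plane → ℝ} (hf : ContDiff ℝ ∞ f) : ContDiff ℝ ∞ (primY f) := by
  have h : primY f = fun z => z 1 * ∫ t in (0 : ℝ)..1, f !₂[z 0, z 1 * t] := by
    funext z
    have := intervalIntegral.mul_integral_comp_mul_left (a := 0) (b := 1)
      (f := fun s => f !₂[z 0, s]) (c := z 1)
    rw [primY, this]; simp
  rw [h]
  refine (contDiff_coord 1).mul (contDiff_integral (f := fun p => f !₂[p.1 0, p.1 1 * p.2]) ?_)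
  exact hf.comp (contDiff_mk ((contDiff_coord 0).comp contDiff_fst)
    (((contDiff_coord 1).comp contDiff_fst).mul contDiff_snd))

theorem mk_coord (z : Plane) : (!₂[z 0, z 1] : Plane) = z := by
  ext i; fin_cases i <;> rfl

/-- The partial derivative along the first axis, as the derivative of a function of one variable. -/
theorem hasDerivAt_lineX {F : Plane → ℝ} (hF : ContDiff ℝ ∞ F) (x y : ℝ) :
    HasDerivAt (fun s => F !₂[s, y]) (fderiv ℝ F !₂[x, y] (EuclideanSpace.single 0 1)) x := by
  have h1 : HasDerivAt (fun s : ℝ => (!₂[s, y] : Plane)) (EuclideanSpace.single 0 1) x := by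
    have e : (fun s : ℝ => (!₂[s, y] : Plane)) =
        fun s => s • EuclideanSpace.single 0 (1 : ℝ) + !₂[0, y] := by
      funext s; ext i; fin_cases i <;> simp
    rw [e]
    simpa using ((hasDerivAt_id x).smul_const (EuclideanSpace.single (0 : Fin 2) (1 : ℝ))).add_const
      (!₂[0, y] : Plane)
  exact (hF.differentiable (by simp) _).hasFDerivAt.comp_hasDerivAt x h1

theorem hasDerivAt_lineY {F : Plane → ℝ} (hF : ContDiff ℝ ∞ F) (x y : ℝ) :
    HasDerivAt (fun s => F !₂[x, s]) (fderiv ℝ F !₂[x, y] (EuclideanSpace.single 1 1)) y := by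
  have h1 : HasDerivAt (fun s : ℝ => (!₂[x, s] : Plane)) (EuclideanSpace.single 1 1) y := by
    have e : (fun s : ℝ => (!₂[x, s] : Plane)) =
        fun s => s • EuclideanSpace.single 1 (1 : ℝ) + !₂[x, 0] := by
      funext s; ext i; fin_cases i <;> simp
    rw [e]
    simpa using ((hasDerivAt_id y).smul_const (EuclideanSpace.single (1 : Fin 2) (1 : ℝ))).add_const
      (!₂[x, 0] : Plane)
  exact (hF.differentiable (by simp) _).hasFDerivAt.comp_hasDerivAt y h1

theorem continuous_lineX {f : Plane → ℝ} (hf : Continuous f) (y : ℝ) :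
    Continuous fun s => f !₂[s, y] := by
  refine hf.comp ?_
  exact (contDiff_mk (n := 0) contDiff_id contDiff_const).continuous

theorem continuous_lineY {f : Plane → ℝ} (hf : Continuous f) (x : ℝ) :
    Continuous fun s => f !₂[x, s] := by
  refine hf.comp ?_
  exact (contDiff_mk (n := 0) contDiff_const contDiff_id).continuous

theorem fderiv_primX {f : Plane → ℝ} (hf : ContDiff ℝ ∞ f) (z : Plane) :
    fderiv ℝ (primX f) z (EuclideanSpace.single 0 1) = f z := by
  have h1 := hasDerivAt_lineX (contDiff_primX hf) (z 0) (z 1)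
  rw [mk_coord] at h1
  have h2 := (continuous_lineX hf.continuous (z 1)).integral_hasStrictDerivAt 0 (z 0)
  have h3 := h1.unique h2.hasDerivAt
  rwa [mk_coord] at h3

theorem fderiv_primY {f : Plane → ℝ} (hf : ContDiff ℝ ∞ f) (z : Plane) :
    fderiv ℝ (primY f) z (EuclideanSpace.single 1 1) = f z := by
  have h1 := hasDerivAt_lineY (contDiff_primY hf) (z 0) (z 1)
  rw [mk_coord] at h1
  have h2 := (continuous_lineY hf.continuous (z 0)).integral_hasStrictDerivAt 0 (z 1)
  have h3 := h1.unique h2.hasDerivAt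
  rwa [mk_coord] at h3

/-- A function of the second coordinate alone is constant along the first axis. -/
theorem fderiv_single_zero_of_const {F : Plane → ℝ} (hF : ContDiff ℝ ∞ F)
    (h : ∀ x x' y, F !₂[x, y] = F !₂[x', y]) (z : Plane) :
    fderiv ℝ F z (EuclideanSpace.single 0 1) = 0 := by
  have h1 := hasDerivAt_lineX hF (z 0) (z 1)
  rw [mk_coord] at h1
  have h2 : (fun s => F !₂[s, z 1]) = fun _ => F !₂[0, z 1] := funext fun s => h _ _ _
  rw [h2] at h1
  exact h1.unique (hasDerivAt_const _ _)

end Primitives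

/-! ### Closed forms on quotients of the plane -/

section DeRham

variable {B : Type*} [TopologicalSpace B] [ChartedSpace Plane B]

/-- A `2`-form on `ℝ²/G` is exact as soon as its pull-back to the plane has a `G`-invariant
primitive. -/
theorem IsQuotientBy.mem_exactTwoForms [IsManifold 𝓘(ℝ, Plane) ∞ B]
    {G : Subgroup (Equiv.Perm Plane)} {q : Plane → B}
    (hq : IsQuotientBy G q) {η : FormField B 2} (hη : SmoothOn η Set.univ) {P Q : Plane → ℝ}
    (hP : ContDiff ℝ ∞ P) (hQ : ContDiff ℝ ∞ Q) (hG : G ≤ formStabilizer (oneForm P Q))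
    (hd : ∀ z, extDeriv (oneForm P Q) z = pullbackForm q η z) : η ∈ exactTwoForms B := by
  obtain ⟨θ, hθ⟩ := hq.exists_pullbackForm_eq hG
  obtain ⟨α, rfl⟩ := exists_toForm_eq θ
  refine ⟨hη, α, smoothOn_of_pullback hq.isLocalDiffeomorph fun y _ => ?_,
    isDiffOn_of_pullback hq.isLocalDiffeomorph fun y _ => ?_⟩
  all_goals
    obtain ⟨z, rfl⟩ := hq.surjective y
    refine ⟨z, rfl, ?_⟩
    rw [hθ]
  · exact (contDiff_oneForm hP hQ).contDiffAt
  · exact ⟨(contDiff_oneForm hP hQ).contDiffAt, hd z⟩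

/-- The coefficient of the pull-back of a `2`-form to the plane. -/
def coeff (q : Plane → B) (η : FormField B 2) (z : Plane) : ℝ :=
  pullbackForm q η z ![EuclideanSpace.single 0 1, EuclideanSpace.single 1 1]

theorem pullbackForm_eq_twoForm (q : Plane → B) (η : FormField B 2) :
    pullbackForm q η = twoForm (coeff q η) :=
  funext fun z => eq_smul_areaForm (pullbackForm q η z)

theorem contDiff_coeff [IsManifold 𝓘(ℝ, Plane) ∞ B] {q : Plane → B}
    (hq : IsLocalDiffeomorph 𝓘(ℝ, Plane) 𝓘(ℝ, Plane) ∞ q)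
    {η : FormField B 2} (hη : SmoothOn η Set.univ) : ContDiff ℝ ∞ (coeff q η) :=
  contDiff_iff_contDiffAt.2 fun z => contDiffAt_alternating_apply
    (hη.contDiffAt_pullback hq isOpen_univ (mem_univ (q z))) _

theorem IsQuotientBy.coeff_upperAff {G : Subgroup (Equiv.Perm Plane)} {q : Plane → B}
    (hq : IsQuotientBy G q) (hG : G ≤ smoothPerms) (η : FormField B 2) {k : ℤ} {ε : ℤˣ} {c d : ℝ}
    (hg : upperAff k ε c d ∈ G) (z : Plane) :
    coeff q η (upperAff k ε c d z) = ((ε : ℤ) : ℝ) * coeff q η z := by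
  have := hq.le_formStabilizer hG η hg
  rw [pullbackForm_eq_twoForm] at this
  exact mem_formStabilizer_twoForm_iff.1 this z

theorem subsingleton_deRhamH2 (h : ∀ η ∈ closedTwoForms B, η ∈ exactTwoForms B) :
    Subsingleton (DeRhamH2 B) := by
  refine Submodule.Quotient.subsingleton_iff.2 (eq_top_iff.2 fun η _ => ?_)
  exact h η η.2

theorem closure_le_smoothPerms {S : Set (Equiv.Perm Plane)}
    (h : ∀ g ∈ S, ∃ k ε c d, g = upperAff k ε c d) : Subgroup.closure S ≤ smoothPerms := by
  refine (Subgroup.closure_le _).2 fun g hg => ?_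
  obtain ⟨k, ε, c, d, rfl⟩ := h g hg
  exact upperAff_mem_smoothPerms _ _ _ _

/-- On a quotient of the plane by maps `(x, y) ↦ (x + c, ± y)`, the form `h dx ∧ dy` is the
differential of the invariant form `-(∫₀^y h) dx`. -/
theorem IsQuotientBy.subsingleton_deRhamH2_of_horizontal [IsManifold 𝓘(ℝ, Plane) ∞ B]
    {S : Set (Equiv.Perm Plane)} {q : Plane → B} (hq : IsQuotientBy (Subgroup.closure S) q)
    (hS : ∀ g ∈ S, ∃ ε c, g = upperAff 0 ε c 0) : Subsingleton (DeRhamH2 B) := by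
  have hG : Subgroup.closure S ≤ smoothPerms := closure_le_smoothPerms fun g hg => by
    obtain ⟨ε, c, rfl⟩ := hS g hg
    exact ⟨_, _, _, _, rfl⟩
  refine subsingleton_deRhamH2 fun η hη => ?_
  have hh := contDiff_coeff hq.isLocalDiffeomorph hη.1
  have hP := (contDiff_primY hh).neg
  refine hq.mem_exactTwoForms hη.1 (P := fun z => -primY (coeff q η) z) (Q := fun _ => 0) hP
    contDiff_const ?_ fun z => ?_
  · refine (Subgroup.closure_le _).2 fun g hg => ?_
    obtain ⟨ε, c, rfl⟩ := hS g hg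
    refine upperAff_mem_formStabilizer_oneForm (fun z => ?_) fun z => by simp
    have h1 : ∀ x y, coeff q η !₂[x + c, ((ε : ℤ) : ℝ) * y] =
        ((ε : ℤ) : ℝ) * coeff q η !₂[x, y] := by
      intro x y
      have := hq.coeff_upperAff hG η (Subgroup.subset_closure hg) !₂[x, y]
      simpa [upperAff_apply] using this
    have h2 : ∀ e : ℝ, e = ((ε : ℤ) : ℝ) → e * e = 1 →
        ∫ s in (0 : ℝ)..e * z 1, coeff q η !₂[z 0 + c, s] =
        ∫ s in (0 : ℝ)..z 1, coeff q η !₂[z 0, s] := by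
      rintro e he hee
      have h3 := intervalIntegral.mul_integral_comp_mul_left (a := 0) (b := z 1)
        (f := fun s => coeff q η !₂[z 0 + c, s]) (c := e)
      rw [mul_zero] at h3
      rw [← h3, ← intervalIntegral.integral_const_mul]
      refine intervalIntegral.integral_congr fun s _ => ?_
      simp only
      rw [he, h1, ← mul_assoc, ← he, hee, one_mul]
    simp only [primY, upperAff_apply]
    simpa using h2 _ rfl (units_coe_mul_self ε)
  · rw [extDeriv_oneForm hP contDiff_const, pullbackForm_eq_twoForm]
    have : fderiv ℝ (fun z => -primY (coeff q η) z) z (EuclideanSpace.single 1 1) =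
        - coeff q η z := by
      rw [fderiv_fun_neg, ← fderiv_primY hh z]; rfl
    rw [this]
    simp [twoForm]

end DeRham

/-! ### Closed forms on the torus and on the Klein bottle -/

section TorusKlein

/-- The integral over the unit square. -/
def squareIntegral (f : Plane → ℝ) : ℝ := ∫ y in (0 : ℝ)..1, ∫ x in (0 : ℝ)..1, f !₂[x, y]

theorem squareIntegral_comm {f : Plane → ℝ} (hf : Continuous f) :
    squareIntegral f = ∫ x in (0 : ℝ)..1, ∫ y in (0 : ℝ)..1, f !₂[x, y] := by
  refine intervalIntegral_intervalIntegral_swap (F := fun y x => f !₂[x, y]) ?_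
  have hc : Continuous fun p : ℝ × ℝ => f !₂[p.2, p.1] :=
    hf.comp (contDiff_mk (n := 0) contDiff_snd contDiff_fst).continuous
  have h := hc.continuousOn.integrableOn_compact (μ := volume)
    ((isCompact_Icc (a := (0 : ℝ)) (b := 1)).prod (isCompact_Icc (a := (0 : ℝ)) (b := 1)))
  have hI : uIoc (0 : ℝ) 1 ⊆ Icc 0 1 := uIoc_subset_uIcc.trans (uIcc_of_le zero_le_one).subset
  exact h.mono_set (prod_mono hI hI)

/-- Stokes' theorem on the unit square. -/
theorem squareIntegral_stokes {P Q : Plane → ℝ} (hP : ContDiff ℝ ∞ P) (hQ : ContDiff ℝ ∞ Q) :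
    squareIntegral (fun z => fderiv ℝ Q z (EuclideanSpace.single 0 1) -
      fderiv ℝ P z (EuclideanSpace.single 1 1)) =
    (∫ y in (0 : ℝ)..1, (Q !₂[1, y] - Q !₂[0, y])) -
      ∫ x in (0 : ℝ)..1, (P !₂[x, 1] - P !₂[x, 0]) := by
  have hQ' : Continuous fun z => fderiv ℝ Q z (EuclideanSpace.single 0 1) :=
    (hQ.continuous_fderiv (by simp)).clm_apply continuous_const
  have hP' : Continuous fun z => fderiv ℝ P z (EuclideanSpace.single 1 1) :=
    (hP.continuous_fderiv (by simp)).clm_apply continuous_const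
  have e1 : squareIntegral (fun z => fderiv ℝ Q z (EuclideanSpace.single 0 1) -
      fderiv ℝ P z (EuclideanSpace.single 1 1)) =
      squareIntegral (fun z => fderiv ℝ Q z (EuclideanSpace.single 0 1)) -
      squareIntegral (fun z => fderiv ℝ P z (EuclideanSpace.single 1 1)) := by
    have hi : ∀ {f : Plane → ℝ}, Continuous f →
        Continuous fun y : ℝ => ∫ x in (0 : ℝ)..1, f !₂[x, y] := fun {f} hf =>
      intervalIntegral.continuous_parametric_intervalIntegral_of_continuous'
          (f := fun y x => f !₂[x, y])
        (hf.comp (contDiff_mk (n := 0) contDiff_snd contDiff_fst).continuous) 0 1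
    rw [squareIntegral, squareIntegral, squareIntegral, ← intervalIntegral.integral_sub
      ((hi hQ').intervalIntegrable _ _) ((hi hP').intervalIntegrable _ _)]
    refine intervalIntegral.integral_congr fun y _ => ?_
    exact intervalIntegral.integral_sub ((continuous_lineX hQ' y).intervalIntegrable _ _)
      ((continuous_lineX hP' y).intervalIntegrable _ _)
  rw [e1, squareIntegral_comm hP', squareIntegral]
  congr 1
  · refine intervalIntegral.integral_congr fun y _ => ?_
    exact intervalIntegral.integral_eq_sub_of_hasDerivAt (fun x _ => hasDerivAt_lineX hQ x y)
      ((continuous_lineX hQ' y).intervalIntegrable _ _)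
  · refine intervalIntegral.integral_congr fun x _ => ?_
    exact intervalIntegral.integral_eq_sub_of_hasDerivAt (fun y _ => hasDerivAt_lineY hP x y)
      ((continuous_lineY hP' x).intervalIntegrable _ _)

/-- `x ↦ h(x, y)`, averaged over a unit interval. -/
def meanX (h : Plane → ℝ) (z : Plane) : ℝ := primX h !₂[1, z 1]

theorem contDiff_meanX {h : Plane → ℝ} (hh : ContDiff ℝ ∞ h) : ContDiff ℝ ∞ (meanX h) :=
  (contDiff_primX hh).comp (contDiff_mk contDiff_const (contDiff_coord 1))

theorem meanX_apply (h : Plane → ℝ) (x y : ℝ) : meanX h !₂[x, y] =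
    ∫ s in (0 : ℝ)..1, h !₂[s, y] := by
  simp [meanX, primX]

theorem primX_apply (h : Plane → ℝ) (x y : ℝ) : primX h !₂[x, y] =
    ∫ s in (0 : ℝ)..x, h !₂[s, y] := by
  simp [primX]

theorem primY_apply (h : Plane → ℝ) (x y : ℝ) : primY h !₂[x, y] =
    ∫ s in (0 : ℝ)..y, h !₂[x, s] := by
  simp [primY]

/-- The form `-(∫₀^y m) dx + (∫₀^x h - x m + c) dy` is a primitive of `h dx ∧ dy` if `m` and `c`
do not depend on `x`. -/
theorem extDeriv_primitive {h m c : Plane → ℝ} (hh : ContDiff ℝ ∞ h) (hm : ContDiff ℝ ∞ m)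
    (hc : ContDiff ℝ ∞ c) (hm' : ∀ x x' y, m !₂[x, y] = m !₂[x', y])
    (hc' : ∀ x x' y, c !₂[x, y] = c !₂[x', y]) (z : Plane) :
    extDeriv (oneForm (fun z => -primY m z) (fun z => primX h z - z 0 * m z + c z)) z =
      twoForm h z := by
  have h1 : ContDiff ℝ ∞ fun z : Plane => z 0 * m z := (contDiff_coord 0).mul hm
  have h2 : ContDiff ℝ ∞ fun z : Plane => primX h z - z 0 * m z := (contDiff_primX hh).sub h1
  have d : ∀ {f : Plane → ℝ}, ContDiff ℝ ∞ f → DifferentiableAt ℝ f z := fun hf =>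
    hf.differentiable (by simp) z
  rw [extDeriv_oneForm (contDiff_primY hm).neg (h2.add hc), twoForm]
  congr 1
  rw [fderiv_fun_neg, fderiv_fun_add (d h2) (d hc), fderiv_fun_sub (d (contDiff_primX hh)) (d h1),
    fderiv_fun_mul (d (contDiff_coord 0)) (d hm)]
  have e0 : fderiv ℝ (fun z : Plane => z 0) z (EuclideanSpace.single 0 1) = 1 := by
    rw [show (fun z : Plane => z 0) = EuclideanSpace.proj (𝕜 := ℝ) (0 : Fin 2) from rfl,
      ContinuousLinearMap.fderiv]
    simp
  simp only [add_apply, sub_apply, neg_apply, smul_apply, smul_eq_mul]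
  rw [fderiv_primX hh, fderiv_primY hm, fderiv_single_zero_of_const hm hm',
    fderiv_single_zero_of_const hc hc', e0]
  ring

variable {B : Type*} [TopologicalSpace B] [ChartedSpace Plane B]

/-- The standard torus group, generated by the two unit translations. -/
def stdTorusGroup : Subgroup (Equiv.Perm Plane) :=
  Subgroup.closure {upperAff 0 1 1 0, upperAff 0 1 0 1}

/-- The standard Klein bottle group, generated by `(x, y) ↦ (x + 1, -y)` and
`(x, y) ↦ (x, y + 1)`. -/
def stdKleinGroup : Subgroup (Equiv.Perm Plane) :=
  Subgroup.closure {upperAff 0 (-1) 1 0, upperAff 0 1 0 1}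

theorem stdTorusGroup_le : stdTorusGroup ≤ smoothPerms := closure_le_smoothPerms (by
  rintro g (rfl | rfl) <;> exact ⟨_, _, _, _, rfl⟩)

theorem stdKleinGroup_le : stdKleinGroup ≤ smoothPerms := closure_le_smoothPerms (by
  rintro g (rfl | rfl) <;> exact ⟨_, _, _, _, rfl⟩)

theorem coeff_torus {q : Plane → B} (hq : IsQuotientBy stdTorusGroup q) (η : FormField B 2)
    (x y : ℝ) : coeff q η !₂[x + 1, y] = coeff q η !₂[x, y] ∧
      coeff q η !₂[x, y + 1] = coeff q η !₂[x, y] := by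
  have h1 := hq.coeff_upperAff stdTorusGroup_le η (Subgroup.subset_closure (Or.inl rfl)) !₂[x, y]
  have h2 := hq.coeff_upperAff stdTorusGroup_le η (Subgroup.subset_closure (Or.inr rfl)) !₂[x, y]
  constructor
  · simpa [upperAff_apply] using h1
  · simpa [upperAff_apply] using h2

/-- A `2`-form with integral zero on the torus is exact: subtract the mean in one direction,
then integrate. -/
theorem exact_of_squareIntegral_eq_zero [IsManifold 𝓘(ℝ, Plane) ∞ B] {q : Plane → B}
    (hq : IsQuotientBy stdTorusGroup q) {η : FormField B 2} (hη : SmoothOn η Set.univ)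
    (h0 : squareIntegral (coeff q η) = 0) : η ∈ exactTwoForms B := by
  have hh := contDiff_coeff hq.isLocalDiffeomorph hη
  have hper := coeff_torus hq η
  set h := coeff q η with hdef
  have hm := contDiff_meanX hh
  have hmc : ∀ x x' y, meanX h !₂[x, y] = meanX h !₂[x', y] := fun x x' y => by
    rw [meanX_apply, meanX_apply]
  refine hq.mem_exactTwoForms hη (P := fun z => -primY (meanX h) z)
    (Q := fun z => primX h z - z 0 * meanX h z + 0) (contDiff_primY hm).neg
    (((contDiff_primX hh).sub ((contDiff_coord 0).mul hm)).add contDiff_const) ?_ fun z => ?_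
  · refine (Subgroup.closure_le _).2 ?_
    have hPx : ∀ x y, primY (meanX h) !₂[x, y] = ∫ s in (0 : ℝ)..y, meanX h !₂[0, s] :=
        fun x y => by
      rw [primY_apply]
      exact intervalIntegral.integral_congr fun s _ => hmc _ _ _
    have hp1 : ∀ y, Function.Periodic (fun s => h !₂[s, y]) 1 := fun y s => (hper s y).1
    have hp2 : Function.Periodic (fun s => meanX h !₂[0, s]) 1 := fun s => by
      simp only [meanX_apply]
      exact intervalIntegral.integral_congr fun t _ => (hper t s).2
    have hint : ∀ {f : Plane → ℝ}, ContDiff ℝ ∞ f → ∀ a b y, IntervalIntegrable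
        (fun s => f !₂[s, y]) volume a b :=
      fun hf a b y => (continuous_lineX hf.continuous y).intervalIntegrable _ _
    have hint' : ∀ {f : Plane → ℝ}, ContDiff ℝ ∞ f → ∀ a b x, IntervalIntegrable
        (fun s => f !₂[x, s]) volume a b :=
      fun hf a b y => (continuous_lineY hf.continuous y).intervalIntegrable _ _
    rintro g (rfl | rfl)
    · refine upperAff_mem_formStabilizer_oneForm (fun z => ?_) fun z => ?_
      · rw [← mk_coord z]
        simp [upperAff_apply, hPx]
      · rw [← mk_coord z]
        simp only [upperAff_apply]
        have h1 : ∫ s in (0 : ℝ)..z 0 + 1, h !₂[s, z 1] = (∫ s in (0 : ℝ)..z 0, h !₂[s, z 1]) +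
            meanX h !₂[z 0, z 1] := by
          rw [← intervalIntegral.integral_add_adjacent_intervals (hint hh 0 (z 0) _)
            (hint hh (z 0) (z 0 + 1) _), (hp1 (z 1)).intervalIntegral_add_eq (z 0) 0, meanX_apply,
            zero_add]
        have h2 := hmc (z 0 + 1) (z 0) (z 1)
        simp [primX_apply, h1, h2]
        ring
    · refine upperAff_mem_formStabilizer_oneForm (fun z => ?_) fun z => ?_
      · rw [← mk_coord z]
        have h1 : ∫ s in (0 : ℝ)..z 1 + 1, meanX h !₂[0, s] =
            ∫ s in (0 : ℝ)..z 1, meanX h !₂[0, s] := by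
          rw [← intervalIntegral.integral_add_adjacent_intervals (hint' hm 0 (z 1) _)
            (hint' hm (z 1) (z 1 + 1) _), hp2.intervalIntegral_add_eq (z 1) 0, zero_add]
          simp only [meanX_apply]
          rw [← squareIntegral, h0, add_zero]
        simp [upperAff_apply, hPx, h1]
      · rw [← mk_coord z]
        have h1 : ∀ x, ∫ s in (0 : ℝ)..x, h !₂[s, z 1 + 1] = ∫ s in (0 : ℝ)..x, h !₂[s, z 1] :=
          fun x => intervalIntegral.integral_congr fun t _ => (hper t (z 1)).2
        simp [upperAff_apply, primX_apply, meanX_apply, h1]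
  · rw [extDeriv_primitive hh hm contDiff_const hmc (fun _ _ _ => rfl), pullbackForm_eq_twoForm]

/-- Every `2`-form `h dx ∧ dy` on the Klein bottle is exact. The mean of `h` over a full horizontal
period is an odd periodic function of `y`, so it has an even periodic primitive, and the recipe for
the torus applies; a function of `y` is added to the `dy`-component to make the primitive
anti-invariant under the glide reflection. -/
theorem IsQuotientBy.subsingleton_deRhamH2_klein [IsManifold 𝓘(ℝ, Plane) ∞ B] {q : Plane → B}
    (hq : IsQuotientBy stdKleinGroup q) : Subsingleton (DeRhamH2 B) := by
  refine subsingleton_deRhamH2 fun η hη => ?_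
  have hh := contDiff_coeff hq.isLocalDiffeomorph hη.1
  have hA : ∀ x y, coeff q η !₂[x + 1, -y] = - coeff q η !₂[x, y] := fun x y => by
    have h1 := hq.coeff_upperAff stdKleinGroup_le η (Subgroup.subset_closure (Or.inl rfl)) !₂[x, y]
    simpa [upperAff_apply] using h1
  have hS : ∀ x y, coeff q η !₂[x, y + 1] = coeff q η !₂[x, y] := fun x y => by
    have h1 := hq.coeff_upperAff stdKleinGroup_le η (Subgroup.subset_closure (Or.inr rfl)) !₂[x, y]
    simpa [upperAff_apply] using h1
  set h := coeff q η with hdef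
  -- `c` is the mean over `[0, 1]`; the mean over the full period `[0, 2]` is the odd part of `c`.
  set c := meanX h with hcdef
  have hc := contDiff_meanX hh
  let m : Plane → ℝ := fun z => (c z - c !₂[0, -z 1]) / 2
  have hm : ContDiff ℝ ∞ m := (hc.sub (hc.comp (contDiff_mk contDiff_const
    (contDiff_coord 1).neg))).div_const 2
  have hcc : ∀ x x' y, c !₂[x, y] = c !₂[x', y] := fun x x' y => by
    rw [hcdef, meanX_apply, meanX_apply]
  have hm1 : ∀ x y, m !₂[x, y] = (c !₂[0, y] - c !₂[0, -y]) / 2 := fun x y => by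
    simp only [m]; rw [hcc x 0 y]; simp
  have hmc : ∀ x x' y, m !₂[x, y] = m !₂[x', y] := fun x x' y => by rw [hm1, hm1]
  have hcS : ∀ y, c !₂[0, y + 1] = c !₂[0, y] := fun y => by
    rw [hcdef, meanX_apply, meanX_apply]
    exact intervalIntegral.integral_congr fun t _ => hS t y
  have hcS' : ∀ y, c !₂[0, -(y + 1)] = c !₂[0, -y] := fun y => by
    have h1 := hcS (-(y + 1))
    rw [show -(y + 1) + 1 = -y by ring] at h1
    exact h1.symm
  have hint : ∀ {f : Plane → ℝ}, ContDiff ℝ ∞ f → ∀ a b y, IntervalIntegrable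
      (fun s => f !₂[s, y]) volume a b :=
    fun hf a b y => (continuous_lineX hf.continuous y).intervalIntegrable _ _
  have hint' : ∀ {f : Plane → ℝ}, ContDiff ℝ ∞ f → ∀ a b x, IntervalIntegrable
      (fun s => f !₂[x, s]) volume a b :=
    fun hf a b y => (continuous_lineY hf.continuous y).intervalIntegrable _ _
  have hPx : ∀ x y, primY m !₂[x, y] = ∫ s in (0 : ℝ)..y, m !₂[0, s] := fun x y => by
    rw [primY_apply]
    exact intervalIntegral.integral_congr fun s _ => hmc _ _ _
  have hodd : ∀ y, m !₂[0, -y] = - m !₂[0, y] := fun y => by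
    rw [hm1, hm1, neg_neg]; ring
  refine hq.mem_exactTwoForms hη.1 (P := fun z => -primY m z)
    (Q := fun z => primX h z - z 0 * m z + -(c z / 2)) (contDiff_primY hm).neg
    (((contDiff_primX hh).sub ((contDiff_coord 0).mul hm)).add (hc.div_const 2).neg) ?_ fun z => ?_
  · refine (Subgroup.closure_le _).2 ?_
    rintro g (rfl | rfl)
    · refine upperAff_mem_formStabilizer_oneForm (fun z => ?_) fun z => ?_
      · rw [← mk_coord z]
        have h1 : ∫ s in (0 : ℝ)..-z 1, m !₂[0, s] = ∫ s in (0 : ℝ)..z 1, m !₂[0, s] := by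
          have h2 := intervalIntegral.integral_comp_neg (a := 0) (b := z 1) (fun s => m !₂[0, s])
          simp only [hodd, intervalIntegral.integral_neg, neg_zero] at h2
          rw [intervalIntegral.integral_symm, ← h2, neg_neg]
        simp [upperAff_apply, hPx, h1]
      · rw [← mk_coord z]
        have h1 : ∫ s in (0 : ℝ)..z 0 + 1, h !₂[s, -z 1] = c !₂[0, -z 1] -
            ∫ s in (0 : ℝ)..z 0, h !₂[s, z 1] := by
          rw [← intervalIntegral.integral_add_adjacent_intervals (hint hh 0 1 _)
            (hint hh 1 (z 0 + 1) _), hcdef, meanX_apply]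
          have h2 := intervalIntegral.integral_comp_add_right (a := 0) (b := z 0)
            (fun s => h !₂[s, -z 1]) 1
          simp only [hA, intervalIntegral.integral_neg, zero_add] at h2
          rw [← h2, sub_eq_add_neg]
        have h2 := hcc (z 0) 0 (z 1)
        have h3 := hcc (z 0 + 1) 0 (-z 1)
        simp [upperAff_apply, primX_apply, h1, h2, h3, hm1]
        ring
    · refine upperAff_mem_formStabilizer_oneForm (fun z => ?_) fun z => ?_
      · rw [← mk_coord z]
        have hp2 : Function.Periodic (fun s => m !₂[0, s]) 1 := fun s => by
          simp only [hm1, hcS, hcS']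
        have h0 : ∫ s in (0 : ℝ)..1, m !₂[0, s] = 0 := by
          have h2 := intervalIntegral.integral_comp_sub_left (a := 0) (b := 1)
            (fun s => m !₂[0, s]) 1
          have h3 : ∀ s, m !₂[0, 1 - s] = - m !₂[0, s] := fun s => by
            have h4 : m !₂[0, -s + 1] = m !₂[0, -s] := hp2 (-s)
            rw [← hodd, ← h4, show -s + 1 = 1 - s by ring]
          simp only [h3, intervalIntegral.integral_neg, sub_self, sub_zero] at h2
          linarith
        have h1 : ∫ s in (0 : ℝ)..z 1 + 1, m !₂[0, s] = ∫ s in (0 : ℝ)..z 1, m !₂[0, s] := by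
          rw [← intervalIntegral.integral_add_adjacent_intervals (hint' hm 0 (z 1) _)
            (hint' hm (z 1) (z 1 + 1) _), hp2.intervalIntegral_add_eq (z 1) 0, zero_add, h0,
            add_zero]
        simp [upperAff_apply, hPx, h1]
      · rw [← mk_coord z]
        have h1 : ∀ x, ∫ s in (0 : ℝ)..x, h !₂[s, z 1 + 1] = ∫ s in (0 : ℝ)..x, h !₂[s, z 1] :=
          fun x => intervalIntegral.integral_congr fun t _ => hS t (z 1)
        have h2 : c !₂[z 0, z 1 + 1] = c !₂[z 0, z 1] := by rw [hcc _ 0, hcS, hcc 0]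
        have h3 := hcS (z 1)
        have h4 := hcS' (z 1)
        simp [upperAff_apply, primX_apply, h1, h2, hm1, h3]
        left
        rwa [neg_add_rev] at h4
  · rw [extDeriv_primitive hh hm (hc.div_const 2).neg hmc (fun x x' y => by
      have h1 := hcc x x' y
      rw [hcdef] at h1
      rw [h1]),
      pullbackForm_eq_twoForm]

end TorusKlein

/-! ### Singular cochains of the plane -/

section Cone

variable {k : ℕ}

/-- The projection of `Δᵏ⁺¹` minus its vertex `0` onto the opposite face (with an arbitrary value
at the vertex itself). -/
def tail (t : Simplex (k + 1)) : Simplex k :=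
  if h : t 0 = 1 then stdSimplex.vertex 0
  else ⟨fun i => t i.succ / (1 - t 0),
    fun i => div_nonneg (stdSimplex.zero_le t _) (sub_nonneg.2 (stdSimplex.le_one t _)), by
      have h1 := stdSimplex.sum_eq_one t
      rw [Fin.sum_univ_succ] at h1
      rw [← Finset.sum_div, div_eq_one_iff_eq (sub_ne_zero.2 (Ne.symm h))]
      linarith⟩

theorem tail_apply {t : Simplex (k + 1)} (h : t 0 ≠ 1) (i : Fin (k + 1)) :
    tail t i = t i.succ / (1 - t 0) := by
  rw [tail, dif_neg h]; rfl

theorem continuous_simplex_apply (i : Fin (k + 1)) : Continuous fun t : Simplex k => t i :=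
  (continuous_apply i).comp continuous_subtype_val

theorem continuousOn_tail : ContinuousOn (tail (k := k)) {t | t 0 ≠ 1} := by
  rw [continuousOn_iff_continuous_domRestrict]
  refine Continuous.subtype_mk (p := fun x => x ∈ stdSimplex ℝ (Fin (k + 1)))
    (f := fun t : {t : Simplex (k + 1) | t 0 ≠ 1} => fun i => t.1 i.succ /
        (1 - t.1 0)) ?_ ?_ |>.congr ?_
  · refine continuous_pi fun i => Continuous.div ?_ ?_ fun t => sub_ne_zero.2 (Ne.symm t.2)
    · exact (continuous_simplex_apply _).comp continuous_subtype_val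
    · exact continuous_const.sub ((continuous_simplex_apply _).comp continuous_subtype_val)
  · intro t
    have := (tail t.1).2
    convert this using 1
    funext i
    exact (tail_apply t.2 i).symm
  · intro t
    refine stdSimplex.ext (funext fun i => ?_)
    exact (tail_apply t.2 i).symm

/-- The cone over the singular simplex `σ` with apex the origin, which becomes the vertex `0`. -/
def cone (σ : C(Simplex k, Plane)) : C(Simplex (k + 1), Plane) where
  toFun t := (1 - t 0) • σ (tail t)
  continuous_toFun := by
    refine continuous_iff_continuousAt.2 fun t => ?_
    have h0 : Continuous fun t : Simplex (k + 1) => 1 - t 0 :=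
      continuous_const.sub (continuous_simplex_apply 0)
    by_cases ht : t 0 = 1
    · obtain ⟨C, hC⟩ := (isCompact_range σ.continuous).isBounded.exists_norm_le
      refine continuousAt_of_tendsto_nhds (y := 0) ?_ |>.congr (Eventually.of_forall fun _ => rfl)
      refine squeeze_zero_norm (a := fun t : Simplex (k + 1) => |1 - t 0| * C) (fun t => ?_) ?_
      · rw [norm_smul, Real.norm_eq_abs]
        exact mul_le_mul_of_nonneg_left (hC _ ⟨_, rfl⟩) (abs_nonneg _)
      · have h2 : Continuous fun t : Simplex (k + 1) => |1 - t 0| * C := h0.abs.mul continuous_const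
        exact h2.tendsto' t 0 (by rw [ht]; simp)
    · have hopen : IsOpen {t : Simplex (k + 1) | t 0 ≠ 1} :=
        isOpen_ne.preimage (continuous_simplex_apply 0)
      exact h0.continuousAt.smul
        (σ.continuous.continuousAt.comp (continuousOn_tail.continuousAt (hopen.mem_nhds ht)))

theorem cone_apply (σ : C(Simplex k, Plane)) (t : Simplex (k + 1)) :
    cone σ t = (1 - t 0) • σ (tail t) := rfl

theorem face_apply_self (i : Fin (k + 2)) (t : Simplex k) : face k i t i = 0 := by
  change FunOnFinite.linearMap ℝ ℝ i.succAbove t i = 0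
  rw [FunOnFinite.linearMap_apply_apply]
  refine Finset.sum_eq_zero fun j hj => ?_
  simp at hj

theorem face_apply_succAbove (i : Fin (k + 2)) (t : Simplex k) (j : Fin (k + 1)) :
    face k i t (i.succAbove j) = t j := by
  change FunOnFinite.linearMap ℝ ℝ i.succAbove t (i.succAbove j) = t j
  rw [FunOnFinite.linearMap_apply_apply, Finset.sum_eq_single j]
  · simp
  · simp

theorem cone_comp_face_zero (σ : C(Simplex k, Plane)) : (cone σ).comp (face k 0) = σ := by
  ext1 t
  rw [ContinuousMap.comp_apply, cone_apply, face_apply_self, sub_zero, one_smul]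
  congr 1
  refine stdSimplex.ext (funext fun i => ?_)
  rw [tail_apply (by rw [face_apply_self]; norm_num), face_apply_self, sub_zero, div_one]
  exact face_apply_succAbove 0 t i

theorem cone_comp_face_succ (σ : C(Simplex (k + 1), Plane)) (i : Fin (k + 2)) :
    (cone σ).comp (face (k + 1) i.succ) = cone (σ.comp (face k i)) := by
  ext1 t
  have h0 : face (k + 1) i.succ t 0 = t 0 := face_apply_succAbove i.succ t 0
  rw [ContinuousMap.comp_apply, cone_apply, cone_apply, h0, ContinuousMap.comp_apply]
  by_cases ht : t 0 = 1
  · rw [ht, sub_self, zero_smul, zero_smul]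
  · congr 2
    refine stdSimplex.ext (funext fun j => ?_)
    rw [tail_apply (by rwa [h0]), h0]
    obtain rfl | ⟨j, rfl⟩ := Fin.eq_self_or_eq_succAbove i j
    · rw [face_apply_self, face_apply_self, zero_div]
    · rw [face_apply_succAbove, tail_apply ht, ← Fin.succ_succAbove_succ, face_apply_succAbove]

theorem cone_comp_face_one (σ : C(Simplex 0, Plane)) :
    (cone σ).comp (face 0 1) = ContinuousMap.const _ 0 := by
  ext1 t
  have h0 : face 0 1 t 0 = 1 := by
    have := face_apply_succAbove 1 t 0
    have h1 := stdSimplex.sum_eq_one t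
    rw [Fin.sum_univ_succ] at h1
    simp only [Finset.univ_eq_empty, Finset.sum_empty, add_zero] at h1
    rw [h1] at this
    exact this
  rw [ContinuousMap.comp_apply, cone_apply, h0, sub_self, zero_smul]
  rfl

end Cone

section Cochains

variable {L : Type*} [AddCommGroup L] {k : ℕ}

/-- The coboundary of singular cochains of the plane with values in `L`. -/
def cobd : (C(Simplex k, Plane) → L) →+ (C(Simplex (k + 1), Plane) → L) where
  toFun c σ := ∑ i : Fin (k + 2), (-1 : ℤ) ^ (i : ℕ) • c (σ.comp (face k i))
  map_zero' := by funext σ; simp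
  map_add' a b := by funext σ; simp [Finset.sum_add_distrib]

theorem cobd_apply (c : C(Simplex k, Plane) → L) (σ : C(Simplex (k + 1), Plane)) :
    cobd c σ = ∑ i : Fin (k + 2), (-1 : ℤ) ^ (i : ℕ) • c (σ.comp (face k i)) := rfl

theorem face_comp_face (i : Fin (k + 2)) (j : Fin (k + 3)) :
    (face (k + 1) j).comp (face k i) =
      ⟨stdSimplex.map (j.succAbove ∘ i.succAbove), stdSimplex.continuous_map _⟩ :=
  ContinuousMap.ext fun t => stdSimplex.map_comp_apply _ _ t

theorem cobd_cobd_apply (c : C(Simplex k, Plane) → L) (σ : C(Simplex (k + 2), Plane)) :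
    cobd (cobd c) σ = ∑ j : Fin (k + 3), ∑ i : Fin (k + 2), (-1 : ℤ) ^ (j : ℕ) •
        (-1 : ℤ) ^ (i : ℕ) •
      c (σ.comp ⟨stdSimplex.map (j.succAbove ∘ i.succAbove), stdSimplex.continuous_map _⟩) := by
  rw [cobd_apply]
  refine Finset.sum_congr rfl fun j _ => ?_
  rw [cobd_apply, Finset.smul_sum]
  refine Finset.sum_congr rfl fun i _ => ?_
  rw [← face_comp_face]; rfl

theorem succAbove_comp_succAbove (i j : Fin (k + 2)) (h : i ≤ j) :
    j.succ.succAbove ∘ i.succAbove = i.castSucc.succAbove ∘ j.succAbove := by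
  funext x
  simp only [Function.comp, Fin.ext_iff, Fin.succAbove, Fin.lt_def, Fin.le_def] at h ⊢
  split_ifs <;> simp_all <;> omega

theorem cobd_cobd (c : C(Simplex k, Plane) → L) : cobd (cobd c) = 0 := by
  funext σ
  rw [cobd_cobd_apply]
  set f : Fin (k + 3) → Fin (k + 2) → L := fun j i => (-1 : ℤ) ^ (j : ℕ) • (-1 : ℤ) ^ (i : ℕ) •
      c (σ.comp ⟨stdSimplex.map (j.succAbove ∘ i.succAbove), stdSimplex.continuous_map _⟩) with hf
  have key : ∀ i j : Fin (k + 2), i ≤ j → f j.succ i = - f i.castSucc j := fun i j h => by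
    simp only [hf]
    rw [← neg_smul]
    simp only [succAbove_comp_succAbove i j h, smul_smul]
    congr 1
    simp [pow_succ]; ring
  rw [← Finset.sum_product' (f := f)]
  -- The terms `(j + 1, i)` and `(i, j)`, `i ≤ j`, cancel.
  rw [Finset.univ_product_univ, ← Finset.sum_filter_add_sum_filter_not _
    (fun p : Fin (k + 3) × Fin (k + 2) => p.2.castSucc < p.1)]
  refine (eq_neg_iff_add_eq_zero (G := L)).1 ?_
  rw [← Finset.sum_neg_distrib]
  have ne0 : ∀ p : Fin (k + 3) × Fin (k + 2), p.2.castSucc < p.1 → p.1 ≠ 0 := fun p hp =>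
    ((Fin.zero_le _).trans_lt hp).ne'
  have neL : ∀ p : Fin (k + 3) × Fin (k + 2), ¬ p.2.castSucc < p.1 → p.1 ≠ Fin.last _ :=
    fun p hp h => hp (h ▸ Fin.castSucc_lt_last _)
  refine Finset.sum_bij' (fun p hp => (p.2.castSucc, p.1.pred (ne0 p (Finset.mem_filter.1 hp).2)))
    (fun p hp => (p.2.succ, p.1.castPred (neL p (Finset.mem_filter.1 hp).2))) ?_ ?_ ?_ ?_ ?_
  · rintro ⟨j, i⟩ hp
    simp only [Finset.mem_filter, Finset.mem_univ, true_and, Fin.lt_def, Fin.val_castSucc,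
      Fin.val_pred] at hp ⊢
    omega
  · rintro ⟨j, i⟩ hp
    simp only [Finset.mem_filter, Finset.mem_univ, true_and, Fin.lt_def, Fin.val_castSucc,
      Fin.val_succ, Fin.coe_castPred] at hp ⊢
    omega
  · rintro ⟨j, i⟩ hp
    simp
  · rintro ⟨j, i⟩ hp
    simp
  · rintro ⟨j, i⟩ hp
    have h1 := ne0 _ (Finset.mem_filter.1 hp).2
    have h2 : i.castSucc < j := (Finset.mem_filter.1 hp).2
    have h3 := key i (j.pred h1) (by
      rw [Fin.lt_def, Fin.val_castSucc] at h2
      rw [Fin.le_def, Fin.val_pred]; omega)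
    rwa [Fin.succ_pred] at h3

end Cochains

section Contraction

variable {L : Type*} [AddCommGroup L] {k : ℕ}

/-- Cocycles of the plane are coboundaries: the cone operator is a contraction. -/
theorem eq_cobd_cone {c : C(Simplex (k + 1), Plane) → L} (hc : cobd c = 0) :
    c = cobd (fun σ => c (cone σ)) := by
  funext σ
  have h := congrFun hc (cone σ)
  rw [cobd_apply, Fin.sum_univ_succ, cone_comp_face_zero] at h
  simp only [cone_comp_face_succ, Fin.val_succ, pow_succ, mul_neg, mul_one, neg_smul,
    Finset.sum_neg_distrib, Fin.val_zero, pow_zero, one_smul] at h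
  rw [cobd_apply]
  exact add_neg_eq_zero.1 h

/-- A `0`-cocycle of the plane is constant: the cone over a point is a segment from the point to
the origin. -/
theorem eq_const_of_cobd_eq_zero {c : C(Simplex 0, Plane) → L} (hc : cobd c = 0) :
    ∃ μ, c = fun _ => μ := by
  refine ⟨c (ContinuousMap.const _ 0), funext fun σ => ?_⟩
  have h := congrFun hc (cone σ)
  rw [cobd_apply, Fin.sum_univ_two, cone_comp_face_zero, cone_comp_face_one] at h
  simp only [Fin.val_zero, pow_zero, one_smul, Fin.val_one, pow_one, neg_smul] at h
  exact add_neg_eq_zero.1 h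

theorem cobd_const (μ : L) : cobd (fun _ : C(Simplex 0, Plane) => μ) = 0 := by
  funext σ
  rw [cobd_apply, Fin.sum_univ_two]
  simp

end Contraction

/-! ### Twisted difference equations -/

section Difference

variable {L Y : Type*} [AddCommGroup L]

/-- The action of a pair `(e, τ)` on functions `F : Y → L`, namely `F ↦ τ ∘ F ∘ e⁻¹`. -/
def act (e : Equiv.Perm Y) (τ : L ≃+ L) : AddAut (Y → L) where
  toFun F y := τ (F (e.symm y))
  invFun F y := τ.symm (F (e y))
  left_inv F := by funext y; simp
  right_inv F := by funext y; simp
  map_add' F F' := by funext y; simp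

theorem act_apply (e : Equiv.Perm Y) (τ : L ≃+ L) (F : Y → L) (y : Y) :
    act e τ F y = τ (F (e.symm y)) := rfl

theorem act_eq_iff {e : Equiv.Perm Y} {τ : L ≃+ L} {F F' : Y → L} :
    act e τ F = F' ↔ ∀ y, F' (e y) = τ (F y) := by
  constructor
  · rintro rfl y; simp [act_apply]
  · intro h; funext y
    rw [act_apply, ← h, Equiv.apply_symm_apply]

/-- The sum of `a` over `[0, n)`, with the usual convention for negative `n`. -/
def signedSum (a : ℤ → L) (n : ℤ) : L := ∑ k ∈ Finset.Ico 0 n, a k - ∑ k ∈ Finset.Ico n 0, a k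

theorem signedSum_succ (a : ℤ → L) (n : ℤ) : signedSum a (n + 1) = signedSum a n + a n := by
  unfold signedSum
  rcases le_or_gt 0 n with h | h
  · rw [Finset.Ico_eq_empty (a := n) (b := 0) (by omega), Finset.Ico_eq_empty (a := n + 1)
      (b := 0) (by omega),
      ← Finset.insert_Ico_right_eq_Ico_add_one h, Finset.sum_insert (by simp)]
    simp [add_comm]
  · rw [Finset.Ico_eq_empty (a := 0) (b := n) (by omega), Finset.Ico_eq_empty (a := 0)
      (b := n + 1) (by omega),
      ← Finset.insert_Ico_add_one_left_eq_Ico h, Finset.sum_insert (by simp)]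
    simp

theorem signedSum_zero (a : ℤ → L) : signedSum a 0 = 0 := by simp [signedSum]

theorem signedSum_shift (a : ℤ → L) (n : ℤ) :
    signedSum (fun k => a (k + 1)) (n - 1) = signedSum a n - a 0 := by
  induction n using Int.induction_on with
  | zero =>
    have h := signedSum_succ (fun k => a (k + 1)) (0 - 1)
    rw [sub_add_cancel, signedSum_zero, zero_sub] at h
    rw [signedSum_zero, zero_sub, zero_sub]
    exact eq_neg_of_add_eq_zero_left h.symm
  | succ n ih =>
    have h := signedSum_succ (fun k => a (k + 1)) (n - 1)
    rw [sub_add_cancel] at h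
    rw [add_sub_cancel_right, h, ih, signedSum_succ]; abel
  | pred n ih =>
    have h := signedSum_succ (fun k => a (k + 1)) (-n - 1 - 1)
    rw [sub_add_cancel] at h
    have h2 := signedSum_succ a (-n - 1)
    rw [sub_add_cancel] at h2
    rw [ih, h2] at h
    have h3 : signedSum (fun k => a (k + 1)) (-n - 1 - 1) =
      signedSum a (-n - 1) + a (-n - 1) - a 0 - a (-n - 1) := eq_sub_of_add_eq h.symm
    rw [h3]; abel

/-- If `e` raises the height function `i` by one, then the equation `T u - u = r` is solvable, where
`T = act e τ`. The solution has all the symmetries of the functions `Tⁿ r` that preserve `i`. -/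
theorem exists_act_sub_eq (e : Equiv.Perm Y) (τ : L ≃+ L) (i : Y → ℤ) (hi : ∀ y, i (e y) = i y + 1)
    (r : Y → L) : ∃ u : Y → L, act e τ u - u = r ∧
      ∀ (f : Equiv.Perm Y) (σ : L ≃+ L), (∀ y, i (f y) = i y) →
        (∀ n : ℤ, act f σ ((n • act e τ) r) = (n • act e τ) r) → act f σ u = u := by
  refine ⟨fun y => - signedSum (fun n => (n • act e τ) r y) (i y), ?_, fun f σ hf h => ?_⟩
  · funext y
    have h1 : i (e.symm y) = i y - 1 := by
      have := hi (e.symm y)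
      rw [Equiv.apply_symm_apply] at this
      omega
    have h2 : ∀ n : ℤ, τ ((n • act e τ) r (e.symm y)) = ((n + 1) • act e τ) r y := fun n => by
      rw [add_comm n 1, add_zsmul, one_zsmul]; rfl
    have h3 : τ (signedSum (fun n => (n • act e τ) r (e.symm y)) (i y - 1)) =
        signedSum (fun n => ((n + 1) • act e τ) r y) (i y - 1) := by
      simp only [signedSum, map_sub, map_sum, h2]
    rw [Pi.sub_apply, act_apply, map_neg, h1, h3,
      signedSum_shift (fun n => (n • act e τ) r y) (i y)]
    simp
  · refine act_eq_iff.2 fun y => ?_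
    rw [map_neg, hf]
    congr 1
    have h2 : ∀ n : ℤ, (n • act e τ) r (f y) = σ ((n • act e τ) r y) := fun n =>
      act_eq_iff.1 (h n) y
    simp only [signedSum, map_sub, map_sum, h2]

end Difference

/-! ### Equivariant cohomology in degree two -/

section Equivariant

variable {L : Type*} [AddCommGroup L] {k : ℕ}

/-- Composition of singular simplices with a homeomorphism of the plane. -/
def push (t : Plane ≃ₜ Plane) (k : ℕ) : Equiv.Perm C(Simplex k, Plane) where
  toFun σ := (t : C(Plane, Plane)).comp σ
  invFun σ := (t.symm : C(Plane, Plane)).comp σ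
  left_inv σ := by ext1 x; simp
  right_inv σ := by ext1 x; simp

/-- The action of a homeomorphism of the plane on cochains with values in `L`, twisted by an
automorphism of `L`. -/
abbrev cochainAct (t : Plane ≃ₜ Plane) (τ : L ≃+ L) (k : ℕ) : AddAut (C(Simplex k, Plane) → L) :=
  act (push t k) τ

theorem cobd_act (t : Plane ≃ₜ Plane) (τ : L ≃+ L) (c : C(Simplex k, Plane) → L) :
    cobd (cochainAct t τ k c) = cochainAct t τ (k + 1) (cobd c) := by
  funext σ
  rw [act_apply, cobd_apply, cobd_apply, map_sum]
  refine Finset.sum_congr rfl fun i _ => ?_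
  rw [map_zsmul]; rfl

theorem height_push {t : Plane ≃ₜ Plane} {i : Plane → ℤ} {n : ℤ} (h : ∀ z, i (t z) = i z + n)
    (σ : C(Simplex k, Plane)) :
    i (push t k σ (stdSimplex.vertex 0)) = i (σ (stdSimplex.vertex 0)) + n := h _

/-- A group of transformations of the plane generated by `t`, on which `t` acts like a
translation, has no equivariant cohomology in degree two. -/
theorem exists_invariant_primitive {t : Plane ≃ₜ Plane} {τ : L ≃+ L} {i : Plane → ℤ}
    (hi : ∀ z, i (t z) = i z + 1) {f : C(Simplex 2, Plane) → L} (hf : cobd f = 0)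
    (ht : cochainAct t τ 2 f = f) : ∃ b, cochainAct t τ 1 b = b ∧ cobd b = f := by
  have h0 := eq_cobd_cone hf
  set b0 : C(Simplex 1, Plane) → L := fun σ => f (cone σ) with hb0
  have h1 : cobd (cochainAct t τ 1 b0 - b0) = 0 := by
    rw [map_sub, cobd_act, ← h0, ht, sub_self]
  have h2 := eq_cobd_cone h1
  set w := fun σ : C(Simplex 0, Plane) => (cochainAct t τ 1 b0 - b0) (cone σ) with hw
  obtain ⟨u, hu, -⟩ := exists_act_sub_eq (push t 0) τ (fun σ => i (σ (stdSimplex.vertex 0)))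
    (height_push hi) (-w)
  refine ⟨b0 + cobd u, ?_, ?_⟩
  · have h3 : cochainAct t τ 0 u = u - w := by rw [sub_eq_add_neg, ← hu]; abel
    rw [map_add, ← cobd_act, h3, map_sub, ← h2]; abel
  · rw [map_add, cobd_cobd, add_zero, ← h0]

/-- A pair `s`, `t` of homeomorphisms of the plane with twists `σ`, `τ`, which generates a group
acting like the fundamental group of a torus or of a Klein bottle: `⟨s⟩` is normalized by `t`, and
there are height functions on which `t` and `s` act as shifts. The map `D` describes
`(S - 1)(T - 1)` on functions `u` with `(S - 1) u` constant. -/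
structure ShiftPair (s t : Plane ≃ₜ Plane) (σ τ : L ≃+ L) (D : L →+ L) : Prop where
  exists_height : ∃ i : Plane → ℤ, (∀ z, i (t z) = i z + 1) ∧ ∀ z, i (s z) = i z
  exists_height' : ∃ j : Plane → ℤ, ∀ z, j (s z) = j z + 1
  invariant : ∀ (k : ℕ) (F : C(Simplex k, Plane) → L), cochainAct s σ k F = F →
    cochainAct s σ k (cochainAct t τ k F) = cochainAct t τ k F ∧
      cochainAct s σ k ((cochainAct t τ k).symm F) = (cochainAct t τ k).symm F
  map_const : ∀ (u : C(Simplex 0, Plane) → L) (μ : L), (cochainAct s σ 0 u - u = fun _ => μ) →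
    (cochainAct s σ 0 (cochainAct t τ 0 u - u) - (cochainAct t τ 0 u - u) = fun _ => D μ)

variable {s t : Plane ≃ₜ Plane} {σ τ : L ≃+ L} {D : L →+ L}

theorem ShiftPair.invariant_zpow (h : ShiftPair s t σ τ D) {F : C(Simplex k, Plane) → L}
    (hF : cochainAct s σ k F = F) (n : ℤ) :
    cochainAct s σ k ((n • cochainAct t τ k) F) = (n • cochainAct t τ k) F := by
  induction n using Int.induction_on with
  | zero => simpa using hF
  | succ n ih =>
    have := (h.invariant k _ ih).1
    rw [add_comm (n : ℤ) 1, add_zsmul, one_zsmul]; exact this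
  | pred n ih =>
    have := (h.invariant k _ ih).2
    rw [sub_eq_add_neg, add_comm (-n : ℤ) (-1), add_zsmul, neg_one_zsmul]; exact this

/-- The cochain `f = δ b` with `S b = b`, `T b - b = δ v`, has the obstruction `(S - 1) v = κ`. -/
def Obstruction (s t : Plane ≃ₜ Plane) (σ τ : L ≃+ L) (f : C(Simplex 2, Plane) → L)
    (κ : L) : Prop :=
  ∃ (b : C(Simplex 1, Plane) → L) (v : C(Simplex 0, Plane) → L), cochainAct s σ 1 b = b ∧
    cobd b = f ∧ cochainAct t τ 1 b - b = cobd v ∧ cochainAct s σ 0 v - v = fun _ => κ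

/-- Every invariant `2`-cocycle has an obstruction: contract `f` to an `S`-invariant primitive `b`,
contract the `1`-cocycle `T b - b` to `v`; then `(S - 1) v` is a `0`-cocycle, that is, a constant.
-/
theorem ShiftPair.exists_obstruction (h : ShiftPair s t σ τ D) {f : C(Simplex 2, Plane) → L}
    (hf : cobd f = 0) (hs : cochainAct s σ 2 f = f) (ht : cochainAct t τ 2 f = f) :
    ∃ κ, Obstruction s t σ τ f κ := by
  obtain ⟨j, hj⟩ := h.exists_height'
  obtain ⟨b, hb, hbf⟩ := exists_invariant_primitive hj hf hs
  have h1 : cobd (cochainAct t τ 1 b - b) = 0 := by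
    rw [map_sub, cobd_act, hbf, ht, sub_self]
  have h2 := eq_cobd_cone h1
  set v := fun σ : C(Simplex 0, Plane) => (cochainAct t τ 1 b - b) (cone σ) with hv
  have h3 : cobd (cochainAct s σ 0 v - v) = 0 := by
    rw [map_sub, cobd_act, ← h2, map_sub, hb, (h.invariant 1 b hb).1, sub_self]
  obtain ⟨κ, hκ⟩ := eq_const_of_cobd_eq_zero h3
  exact ⟨κ, b, v, hb, hbf, h2, hκ⟩

/-- Every element of `L` is an obstruction: solve `(S - 1) v = κ`, then `(T - 1) b = δ v`, and take
the cocycle `δ b`. -/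
theorem ShiftPair.exists_cocycle (h : ShiftPair s t σ τ D) (κ : L) :
    ∃ f : C(Simplex 2, Plane) → L, cobd f = 0 ∧ cochainAct s σ 2 f = f ∧ cochainAct t τ 2 f = f ∧
      Obstruction s t σ τ f κ := by
  obtain ⟨j, hj⟩ := h.exists_height'
  obtain ⟨i, hi, hi'⟩ := h.exists_height
  obtain ⟨v, hv, -⟩ := exists_act_sub_eq (push s 0) σ (fun x => j (x (stdSimplex.vertex 0)))
    (height_push hj) (fun _ => κ)
  have hv' : cochainAct s σ 1 (cobd v) = cobd v := by
    rw [← cobd_act, ← sub_eq_zero, ← map_sub, hv, cobd_const]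
  obtain ⟨b, hb, hbs⟩ := exists_act_sub_eq (push t 1) τ (fun x => i (x (stdSimplex.vertex 0)))
    (height_push hi) (cobd v)
  have hb1 : cochainAct s σ 1 b = b := hbs (push s 1) σ (fun y => hi' _) (h.invariant_zpow hv')
  refine ⟨cobd b, cobd_cobd b, ?_, ?_, b, v, hb1, rfl, hb, hv⟩
  · rw [← cobd_act, hb1]
  · rw [← cobd_act, ← sub_eq_zero, ← map_sub, hb, cobd_cobd]

theorem Obstruction.add {f f' : C(Simplex 2, Plane) → L} {κ κ' : L} (h : Obstruction s t σ τ f κ)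
    (h' : Obstruction s t σ τ f' κ') : Obstruction s t σ τ (f + f') (κ + κ') := by
  obtain ⟨b, v, h1, h2, h3, h4⟩ := h
  obtain ⟨b', v', h1', h2', h3', h4'⟩ := h'
  refine ⟨b + b', v + v', by rw [map_add, h1, h1'], by rw [map_add, h2, h2'], ?_, ?_⟩
  · rw [map_add, map_add, ← h3, ← h3']; abel
  · rw [map_add, add_sub_add_comm, h4, h4']; rfl

theorem Obstruction.neg {f : C(Simplex 2, Plane) → L} {κ : L} (h : Obstruction s t σ τ f κ) :
    Obstruction s t σ τ (-f) (-κ) := by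
  obtain ⟨b, v, h1, h2, h3, h4⟩ := h
  refine ⟨-b, -v, by rw [map_neg, h1], by rw [map_neg, h2], ?_, ?_⟩
  · rw [map_neg, map_neg, ← h3]; abel
  · rw [map_neg, ← neg_sub', h4]; rfl

/-- The image of `S - 1`, together with the image of `D`: the relations between obstructions. -/
def relations (σ : L ≃+ L) (D : L →+ L) : AddSubgroup L :=
  (σ.toAddMonoidHom - AddMonoidHom.id L).range ⊔ D.range

theorem mem_relations {κ : L} : κ ∈ relations σ D ↔ ∃ ν μ, (σ ν - ν) + D μ = κ := by
  rw [relations, AddSubgroup.mem_sup]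
  constructor
  · rintro ⟨_, ⟨ν, rfl⟩, _, ⟨μ, rfl⟩, h⟩
    exact ⟨ν, μ, h⟩
  · rintro ⟨ν, μ, h⟩
    exact ⟨_, ⟨ν, rfl⟩, _, ⟨μ, rfl⟩, h⟩

theorem act_const {Y : Type*} (e : Equiv.Perm Y) (ν : L) :
    act e σ (fun _ => ν) = fun _ => σ ν := rfl

/-- The obstruction decides whether a cocycle is the coboundary of an equivariant cochain. -/
theorem ShiftPair.obstruction_mem_iff (h : ShiftPair s t σ τ D)
    {f : C(Simplex 2, Plane) → L} {κ : L}
    (hf : Obstruction s t σ τ f κ) :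
    (∃ b, cochainAct s σ 1 b = b ∧ cochainAct t τ 1 b = b ∧ cobd b = f) ↔ κ ∈ relations σ D := by
  obtain ⟨b, v, hbs, hbf, hbt, hv⟩ := hf
  rw [mem_relations]
  constructor
  · rintro ⟨b', hs', ht', hf'⟩
    -- write `b - b' = δ u`; then `(S - 1) u = μ` and `v - (T - 1) u = ν` are constant
    have h1 : cobd (b - b') = 0 := by rw [map_sub, hbf, hf', sub_self]
    have h2 := eq_cobd_cone h1
    set u := fun x : C(Simplex 0, Plane) => (b - b') (cone x) with hu
    have h3 : cobd (cochainAct s σ 0 u - u) = 0 := by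
      rw [map_sub, cobd_act, ← h2, map_sub, hbs, hs', sub_self]
    obtain ⟨μ, hμ⟩ := eq_const_of_cobd_eq_zero h3
    have h4 : cobd (v - (cochainAct t τ 0 u - u)) = 0 := by
      rw [map_sub, map_sub, cobd_act, ← h2, ← hbt, map_sub, ht']; abel
    obtain ⟨ν, hν⟩ := eq_const_of_cobd_eq_zero h4
    refine ⟨ν, μ, ?_⟩
    have h5 : v = (cochainAct t τ 0 u - u) + fun _ => ν := by rw [← hν]; abel
    have h6 : cochainAct s σ 0 v - v = (cochainAct s σ 0 (cochainAct t τ 0 u - u) -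
        (cochainAct t τ 0 u - u)) + ((fun _ => σ ν) - fun _ => ν) := by
      conv_lhs => rw [h5, map_add, act_const]
      abel
    rw [hv, h.map_const u μ hμ] at h6
    have h7 := congrFun h6 (ContinuousMap.const _ 0)
    simp only [Pi.add_apply, Pi.sub_apply] at h7
    rw [h7, add_comm]
  · rintro ⟨ν, μ, rfl⟩
    -- Correct `b` by `δ u` with `(S - 1) u` constant and `(T - 1) u = ν - v`. Start with a solution
    -- `u₀` of `(S - 1) u₀ = -μ`; then the remaining error `r = ν - v - (T - 1) u₀` is
    -- `S`-invariant,
    -- and so `(T - 1) u' = r` has an `S`-invariant solution.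
    obtain ⟨j, hj⟩ := h.exists_height'
    obtain ⟨i, hi, hi'⟩ := h.exists_height
    obtain ⟨u₀, hu₀, -⟩ := exists_act_sub_eq (push s 0) σ (fun x => j (x (stdSimplex.vertex 0)))
      (height_push hj) (fun _ => -μ)
    have h1 := h.map_const u₀ (-μ) hu₀
    set r : C(Simplex 0, Plane) → L := (fun _ => ν) - v - (cochainAct t τ 0 u₀ - u₀) with hr
    have hrs : cochainAct s σ 0 r = r := by
      rw [← sub_eq_zero]
      have : cochainAct s σ 0 r - r = ((fun _ => σ ν) - fun _ => ν) - (cochainAct s σ 0 v - v) -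
          (cochainAct s σ 0 (cochainAct t τ 0 u₀ - u₀) - (cochainAct t τ 0 u₀ - u₀)) := by
        rw [hr, map_sub, map_sub, act_const]; abel
      rw [this, hv, h1]
      funext x
      simp only [Pi.sub_apply, Pi.zero_apply, map_neg]
      abel
    obtain ⟨u', hu', hus⟩ := exists_act_sub_eq (push t 0) τ (fun x => i (x (stdSimplex.vertex 0)))
      (height_push hi) r
    have hus' : cochainAct s σ 0 u' = u' := hus (push s 0) σ (fun y => hi' _) (h.invariant_zpow hrs)
    refine ⟨b + cobd (u₀ + u'), ?_, ?_, ?_⟩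
    · have h2 : cochainAct s σ 0 (u₀ + u') = (u₀ + u') + fun _ => -μ := by
        rw [map_add, hus', ← hu₀]; abel
      rw [map_add, hbs, ← cobd_act, h2, map_add, cobd_const, add_zero]
    · have h2 : cochainAct t τ 0 (u₀ + u') = (u₀ + u') + ((fun _ => ν) - v) := by
        have h3 : cochainAct t τ 0 u' = u' + r := by rw [← hu']; abel
        rw [map_add, h3, hr]; abel
      have h3 : cochainAct t τ 1 b = b + cobd v := by rw [← hbt]; abel
      rw [map_add, h3, ← cobd_act, h2, map_add, map_sub, cobd_const]; abel
    · rw [map_add, cobd_cobd, add_zero, hbf]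

/-- An additive correspondence `W ⊆ A × C` that projects onto both factors and matches `A₀` with
`C₀` induces an isomorphism `A ⧸ A₀ ≃ C ⧸ C₀`. -/
theorem nonempty_quotient_equiv {A C : Type*} [AddCommGroup A] [AddCommGroup C] {A₀ : AddSubgroup A}
    {C₀ : AddSubgroup C} (W : AddSubgroup (A × C)) (h1 : ∀ a, ∃ c, (a, c) ∈ W)
    (h2 : ∀ c, ∃ a, (a, c) ∈ W) (h : ∀ a c, (a, c) ∈ W → (a ∈ A₀ ↔ c ∈ C₀)) :
    Nonempty (A ⧸ A₀ ≃+ C ⧸ C₀) := by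
  let f : W →+ A ⧸ A₀ := (QuotientAddGroup.mk' A₀).comp ((AddMonoidHom.fst A C).comp W.subtype)
  let g : W →+ C ⧸ C₀ := (QuotientAddGroup.mk' C₀).comp ((AddMonoidHom.snd A C).comp W.subtype)
  have hf : Function.Surjective f := fun x => by
    obtain ⟨a, rfl⟩ := QuotientAddGroup.mk_surjective x
    obtain ⟨c, hc⟩ := h1 a
    exact ⟨⟨_, hc⟩, rfl⟩
  have hg : Function.Surjective g := fun x => by
    obtain ⟨c, rfl⟩ := QuotientAddGroup.mk_surjective x
    obtain ⟨a, hc⟩ := h2 c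
    exact ⟨⟨_, hc⟩, rfl⟩
  have hk : f.ker = g.ker := by
    ext ⟨⟨a, c⟩, hw⟩
    rw [AddMonoidHom.mem_ker, AddMonoidHom.mem_ker]
    exact (QuotientAddGroup.eq_zero_iff a).trans ((h a c hw).trans
        (QuotientAddGroup.eq_zero_iff c).symm)
  exact ⟨(QuotientAddGroup.quotientKerEquivOfSurjective f hf).symm.trans
    ((QuotientAddGroup.quotientAddEquivOfEq hk).trans
      (QuotientAddGroup.quotientKerEquivOfSurjective g hg))⟩

end Equivariant

/-! ### Sections of the lattice along lifted simplices -/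

section Covectors

/-- The covector `m dX + n dY` with integral coefficients. -/
def covec : ℤ × ℤ →+ (Plane →L[ℝ] ℝ) where
  toFun p := (p.1 : ℝ) • EuclideanSpace.proj (0 : Fin 2) + (p.2 : ℝ) • EuclideanSpace.proj
      (1 : Fin 2)
  map_zero' := by simp
  map_add' p p' := by
    ext v
    simp only [Prod.fst_add, Prod.snd_add, Int.cast_add, add_apply,
      smul_apply, smul_eq_mul]
    ring

theorem covec_apply (p : ℤ × ℤ) (v : Plane) : covec p v = p.1 * v 0 + p.2 * v 1 := rfl

theorem covec_injective : Function.Injective covec := by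
  intro p p' h
  have h0 := congrArg (fun f : Plane →L[ℝ] ℝ => f !₂[1, 0]) h
  have h1 := congrArg (fun f : Plane →L[ℝ] ℝ => f !₂[0, 1]) h
  simp [covec_apply] at h0 h1
  exact Prod.ext h0 h1

theorem range_covec : covec.range = stdLattice := by
  refine le_antisymm ?_ ((AddSubgroup.closure_le _).2 ?_)
  · rintro _ ⟨p, rfl⟩
    have h : covec p = p.1 • EuclideanSpace.proj (0 : Fin 2) + p.2 • EuclideanSpace.proj
        (1 : Fin 2) := by
      ext v; simp [covec_apply]
    rw [h]
    exact add_mem (zsmul_mem (AddSubgroup.subset_closure (by simp)) _)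
      (zsmul_mem (AddSubgroup.subset_closure (by simp)) _)
  · rintro _ (rfl | rfl)
    · exact ⟨(1, 0), by ext v; simp [covec_apply]⟩
    · exact ⟨(0, 1), by ext v; simp [covec_apply]⟩

theorem mem_stdLattice {ℓ : Plane →L[ℝ] ℝ} : ℓ ∈ stdLattice ↔ ∃ p, covec p = ℓ := by
  rw [← range_covec]; rfl

/-- The lattice `stdLattice` is discrete. -/
theorem eq_of_mem_stdLattice {ℓ ℓ' : Plane →L[ℝ] ℝ} (h : ℓ ∈ stdLattice) (h' : ℓ' ∈ stdLattice)
    (h0 : |ℓ !₂[1, 0] - ℓ' !₂[1, 0]| < 1) (h1 : |ℓ !₂[0, 1] - ℓ' !₂[0, 1]| < 1) : ℓ = ℓ' := by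
  obtain ⟨p, rfl⟩ := mem_stdLattice.1 h
  obtain ⟨p', rfl⟩ := mem_stdLattice.1 h'
  simp [covec_apply] at h0 h1
  have e0 : |p.1 - p'.1| < 1 := by exact_mod_cast h0
  have e1 : |p.2 - p'.2| < 1 := by exact_mod_cast h1
  rw [Int.abs_lt_one_iff, sub_eq_zero] at e0 e1
  rw [Prod.ext e0 e1]

/-- A continuous family of elements of the discrete lattice is locally constant. -/
theorem eventually_eq_of_mem_stdLattice {X : Type*} [TopologicalSpace X] {f : X → Plane →L[ℝ] ℝ}
    {x : X} (hf : ContinuousAt f x) (h : ∀ᶠ y in 𝓝 x, f y ∈ stdLattice) :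
    ∀ᶠ y in 𝓝 x, f y = f x := by
  have hv : ∀ v : Plane, ∀ᶠ y in 𝓝 x, |f y v - f x v| < 1 := fun v => by
    have h1 : ContinuousAt (fun y => f y v) x :=
      (ContinuousLinearMap.apply ℝ ℝ v).continuous.continuousAt.comp hf
    exact Metric.continuousAt_iff'.1 h1 1 one_pos
  filter_upwards [h, hv !₂[1, 0], hv !₂[0, 1]] with y hy h0 h1
  exact eq_of_mem_stdLattice hy h.self_of_nhds h0 h1

end Covectors

section Cover

variable {B : Type*} [TopologicalSpace B] [ChartedSpace Plane B]

/-- `q : ℝ² → B` is a smooth covering such that `q^*P` is the standard lattice. -/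
structure IsLatticeCover (P : CotangentLattice B) (q : C(Plane, B)) : Prop where
  isCoveringMap : IsCoveringMap q
  surjective : Function.Surjective q
  isLocalDiffeomorph : IsLocalDiffeomorph 𝓘(ℝ, Plane) 𝓘(ℝ, Plane) ∞ q
  lattice : ∀ z : Plane, stdLattice = (P.fiber (q z)).map (codiff q z)

variable {P : CotangentLattice B} {q : C(Plane, B)}

/-- The differential of `q` at `z`, with both tangent spaces identified with the plane. -/
def IsLatticeCover.diff (hq : IsLatticeCover P q) (z : Plane) : Plane ≃L[ℝ] Plane :=
  (hq.isLocalDiffeomorph z).mfderivToContinuousLinearEquiv (by simp)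

/-- The codifferential of `q`, with the cotangent space of the plane at `z` identified with the dual
of the plane. -/
def pullCovector (q : Plane → B) (z : Plane) : Cotangent (q z) →+ (Plane →L[ℝ] ℝ) := codiff q z

/-- The covector `ℓ ∘ (dq_z)⁻¹` at the point `q z`. -/
def IsLatticeCover.pushCovector (hq : IsLatticeCover P q) (z : Plane) (ℓ : Plane →L[ℝ] ℝ) :
    Plane →L[ℝ] ℝ := ℓ.comp ((hq.diff z).symm : Plane →L[ℝ] Plane)

theorem IsLatticeCover.pullCovector_pushCovector (hq : IsLatticeCover P q) (z : Plane)
    (ℓ : Plane →L[ℝ] ℝ) : pullCovector q z (hq.pushCovector z ℓ) = ℓ := by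
  refine ContinuousLinearMap.ext fun v => ?_
  exact congrArg ℓ ((hq.diff z).symm_apply_apply v)

theorem IsLatticeCover.pushCovector_pullCovector (hq : IsLatticeCover P q) (z : Plane)
    (α : Cotangent (q z)) : hq.pushCovector z (pullCovector q z α) = α := by
  refine ContinuousLinearMap.ext fun v => ?_
  exact congrArg (α : Plane →L[ℝ] ℝ) ((hq.diff z).apply_symm_apply v)

theorem IsLatticeCover.pullCovector_injective (hq : IsLatticeCover P q) (z : Plane) :
    Function.Injective (pullCovector q z) := fun α β h => by
  rw [← hq.pushCovector_pullCovector z α, h, hq.pushCovector_pullCovector]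

theorem pullbackForm_toForm (β : CovectorField B) (z : Plane) :
    pullbackForm q (toForm β) z =
      ContinuousAlternatingMap.ofSubsingleton ℝ Plane ℝ (0 : Fin 1)
          (pullCovector q z (β (q z))) := rfl

theorem IsLatticeCover.mem_fiber_iff (hq : IsLatticeCover P q) (z : Plane) (α : Cotangent (q z)) :
    α ∈ P.fiber (q z) ↔ pullCovector q z α ∈ stdLattice := by
  rw [hq.lattice z]
  refine ⟨fun h => ⟨α, h, rfl⟩, ?_⟩
  rintro ⟨α', h, h'⟩
  exact (hq.pullCovector_injective z h') ▸ h

variable [IsManifold 𝓘(ℝ, Plane) ∞ B]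

theorem continuousAt_pullCovector (hq : IsLocalDiffeomorph 𝓘(ℝ, Plane) 𝓘(ℝ, Plane) ∞ q)
    {β : CovectorField B} {V : Set B}
    (hβ : SmoothOn (toForm β) V) (hV : IsOpen V) {z : Plane} (hz : q z ∈ V) :
    ContinuousAt (fun z => pullCovector q z (β (q z))) z := by
  have h := (SmoothOn.contDiffAt_pullback hq hβ hV hz).continuousAt
  have h2 : (fun z => pullCovector q z (β (q z))) = fun z =>
      (ContinuousAlternatingMap.ofSubsingletonLIE (𝕜 := ℝ) (E := Plane) (F := ℝ) (0 : Fin 1)).symm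
        (pullbackForm q (toForm β) z) := rfl
  rw [h2]
  exact (LinearIsometryEquiv.continuous _).continuousAt.comp h

variable {X : Type*} [TopologicalSpace X]

/-- The pull-back to the plane of a section of `P` along `q ∘ σ` is constant. -/
theorem IsLatticeCover.exists_covec_eq [PreconnectedSpace X] [Nonempty X] (hq : IsLatticeCover P q)
    {σ : C(X, Plane)} (s : sectionsAlong P (q.comp σ)) :
    ∃ p, ∀ t, covec p = pullCovector q (σ t) (s.1 t) := by
  have hmem : ∀ t, pullCovector q (σ t) (s.1 t) ∈ stdLattice := fun t => by
    obtain ⟨V, hV, htV, β, hβ, hβP, he⟩ := s.2 t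
    have h1 : s.1 t = β (q (σ t)) := he.self_of_nhds
    rw [h1]
    exact (hq.mem_fiber_iff _ _).1 (hβP _ htV)
  have hloc : IsLocallyConstant (fun t => pullCovector q (σ t) (s.1 t)) := by
    refine (IsLocallyConstant.iff_eventually_eq _).2 fun t => ?_
    obtain ⟨V, hV, htV, β, hβ, hβP, he⟩ := s.2 t
    have h1 := (continuousAt_pullCovector hq.isLocalDiffeomorph hβ hV htV).comp
      (f := fun t => σ t) σ.continuous.continuousAt
    have h2 := eventually_eq_of_mem_stdLattice h1 (by
      filter_upwards [(q.comp σ).continuous.continuousAt.eventually (hV.mem_nhds htV)] with t' ht'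
      exact (hq.mem_fiber_iff _ _).1 (hβP _ ht'))
    filter_upwards [h2, he] with t' h3 h4
    have h5 : s.1 t = β (q (σ t)) := he.self_of_nhds
    have h6 : s.1 t' = β (q (σ t')) := h4
    rw [h5, h6]
    exact h3
  obtain ⟨t₀⟩ := ‹Nonempty X›
  obtain ⟨p, hp⟩ := mem_stdLattice.1 (hmem t₀)
  exact ⟨p, fun t => hp.trans (hloc.apply_eq_of_preconnectedSpace _ _)⟩

/-- Every integral covector on the plane is the pull-back of a section of `P` along `q ∘ σ`. -/
theorem IsLatticeCover.exists_section (hq : IsLatticeCover P q) (σ : C(X, Plane)) (p : ℤ × ℤ) :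
    ∃ s : sectionsAlong P (q.comp σ), ∀ t, covec p = pullCovector q (σ t) (s.1 t) := by
  refine ⟨⟨fun t => hq.pushCovector (σ t) (covec p), fun t₀ => ?_⟩,
    fun t => (hq.pullCovector_pushCovector _ _).symm⟩
  obtain ⟨e, he, hqe⟩ := hq.isCoveringMap.isLocalHomeomorph (σ t₀)
  let β : CovectorField B := fun y => hq.pushCovector (e.symm y) (covec p)
  have hβ : ∀ z ∈ e.source, β (q z) = hq.pushCovector z (covec p) := fun z hz => by
    have h1 : e.symm (q z) = z := by rw [hqe]; exact e.left_inv hz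
    change hq.pushCovector (e.symm (q z)) (covec p) = _
    rw [h1]
  have hV : ∀ y ∈ e.target, ∃ z ∈ e.source, q z = y := fun y hy =>
    ⟨e.symm y, e.map_target hy, by rw [hqe]; exact e.right_inv hy⟩
  refine ⟨e.target, e.open_target, ?_, β, ?_, ?_, ?_⟩
  · have := e.map_source he
    rw [← hqe] at this; exact this
  · refine smoothOn_of_pullback hq.isLocalDiffeomorph fun y hy => ?_
    obtain ⟨z, hz, rfl⟩ := hV y hy
    refine ⟨z, rfl, ContDiffAt.congr_of_eventuallyEq (f := fun _ =>
      ContinuousAlternatingMap.ofSubsingleton ℝ Plane ℝ (0 : Fin 1) (covec p)) contDiffAt_const ?_⟩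
    filter_upwards [e.open_source.mem_nhds hz] with w hw
    rw [pullbackForm_toForm, hβ w hw]
    exact congrArg _ (hq.pullCovector_pushCovector _ _)
  · intro y hy
    obtain ⟨z, hz, rfl⟩ := hV y hy
    rw [hβ z hz]
    refine (hq.mem_fiber_iff _ _).2 ?_
    rw [hq.pullCovector_pushCovector]
    exact mem_stdLattice.2 ⟨p, rfl⟩
  · filter_upwards [σ.continuous.continuousAt.eventually (e.open_source.mem_nhds he)] with t ht
    exact (hβ _ ht).symm

/-- The sections of `P` along `q ∘ σ` are identified with the integral covectors on the plane. -/
def IsLatticeCover.sectionEquiv [PreconnectedSpace X] [Nonempty X] (hq : IsLatticeCover P q)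
    (σ : C(X, Plane)) : sectionsAlong P (q.comp σ) ≃+ ℤ × ℤ where
  toFun s := (hq.exists_covec_eq s).choose
  invFun p := (hq.exists_section σ p).choose
  left_inv s := by
    refine Subtype.ext (funext fun t => hq.pullCovector_injective _ ?_)
    exact ((hq.exists_section σ (hq.exists_covec_eq s).choose).choose_spec t).symm.trans
      ((hq.exists_covec_eq s).choose_spec t)
  right_inv p := by
    obtain ⟨t⟩ := ‹Nonempty X›
    exact covec_injective (((hq.exists_covec_eq (hq.exists_section σ p).choose).choose_spec t).trans
      ((hq.exists_section σ p).choose_spec t).symm)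
  map_add' s s' := by
    obtain ⟨t⟩ := ‹Nonempty X›
    refine covec_injective ?_
    refine ((hq.exists_covec_eq (s + s')).choose_spec t).symm.symm.trans ?_
    refine (map_add (pullCovector q (σ t)) (s.1 t) (s'.1 t)).trans ?_
    rw [map_add, (hq.exists_covec_eq s).choose_spec t, (hq.exists_covec_eq s').choose_spec t]

theorem IsLatticeCover.covec_sectionEquiv [PreconnectedSpace X] [Nonempty X]
    (hq : IsLatticeCover P q)
    (σ : C(X, Plane)) (s : sectionsAlong P (q.comp σ)) (t : X) :
    covec (hq.sectionEquiv σ s) = pullCovector q (σ t) (s.1 t) :=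
  (hq.exists_covec_eq s).choose_spec t

end Cover

section Lifts

variable {B : Type*} [TopologicalSpace B] {q : C(Plane, B)} {k : ℕ}

/-- The contraction of the simplex to its vertex `0`. -/
def simplexContraction (k : ℕ) : C(unitInterval × Simplex k, Simplex k) where
  toFun p := ⟨fun i => (1 - (p.1 : ℝ)) * (stdSimplex.vertex
      (S := ℝ) (0 : Fin (k + 1))) i + p.1 * p.2 i, by
    have h := (convex_stdSimplex ℝ (Fin (k + 1))) (stdSimplex.vertex
        (S := ℝ) (0 : Fin (k + 1))).2 p.2.2
      (sub_nonneg.2 p.1.2.2) p.1.2.1 (sub_add_cancel 1 (p.1 : ℝ))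
    exact h⟩
  continuous_toFun := by
    refine Continuous.subtype_mk (continuous_pi fun i => ?_) _
    have h1 : Continuous fun p : unitInterval × Simplex k => (p.1 : ℝ) :=
      continuous_subtype_val.comp continuous_fst
    have h2 : Continuous fun p : unitInterval × Simplex k => p.2 i :=
      (continuous_simplex_apply i).comp continuous_snd
    exact ((continuous_const.sub h1).mul continuous_const).add (h1.mul h2)

theorem simplexContraction_zero (x : Simplex k) :
    simplexContraction k (0, x) = stdSimplex.vertex 0 := by
  refine stdSimplex.ext (funext fun i => ?_)
  change (1 - ((0 : unitInterval) : ℝ)) * _ + ((0 : unitInterval) : ℝ) * _ = _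
  simp

theorem simplexContraction_one (x : Simplex k) : simplexContraction k (1, x) = x := by
  refine stdSimplex.ext (funext fun i => ?_)
  change (1 - ((1 : unitInterval) : ℝ)) * _ + ((1 : unitInterval) : ℝ) * _ = _
  simp

/-- Singular simplices lift along a covering: lift the contraction of the simplex to its vertex,
using the homotopy lifting property. -/
theorem exists_lift_simplex (hq : IsCoveringMap q) (σ : C(Simplex k, B)) (z : Plane)
    (hz : q z = σ (stdSimplex.vertex 0)) : ∃ σ' : C(Simplex k, Plane), q.comp σ' = σ := by
  have h0 : ∀ a, (σ.comp (simplexContraction k)) (0, a) = q (ContinuousMap.const (Simplex k) z a) :=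
    fun a => by rw [ContinuousMap.comp_apply, simplexContraction_zero, ← hz]; rfl
  refine ⟨(hq.liftHomotopy _ _ h0).comp (ContinuousMap.prodMk (ContinuousMap.const _ 1)
    (ContinuousMap.id _)), ?_⟩
  ext1 x
  have h1 := congrFun (hq.liftHomotopy_lifts _ _ h0) (1, x)
  have h2 : (σ.comp (simplexContraction k)) (1, x) = σ x := by
    rw [ContinuousMap.comp_apply, simplexContraction_one]
  exact h1.trans h2

instance (k : ℕ) : Nonempty (Simplex k) := ⟨stdSimplex.vertex 0⟩

instance (k : ℕ) : PreconnectedSpace (Simplex k) :=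
  isPreconnected_iff_preconnectedSpace.1 (convex_stdSimplex ℝ (Fin (k + 1))).isPreconnected

end Lifts

/-! ### Equivariant cochains of the plane -/

section Dictionary

variable {B : Type*} [TopologicalSpace B] [ChartedSpace Plane B] {k : ℕ}

/-- The diffeomorphisms `g` of the plane that preserve the cochain `F` with values in the integral
covectors: `F (g ∘ σ)`, pulled back by `g`, equals `F σ`. -/
def cochainStabilizer (F : C(Simplex k, Plane) → ℤ × ℤ) : Subgroup (Equiv.Perm Plane) where
  carrier := {g | g ∈ smoothPerms ∧ ∀ σ σ' : C(Simplex k, Plane), (∀ t, σ' t = g (σ t)) →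
    (covec (F σ')).comp (fderiv ℝ g (σ (stdSimplex.vertex 0))) = covec (F σ)}
  mul_mem' := by
    rintro a b ⟨ha, ha'⟩ ⟨hb, hb'⟩
    refine ⟨mul_mem ha hb, fun σ σ' h => ?_⟩
    have h1 : ∀ z, fderiv ℝ (⇑(a * b)) z = (fderiv ℝ a (b z)).comp (fderiv ℝ b z) := fun z =>
      fderiv_comp z (ha.1.differentiable (by simp) _) (hb.1.differentiable (by simp) _)
    have h2 := hb' σ (ContinuousMap.comp ⟨b, hb.1.continuous⟩ σ) fun t => rfl
    have h3 := ha' (ContinuousMap.comp ⟨b, hb.1.continuous⟩ σ) σ' h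
    rw [h1, ← h2, ← h3]
    rfl
  one_mem' := by
    refine ⟨one_mem _, fun σ σ' h => ?_⟩
    have h1 : fderiv ℝ (⇑(1 : Equiv.Perm Plane)) (σ (stdSimplex.vertex 0)) =
      ContinuousLinearMap.id ℝ Plane := fderiv_id
    rw [h1, show σ' = σ from ContinuousMap.ext h]; rfl
  inv_mem' := by
    rintro a ⟨ha, ha'⟩
    refine ⟨inv_mem ha, fun σ σ' h => ?_⟩
    have h0 : ∀ t, σ t = a (σ' t) := fun t => by rw [h]; simp
    have h1 : (fderiv ℝ a (σ' (stdSimplex.vertex 0))).comp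
        (fderiv ℝ (⇑(a⁻¹)) (σ (stdSimplex.vertex 0))) = ContinuousLinearMap.id ℝ Plane := by
      have h0 := fderiv_comp (𝕜 := ℝ) (g := ⇑a) (f := ⇑(a⁻¹)) (σ (stdSimplex.vertex 0))
        (ha.1.differentiable (by simp) _) (ha.2.differentiable (by simp) _)
      have : ⇑a ∘ ⇑(a⁻¹) = id := by ext1 w; simp
      rw [h, ← h0, this]; exact fderiv_id
    rw [← ha' σ' σ h0, ContinuousLinearMap.comp_assoc, h1]
    rfl

/-- The automorphism `τ` describes the push-forward of integral covectors by the diffeomorphism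
`t`. -/
structure IsTwist (t : Plane ≃ₜ Plane) (τ : ℤ × ℤ ≃+ ℤ × ℤ) : Prop where
  mem_smoothPerms : t.toEquiv ∈ smoothPerms
  comp_fderiv : ∀ p z, (covec (τ p)).comp (fderiv ℝ t z) = covec p

theorem IsTwist.mem_cochainStabilizer_iff {t : Plane ≃ₜ Plane} {τ : ℤ × ℤ ≃+ ℤ × ℤ}
    (h : IsTwist t τ) {F : C(Simplex k, Plane) → ℤ × ℤ} :
    t.toEquiv ∈ cochainStabilizer F ↔ cochainAct t τ k F = F := by
  rw [act_eq_iff]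
  constructor
  · rintro ⟨-, h2⟩ σ
    have h3 := h2 σ (push t k σ) fun _ => rfl
    have h4 := h.comp_fderiv (τ.symm (F (push t k σ))) (σ (stdSimplex.vertex 0))
    rw [AddEquiv.apply_symm_apply] at h4
    rw [← covec_injective (h4.symm.trans h3), AddEquiv.apply_symm_apply]
  · refine fun h2 => ⟨h.mem_smoothPerms, fun σ σ' h3 => ?_⟩
    have h4 : σ' = push t k σ := ContinuousMap.ext h3
    rw [h4, h2]
    exact h.comp_fderiv _ _

variable {P : CotangentLattice B} {q : C(Plane, B)}

theorem IsLatticeCover.exists_lift (hq : IsLatticeCover P q) (σ : C(Simplex k, B)) :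
    ∃ σ' : C(Simplex k, Plane), q.comp σ' = σ :=
  let ⟨z, hz⟩ := hq.surjective (σ (stdSimplex.vertex 0))
  exists_lift_simplex hq.isCoveringMap σ z hz

theorem IsLatticeCover.diff_comp (hq : IsLatticeCover P q) {g : Equiv.Perm Plane}
    (hg : g ∈ smoothPerms) (hqg : ∀ z, q (g z) = q z) (z v : Plane) :
    hq.diff (g z) (fderiv ℝ g z v) = hq.diff z v := by
  have h1 := mfderiv_comp z (hq.isLocalDiffeomorph.mdifferentiable (by simp) (g z))
    ((hg.1.differentiable (by simp) z).mdifferentiableAt)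
  rw [mfderiv_eq_fderiv] at h1
  have h2 : mfderiv 𝓘(ℝ, Plane) 𝓘(ℝ, Plane) (q ∘ g) z = mfderiv 𝓘(ℝ, Plane) 𝓘(ℝ, Plane) q z := by
    rw [show q ∘ g = q from funext hqg]
  exact congrArg (fun L : Plane →L[ℝ] Plane => L v) (h1.symm.trans h2)

variable [IsManifold 𝓘(ℝ, Plane) ∞ B]

/-- The lift to the plane of a cochain with values in `P`. -/
def IsLatticeCover.liftCochain (hq : IsLatticeCover P q) (k : ℕ) :
    Cochain P k →+ (C(Simplex k, Plane) → ℤ × ℤ) where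
  toFun c σ := hq.sectionEquiv σ (c (q.comp σ))
  map_zero' := funext fun σ => map_zero (hq.sectionEquiv σ)
  map_add' _ _ := funext fun σ => map_add (hq.sectionEquiv σ) _ _

theorem IsLatticeCover.covec_liftCochain (hq : IsLatticeCover P q) (c : Cochain P k)
    (σ : C(Simplex k, Plane)) (t : Simplex k) :
    covec (hq.liftCochain k c σ) = pullCovector q (σ t) ((c (q.comp σ)).1 t) :=
  hq.covec_sectionEquiv σ _ t

/-- The lift to the plane commutes with the coboundary. -/
theorem IsLatticeCover.isCoboundaryOf_iff (hq : IsLatticeCover P q) {b : Cochain P k}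
    {c : Cochain P (k + 1)} :
    IsCoboundaryOf P b c ↔ hq.liftCochain (k + 1) c = cobd (hq.liftCochain k b) := by
  constructor
  · intro h
    funext σ
    obtain ⟨τ, hτ, hc⟩ := h (q.comp σ)
    have h1 : c (q.comp σ) = ∑ i : Fin (k + 2), (-1 : ℤ) ^ (i : ℕ) • τ i := by
      refine Subtype.ext (funext fun t => (hc t).trans ?_)
      rw [AddSubgroup.val_finsetSum, Finset.sum_apply]
      rfl
    have h2 : ∀ i, hq.sectionEquiv σ (τ i) = hq.liftCochain k b (σ.comp (face k i)) := fun i => by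
      refine covec_injective ?_
      rw [hq.covec_liftCochain b _ (stdSimplex.vertex 0),
        hq.covec_sectionEquiv σ (τ i) (face k i (stdSimplex.vertex 0))]
      exact congrArg _ (hτ i (stdSimplex.vertex 0))
    change hq.sectionEquiv σ (c (q.comp σ)) = _
    rw [h1, map_sum, cobd_apply]
    refine Finset.sum_congr rfl fun i _ => ?_
    rw [map_zsmul, h2]
  · intro h σ
    obtain ⟨σ, rfl⟩ := hq.exists_lift σ
    refine ⟨fun i => (hq.sectionEquiv σ).symm (hq.liftCochain k b (σ.comp (face k i))),
      fun i t => ?_, fun t => ?_⟩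
    · refine hq.pullCovector_injective (σ (face k i t)) ?_
      refine (hq.covec_sectionEquiv σ _ (face k i t)).symm.trans ?_
      rw [AddEquiv.apply_symm_apply]
      exact hq.covec_liftCochain b _ t
    · have h1 : c (q.comp σ) = ∑ i : Fin (k + 2), (-1 : ℤ) ^ (i : ℕ) •
          (hq.sectionEquiv σ).symm (hq.liftCochain k b (σ.comp (face k i))) := by
        refine (hq.sectionEquiv σ).injective ?_
        have h2 := congrFun h σ
        rw [cobd_apply] at h2
        refine h2.trans ?_
        rw [map_sum]
        refine Finset.sum_congr rfl fun i _ => ?_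
        rw [map_zsmul, AddEquiv.apply_symm_apply]
      rw [h1, AddSubgroup.val_finsetSum, Finset.sum_apply]
      rfl

variable {G : Subgroup (Equiv.Perm Plane)}

theorem IsLatticeCover.covec_liftCochain_comp (hq : IsLatticeCover P q) {g : Equiv.Perm Plane}
    (hg : g ∈ smoothPerms) (hqg : ∀ z, q (g z) = q z) (c : Cochain P k) {σ σ' : C(Simplex k, Plane)}
    (h : ∀ t, σ' t = g (σ t)) :
    (covec (hq.liftCochain k c σ')).comp (fderiv ℝ g (σ (stdSimplex.vertex 0))) =
      covec (hq.liftCochain k c σ) := by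
  have h1 : ∀ τ τ' : C(Simplex k, B), τ = τ' → ((c τ).1 (stdSimplex.vertex 0) : Plane →L[ℝ] ℝ) =
    (c τ').1 (stdSimplex.vertex 0) := by rintro τ _ rfl; rfl
  have h2 := h1 (q.comp σ') (q.comp σ) (by ext1 t; simp [h, hqg])
  ext1 v
  rw [hq.covec_liftCochain c σ (stdSimplex.vertex 0), hq.covec_liftCochain c σ'
      (stdSimplex.vertex 0)]
  change ((c (q.comp σ')).1 (stdSimplex.vertex 0) : Plane →L[ℝ] ℝ)
      (hq.diff (σ' (stdSimplex.vertex 0)) (fderiv ℝ g (σ (stdSimplex.vertex 0)) v)) =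
    ((c (q.comp σ)).1 (stdSimplex.vertex 0) : Plane →L[ℝ] ℝ) (hq.diff (σ (stdSimplex.vertex 0)) v)
  rw [h, hq.diff_comp hg hqg, h2]
  rfl

/-- The lifts of cochains on `ℝ²/G` are the `G`-equivariant cochains of the plane. -/
theorem IsLatticeCover.exists_liftCochain_eq_iff (hq : IsLatticeCover P q) (hG : G ≤ smoothPerms)
    (hfib : ∀ z z' : Plane, q z = q z' ↔ ∃ g ∈ G, g z = z') {F : C(Simplex k, Plane) → ℤ × ℤ} :
    (∃ c, hq.liftCochain k c = F) ↔ G ≤ cochainStabilizer F := by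
  have hqg : ∀ g ∈ G, ∀ z, q (g z) = q z := fun g hg z => ((hfib z (g z)).2 ⟨g, hg, rfl⟩).symm
  constructor
  · rintro ⟨c, rfl⟩ g hg
    exact ⟨hG hg, fun σ σ' h => hq.covec_liftCochain_comp (hG hg) (hqg g hg) c h⟩
  · intro hF
    have key : ∀ σ : C(Simplex k, B), ∃ s : sectionsAlong P σ, ∀ σ' : C(Simplex k, Plane),
        q.comp σ' = σ → ∀ v, (s.1 (stdSimplex.vertex 0) : Plane →L[ℝ] ℝ)
          (hq.diff (σ' (stdSimplex.vertex 0)) v) = covec (F σ') v := by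
      intro σ
      obtain ⟨σ, rfl⟩ := hq.exists_lift σ
      refine ⟨(hq.sectionEquiv σ).symm (F σ), fun σ' h v => ?_⟩
      have h0 : ∀ t, q (σ' t) = q (σ t) := fun t => congrArg (fun f : C(Simplex k, B) => f t) h
      obtain ⟨g, hg, hgz⟩ := (hfib _ _).1 (h0 (stdSimplex.vertex 0))
      have hgc : Continuous g := (hG hg).1.continuous
      have h1 : σ = ContinuousMap.comp ⟨g, hgc⟩ σ' := by
        refine DFunLike.coe_injective (hq.isCoveringMap.eq_of_comp_eq σ.continuous
          (ContinuousMap.continuous _) (funext fun t => ?_) (stdSimplex.vertex 0) hgz.symm)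
        exact (h0 t).symm.trans (hqg g hg (σ' t)).symm
      have h2 := (hF hg).2 σ' σ (fun t => by rw [h1]; rfl)
      have h3 := hq.covec_sectionEquiv σ ((hq.sectionEquiv σ).symm (F σ)) (stdSimplex.vertex 0)
      rw [AddEquiv.apply_symm_apply] at h3
      rw [← h2, h3, ← hq.diff_comp (hG hg) (hqg g hg) _ v, hgz]
      rfl
    choose c hc using key
    refine ⟨c, funext fun σ => covec_injective (ContinuousLinearMap.ext fun v => ?_)⟩
    rw [hq.covec_liftCochain c σ (stdSimplex.vertex 0)]
    exact hc (q.comp σ) σ rfl v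

/-- The second cohomology of the quotient of the plane by a group generated by a pair of shifts. -/
theorem IsLatticeCover.nonempty_latticeH2_equiv (hq : IsLatticeCover P q) {s t : Plane ≃ₜ Plane}
    {σ τ : ℤ × ℤ ≃+ ℤ × ℤ} {D : ℤ × ℤ →+ ℤ × ℤ} (hs : IsTwist s σ) (ht : IsTwist t τ)
    (h : ShiftPair s t σ τ D)
    (hfib : ∀ z z' : Plane, q z = q z' ↔
      ∃ g ∈ Subgroup.closure {s.toEquiv, t.toEquiv}, g z = z') :
    Nonempty (LatticeH2 P ≃+ (ℤ × ℤ) ⧸ relations σ D) := by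
  have hG : Subgroup.closure {s.toEquiv, t.toEquiv} ≤ smoothPerms := by
    rw [Subgroup.closure_le]
    rintro _ (rfl | rfl)
    exacts [hs.mem_smoothPerms, ht.mem_smoothPerms]
  have hE : ∀ {k : ℕ} {F : C(Simplex k, Plane) → ℤ × ℤ}, (∃ c, hq.liftCochain k c = F) ↔
      cochainAct s σ k F = F ∧ cochainAct t τ k F = F := fun {k F} => by
    rw [hq.exists_liftCochain_eq_iff hG hfib, Subgroup.closure_le, Set.insert_subset_iff,
      Set.singleton_subset_iff]
    exact and_congr hs.mem_cochainStabilizer_iff ht.mem_cochainStabilizer_iff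
  have hcoc : ∀ c : Cochain P 2, c ∈ cocycles P ↔ cobd (hq.liftCochain 2 c) = 0 := fun c => by
    refine (hq.isCoboundaryOf_iff (b := c) (c := 0)).trans ?_
    rw [map_zero, eq_comm]
  let W : AddSubgroup (cocycles P × (ℤ × ℤ)) :=
    { carrier := {w | Obstruction s t σ τ (hq.liftCochain 2 w.1.1) w.2}
      zero_mem' := ⟨0, 0, by simp, by simp, by simp, by simp; rfl⟩
      add_mem' := fun {a b} ha hb => by
        have := ha.add hb
        rw [← map_add] at this
        exact this
      neg_mem' := fun {a} ha => by
        have := ha.neg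
        rw [← map_neg] at this
        exact this }
  refine nonempty_quotient_equiv W (fun c => ?_) (fun κ => ?_) (fun c κ hc => ?_)
  · obtain ⟨h1, h2⟩ := hE.1 ⟨c.1, rfl⟩
    exact h.exists_obstruction ((hcoc _).1 c.2) h1 h2
  · obtain ⟨f, h1, h2, h3, h4⟩ := h.exists_cocycle κ
    obtain ⟨c, rfl⟩ := hE.2 ⟨h2, h3⟩
    exact ⟨⟨c, (hcoc c).2 h1⟩, h4⟩
  · rw [← h.obstruction_mem_iff hc]
    constructor
    · rintro ⟨b, hb⟩
      obtain ⟨h1, h2⟩ := hE.1 ⟨b, rfl⟩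
      exact ⟨hq.liftCochain 1 b, h1, h2, (hq.isCoboundaryOf_iff.1 hb).symm⟩
    · rintro ⟨b, h1, h2, h3⟩
      obtain ⟨b, rfl⟩ := hE.2 ⟨h1, h2⟩
      exact ⟨b, hq.isCoboundaryOf_iff.2 h3.symm⟩

/-- The second cohomology of the quotient of the plane by a cyclic group of shifts vanishes. -/
theorem IsLatticeCover.subsingleton_latticeH2 (hq : IsLatticeCover P q) {t : Plane ≃ₜ Plane}
    {τ : ℤ × ℤ ≃+ ℤ × ℤ} (ht : IsTwist t τ) {i : Plane → ℤ} (hi : ∀ z, i (t z) = i z + 1)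
    (hfib : ∀ z z' : Plane, q z = q z' ↔ ∃ g ∈ Subgroup.closure {t.toEquiv}, g z = z') :
    Subsingleton (LatticeH2 P) := by
  have hG : Subgroup.closure {t.toEquiv} ≤ smoothPerms := by
    rw [Subgroup.closure_le]
    rintro _ rfl
    exact ht.mem_smoothPerms
  have hE : ∀ {k : ℕ} {F : C(Simplex k, Plane) → ℤ × ℤ}, (∃ c, hq.liftCochain k c = F) ↔
      cochainAct t τ k F = F := fun {k F} => by
    rw [hq.exists_liftCochain_eq_iff hG hfib, Subgroup.closure_le, Set.singleton_subset_iff]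
    exact ht.mem_cochainStabilizer_iff
  rw [QuotientAddGroup.subsingleton_iff]
  refine eq_top_iff.2 fun c _ => ?_
  have h1 : cobd (hq.liftCochain 2 c.1) = 0 := by
    rw [← hq.isCoboundaryOf_iff.1 c.2, map_zero]
  obtain ⟨b, h2, h3⟩ := exists_invariant_primitive hi h1 (hE.1 ⟨_, rfl⟩)
  obtain ⟨b, rfl⟩ := hE.2 h2
  exact ⟨b, hq.isCoboundaryOf_iff.2 h3.symm⟩

/-- If `B` is the plane itself, then the cone operator contracts the complex of cochains. -/
theorem IsLatticeCover.subsingleton_latticeH2_of_injective (hq : IsLatticeCover P q)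
    (hinj : Function.Injective q) : Subsingleton (LatticeH2 P) := by
  have hE : ∀ {k : ℕ} {F : C(Simplex k, Plane) → ℤ × ℤ}, (∃ c, hq.liftCochain k c = F) :=
    fun {k F} => (hq.exists_liftCochain_eq_iff (G := ⊥) bot_le fun z z' => by
      simp [hinj.eq_iff]).2 bot_le
  rw [QuotientAddGroup.subsingleton_iff]
  refine eq_top_iff.2 fun c _ => ?_
  have h1 : cobd (hq.liftCochain 2 c.1) = 0 := by
    rw [← hq.isCoboundaryOf_iff.1 c.2, map_zero]
  obtain ⟨b, hb⟩ := hE (F := fun σ => hq.liftCochain 2 c.1 (cone σ))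
  exact ⟨b, hq.isCoboundaryOf_iff.2 (hb ▸ eq_cobd_cone h1)⟩

end Dictionary

/-! ### Cohomology with local coefficients for the series -/

section ShiftPairs

variable {L : Type*} [AddCommGroup L] {s t : Plane ≃ₜ Plane} {σ τ : L ≃+ L}

theorem cochainAct_comp {k : ℕ} (F : C(Simplex k, Plane) → L) (x : C(Simplex k, Plane)) :
    cochainAct s σ k (cochainAct t τ k F) (push s k (push t k x)) = σ (τ (F x)) := by
  rw [act_apply, act_apply, Equiv.symm_apply_apply, Equiv.symm_apply_apply]

theorem cochainAct_push {k : ℕ} (F : C(Simplex k, Plane) → L) (x : C(Simplex k, Plane)) :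
    cochainAct s σ k F (push s k x) = σ (F x) := by
  rw [act_apply, Equiv.symm_apply_apply]

/-- Commuting shifts, as for a torus. Here `(S - 1)(T - 1) = (T - 1)(S - 1)`, so `D = τ - 1`. -/
theorem ShiftPair.of_commute {i j : Plane → ℤ} (hst : ∀ z, s (t z) = t (s z))
    (hστ : ∀ p, σ (τ p) = τ (σ p)) (hit : ∀ z, i (t z) = i z + 1) (his : ∀ z, i (s z) = i z)
    (hjs : ∀ z, j (s z) = j z + 1) :
    ShiftPair s t σ τ (τ.toAddMonoidHom - AddMonoidHom.id L) := by
  have hpush : ∀ k (x : C(Simplex k, Plane)), push s k (push t k x) = push t k (push s k x) :=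
    fun k x => ContinuousMap.ext fun y => hst (x y)
  have hact : ∀ k (F : C(Simplex k, Plane) → L), cochainAct s σ k (cochainAct t τ k F) =
      cochainAct t τ k (cochainAct s σ k F) := fun k F => funext fun x => by
    obtain ⟨x, rfl⟩ := (push t k).surjective x
    obtain ⟨x, rfl⟩ := (push s k).surjective x
    rw [cochainAct_comp (s := t), ← hpush, cochainAct_comp, hστ]
  refine ⟨⟨i, hit, his⟩, ⟨j, hjs⟩, fun k F hF => ⟨by rw [hact, hF], ?_⟩, fun u μ hu => ?_⟩
  · refine (cochainAct t τ k).injective ?_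
    rw [← hact, AddEquiv.apply_symm_apply, hF]
  · have h1 : cochainAct s σ 0 (cochainAct t τ 0 u - u) - (cochainAct t τ 0 u - u) =
        cochainAct t τ 0 (cochainAct s σ 0 u - u) - (cochainAct s σ 0 u - u) := by
      rw [map_sub, map_sub, hact]; abel
    rw [h1, hu]
    rfl

/-- Shifts with `s t s = t`, as for a Klein bottle. If `S u = u + μ`, then `S T u = T S⁻¹ u` equals
`T u - σ τ μ`, and therefore `(S - 1)(T - 1) u = -(σ τ + 1) μ`. -/
theorem ShiftPair.of_inv {i j : Plane → ℤ} (hst : ∀ z, s (t (s z)) = t z)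
    (hστ : ∀ p, σ (τ (σ p)) = τ p) (hit : ∀ z, i (t z) = i z + 1) (his : ∀ z, i (s z) = i z)
    (hjs : ∀ z, j (s z) = j z + 1) :
    ShiftPair s t σ τ (-(σ.toAddMonoidHom.comp τ.toAddMonoidHom + AddMonoidHom.id L)) := by
  have hpush : ∀ k (x : C(Simplex k, Plane)), push s k (push t k (push s k x)) = push t k x :=
    fun k x => ContinuousMap.ext fun y => hst (x y)
  have hact : ∀ k (F : C(Simplex k, Plane) → L), cochainAct s σ k (cochainAct t τ k
      (cochainAct s σ k F)) = cochainAct t τ k F := fun k F => funext fun x => by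
    obtain ⟨x, rfl⟩ := (push t k).surjective x
    rw [cochainAct_push (s := t), ← hpush, cochainAct_comp, cochainAct_push, hστ]
  refine ⟨⟨i, hit, his⟩, ⟨j, hjs⟩, fun k F hF => ⟨?_, ?_⟩, fun u μ hu => ?_⟩
  · have := hact k F
    rwa [hF] at this
  · refine (cochainAct t τ k).injective ?_
    have h1 := hact k ((cochainAct t τ k).symm F)
    rw [AddEquiv.apply_symm_apply] at h1 ⊢
    refine (cochainAct s σ k).injective ?_
    rw [h1, hF]
  · have h1 : cochainAct s σ 0 u = u + fun _ => μ := by rw [← hu]; abel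
    have h2 := hact 0 u
    rw [h1, map_add, map_add] at h2
    have h3 : cochainAct s σ 0 (cochainAct t τ 0 u) = cochainAct t τ 0 u -
        cochainAct s σ 0 (cochainAct t τ 0 (fun _ => μ)) := eq_sub_of_add_eq h2
    rw [map_sub, h3, h1]
    funext x
    simp only [Pi.sub_apply, Pi.add_apply, act_const]
    change _ = -(σ (τ μ) + μ)
    abel

end ShiftPairs

section Series

/-- The affine map `upperAff k ε c d` as a homeomorphism. -/
def affHomeo (k : ℤ) (ε : ℤˣ) (c d : ℝ) : Plane ≃ₜ Plane where
  toEquiv := upperAff k ε c d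
  continuous_toFun := (upperAff_mem_smoothPerms k ε c d).1.continuous
  continuous_invFun := (upperAff_mem_smoothPerms k ε c d).2.continuous

theorem affHomeo_apply (k : ℤ) (ε : ℤˣ) (c d : ℝ) (z : Plane) :
    affHomeo k ε c d z = !₂[z 0 + k * z 1 + c, ((ε : ℤ) : ℝ) * z 1 + d] := rfl

/-- The action of the linear map `(1 k; 0 ε)` on integral covectors. -/
def upperTwist (k : ℤ) (ε : ℤˣ) : ℤ × ℤ ≃+ ℤ × ℤ where
  toFun p := (p.1, ε * (p.2 - k * p.1))
  invFun p := (p.1, ε * p.2 + k * p.1)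
  left_inv p := by
    rcases Int.units_eq_one_or ε with rfl | rfl <;> ext <;> simp
  right_inv p := by
    rcases Int.units_eq_one_or ε with rfl | rfl <;> ext <;> simp
  map_add' p p' := by
    ext
    · simp
    · simp only [Prod.fst_add, Prod.snd_add]; ring

theorem upperTwist_apply (k : ℤ) (ε : ℤˣ) (p : ℤ × ℤ) :
    upperTwist k ε p = (p.1, ε * (p.2 - k * p.1)) := rfl

theorem isTwist_affHomeo (k : ℤ) (ε : ℤˣ) (c d : ℝ) : IsTwist (affHomeo k ε c d)
    (upperTwist k ε) := by
  refine ⟨upperAff_mem_smoothPerms k ε c d, fun p z => ContinuousLinearMap.ext fun v => ?_⟩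
  have h : fderiv ℝ (affHomeo k ε c d) z = upperLin k ((ε : ℤ) : ℝ) := fderiv_upperAff k ε c d z
  have hε := units_coe_mul_self ε
  rw [ContinuousLinearMap.comp_apply, h, covec_apply, covec_apply, upperTwist_apply, upperLin_apply]
  simp
  linear_combination (p.2 - k * p.1) * v 1 * hε

variable {B : Type*} [TopologicalSpace B] [ChartedSpace Plane B] {P : CotangentLattice B}
  {q : Plane → B}

theorem IsPresentation.isLatticeCover {G : Subgroup (Equiv.Perm Plane)} (h : IsPresentation P G q) :
    IsLatticeCover P ⟨q, h.isCoveringMap.continuous⟩ :=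
  ⟨h.isCoveringMap, h.surjective, h.isLocalDiffeomorph, h.lattice⟩

theorem floor_div_add (a : ℝ) {x : ℝ} (hx : x ≠ 0) : ⌊(a + x) / x⌋ = ⌊a / x⌋ + 1 := by
  rw [add_div, div_self hx, Int.floor_add_one]

variable [IsManifold 𝓘(ℝ, Plane) ∞ B]

theorem relations_bot {L : Type*} [AddCommGroup L] {σ : L ≃+ L} {D : L →+ L} (hσ : ∀ p, σ p = p)
    (hD : ∀ p, D p = 0) : relations σ D = ⊥ := by
  refine (AddSubgroup.eq_bot_iff_forall _).2 fun κ hκ => ?_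
  obtain ⟨ν, μ, rfl⟩ := mem_relations.1 hκ
  rw [hσ, hD, sub_self, add_zero]

/-- All twists are trivial, so that there are no relations. The heights are the coordinates with
respect to the basis `(u, v)`, `(w, z)`. -/
theorem latticeH2_torus {u v w z : ℝ} (hdet : u * z - v * w ≠ 0)
    (h : IsPresentation P (torusGroup u v w z) q) : Nonempty (LatticeH2 P ≃+ ℤ × ℤ) := by
  have hone : ∀ p, upperTwist 0 1 p = p := fun p => by simp [upperTwist_apply]
  have hp : ShiftPair (affHomeo 0 1 u v) (affHomeo 0 1 w z) (upperTwist 0 1) (upperTwist 0 1) _ :=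
    ShiftPair.of_commute (i := fun p => ⌊(u * p 1 - v * p 0) / (u * z - v * w)⌋)
      (j := fun p => ⌊(z * p 0 - w * p 1) / (u * z - v * w)⌋)
      (fun p => by ext i; fin_cases i <;> simp [affHomeo_apply] <;> ring) (fun p => rfl)
      (fun p => by
        rw [← floor_div_add _ hdet]; congr 2; simp [affHomeo_apply]; ring)
      (fun p => by
        congr 2; simp [affHomeo_apply]; ring)
      (fun p => by
        rw [← floor_div_add _ hdet]; congr 2; simp [affHomeo_apply]; ring)
  obtain ⟨e⟩ := h.isLatticeCover.nonempty_latticeH2_equiv (isTwist_affHomeo 0 1 u v)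
    (isTwist_affHomeo 0 1 w z) hp h.fibers
  rw [relations_bot hone fun p => by
    change upperTwist 0 1 p - p = 0
    rw [hone, sub_self]] at e
  exact ⟨e.trans QuotientAddGroup.quotientBot⟩

theorem nonempty_quotient_equiv_of_surjective {A C : Type*} [AddCommGroup A] [AddCommGroup C]
    {A₀ : AddSubgroup A} (f : A →+ C) (hf : Function.Surjective f) (hk : ∀ a, f a = 0 ↔ a ∈ A₀) :
    Nonempty (A ⧸ A₀ ≃+ C) := by
  have h : A₀ = f.ker := by ext a; exact (hk a).symm
  subst h
  exact ⟨QuotientAddGroup.quotientKerEquivOfSurjective f hf⟩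

/-- The relations are generated by `(0, n)`. -/
theorem latticeH2_shearTorus {n : ℕ} {y x : ℝ} (hy : 0 < y) (hx : 0 < x)
    (h : IsPresentation P (shearTorusGroup n y x) q) : Nonempty (LatticeH2 P ≃+ ℤ × ZMod n) := by
  have hp : ShiftPair (affHomeo 0 1 x 0) (affHomeo n 1 0 y) (upperTwist 0 1) (upperTwist n 1) _ :=
    ShiftPair.of_commute (i := fun p => ⌊p 1 / y⌋) (j := fun p => ⌊p 0 / x⌋)
      (fun p => by ext i; fin_cases i <;> simp [affHomeo_apply]; ring)
      (fun p => by simp [upperTwist_apply])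
      (fun p => by rw [← floor_div_add _ hy.ne']; simp [affHomeo_apply])
      (fun p => by simp [affHomeo_apply])
      (fun p => by rw [← floor_div_add _ hx.ne']; simp [affHomeo_apply])
  obtain ⟨e⟩ := h.isLatticeCover.nonempty_latticeH2_equiv (isTwist_affHomeo 0 1 x 0)
    (isTwist_affHomeo n 1 0 y) hp (by rw [Set.pair_comm]; exact h.fibers)
  obtain ⟨e'⟩ := nonempty_quotient_equiv_of_surjective (A₀ := relations (upperTwist 0 1)
      ((upperTwist n 1).toAddMonoidHom - AddMonoidHom.id (ℤ × ℤ)))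
    ((AddMonoidHom.id ℤ).prodMap (Int.castAddHom (ZMod n)))
    (Function.surjective_id.prodMap (ZMod.intCast_surjective)) (fun a => by
      rw [mem_relations]
      have h1 : ((AddMonoidHom.id ℤ).prodMap (Int.castAddHom (ZMod n))) a =
          (a.1, (a.2 : ZMod n)) := rfl
      rw [h1, Prod.mk_eq_zero, ZMod.intCast_zmod_eq_zero_iff_dvd]
      constructor
      · rintro ⟨h2, c, hc⟩
        refine ⟨0, (-c, 0), ?_⟩
        change (upperTwist 0 1 0 - 0) + (upperTwist n 1 (-c, 0) - (-c, 0)) = a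
        ext
        · simp [upperTwist_apply, h2]
        · simp [upperTwist_apply, hc]
      · rintro ⟨ν, μ, rfl⟩
        change (upperTwist 0 1 ν - ν + (upperTwist n 1 μ - μ)).1 = 0 ∧
          (n : ℤ) ∣ (upperTwist 0 1 ν - ν + (upperTwist n 1 μ - μ)).2
        refine ⟨by simp [upperTwist_apply], -μ.1, ?_⟩
        simp [upperTwist_apply])
  exact ⟨e.trans e'⟩

/-- The relations for the Klein bottle of the series `𝕂²_{m,y;δ,x}` are generated by `(0, m)` and
`(2, δ)`. Here the orientation preserving generator plays the role of `s`; the quadratic term in the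
height function of the other one compensates the shear. -/
theorem latticeH2_klein {m δ : ℕ} {y x : ℝ} (hy : 0 < y) (hx : 0 < x)
    (h : IsPresentation P (kleinGroup m y δ x) q) {C : Type*} [AddCommGroup C] (f : ℤ × ℤ →+ C)
    (hf : Function.Surjective f)
    (hk : ∀ a, f a = 0 ↔ ∃ c d : ℤ, a = (2 * d, c * m + d * δ)) :
    Nonempty (LatticeH2 P ≃+ C) := by
  have hp : ShiftPair (affHomeo m 1 (((m : ℝ) - δ) / 2 * y) y) (affHomeo δ (-1) x 0)
      (upperTwist m 1) (upperTwist δ (-1)) _ :=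
    ShiftPair.of_inv (i := fun p => ⌊(p 0 - m / (2 * y) * p 1 ^ 2 + δ / 2 * p 1) / x⌋)
      (j := fun p => ⌊p 1 / y⌋)
      (fun p => by ext i; fin_cases i <;> simp [affHomeo_apply]; ring)
      (fun p => by simp [upperTwist_apply]; ring)
      (fun p => by
        rw [← floor_div_add _ hx.ne']; congr 2; simp [affHomeo_apply]; ring)
      (fun p => by
        congr 2; simp [affHomeo_apply]; field_simp; ring)
      (fun p => by rw [← floor_div_add _ hy.ne']; simp [affHomeo_apply])
  obtain ⟨e⟩ := h.isLatticeCover.nonempty_latticeH2_equiv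
    (isTwist_affHomeo m 1 (((m : ℝ) - δ) / 2 * y) y)
    (isTwist_affHomeo δ (-1) x 0) hp (by rw [Set.pair_comm]; exact h.fibers)
  obtain ⟨e'⟩ := nonempty_quotient_equiv_of_surjective (A₀ := relations (upperTwist m 1)
    (-((upperTwist m 1).toAddMonoidHom.comp (upperTwist δ (-1)).toAddMonoidHom +
      AddMonoidHom.id (ℤ × ℤ)))) f hf (fun a => by
      rw [mem_relations, hk]
      constructor
      · rintro ⟨c, d, rfl⟩
        refine ⟨(-c - d, 0), (-d, 0), ?_⟩
        change (upperTwist m 1 (-c - d, 0) - (-c - d, 0)) +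
          -(upperTwist m 1 (upperTwist δ (-1) (-d, 0)) + (-d, 0)) = _
        ext <;> simp [upperTwist_apply] <;> ring
      · rintro ⟨ν, μ, rfl⟩
        refine ⟨-ν.1 + μ.1, -μ.1, ?_⟩
        change (upperTwist m 1 ν - ν) + -(upperTwist m 1 (upperTwist δ (-1) μ) + μ) = _
        ext <;> simp [upperTwist_apply] <;> ring)
  exact ⟨e.trans e'⟩

theorem latticeH2_klein_zero {m : ℕ} {y x : ℝ} (hy : 0 < y) (hx : 0 < x)
    (h : IsPresentation P (kleinGroup m y 0 x) q) : Nonempty (LatticeH2 P ≃+ ZMod 2 × ZMod m) := by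
  refine latticeH2_klein hy hx h ((Int.castAddHom (ZMod 2)).prodMap (Int.castAddHom (ZMod m)))
    (ZMod.intCast_surjective.prodMap ZMod.intCast_surjective) fun a => ?_
  have h1 : ((Int.castAddHom (ZMod 2)).prodMap (Int.castAddHom (ZMod m))) a =
    ((a.1 : ZMod 2), (a.2 : ZMod m)) := rfl
  rw [h1, Prod.mk_eq_zero, ZMod.intCast_zmod_eq_zero_iff_dvd, ZMod.intCast_zmod_eq_zero_iff_dvd]
  constructor
  · rintro ⟨⟨d, hd⟩, c, hc⟩
    exact ⟨c, d, Prod.ext hd (by simp [hc, mul_comm])⟩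
  · rintro ⟨c, d, rfl⟩
    exact ⟨⟨d, rfl⟩, ⟨c, by simp [mul_comm]⟩⟩

/-- The homomorphism `(a, b) ↦ a - 2 b` has the kernel generated by `(2, 1)`, and takes `(0, 2 m)`
to `-4 m`. -/
theorem latticeH2_klein_one {m : ℕ} {y x : ℝ} (hy : 0 < y) (hx : 0 < x)
    (h : IsPresentation P (kleinGroup (2 * m) y 1 x) q) :
    Nonempty (LatticeH2 P ≃+ ZMod (4 * m)) := by
  let f : ℤ × ℤ →+ ℤ := AddMonoidHom.fst ℤ ℤ - 2 • AddMonoidHom.snd ℤ ℤ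
  have hf : ∀ a, f a = a.1 - 2 * a.2 := fun a => by
    change a.1 - 2 • a.2 = _
    simp
  refine latticeH2_klein hy hx h ((Int.castAddHom (ZMod (4 * m))).comp f) ?_ fun a => ?_
  · refine ZMod.intCast_surjective.comp fun c => ⟨(c, 0), by simp [hf]⟩
  have h1 : ((Int.castAddHom (ZMod (4 * m))).comp f) a = (f a : ZMod (4 * m)) := rfl
  rw [h1, ZMod.intCast_zmod_eq_zero_iff_dvd, hf]
  constructor
  · rintro ⟨c, hc⟩
    push_cast at hc
    refine ⟨-c, a.2 + 2 * m * c, Prod.ext ?_ ?_⟩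
    · simp only; linear_combination hc
    · push_cast; ring
  · rintro ⟨c, d, rfl⟩
    refine ⟨-c, ?_⟩
    push_cast; ring

end Series

/-! ### Changes of coordinates -/

section Conjugation

variable {B : Type*} [TopologicalSpace B] [ChartedSpace Plane B]

/-- An element of `smoothPerms` as a diffeomorphism. -/
def smoothDiffeo {Ψ : Equiv.Perm Plane} (hΨ : Ψ ∈ smoothPerms) :
    Diffeomorph 𝓘(ℝ, Plane) 𝓘(ℝ, Plane) Plane Plane ∞ where
  toEquiv := Ψ
  contMDiff_toFun := hΨ.1.contMDiff
  contMDiff_invFun := hΨ.2.contMDiff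

/-- A change of the coordinates of the plane conjugates the group. -/
theorem IsQuotientBy.comp_perm {G G' : Subgroup (Equiv.Perm Plane)} {q : Plane → B}
    (hq : IsQuotientBy G q) {Ψ : Equiv.Perm Plane} (hΨ : Ψ ∈ smoothPerms)
    (hG : G = G'.map (MulAut.conj Ψ).toMonoidHom) : IsQuotientBy G' (q ∘ Ψ) := by
  subst hG
  refine ⟨hq.isCoveringMap.comp_homeomorph (smoothDiffeo hΨ).toHomeomorph,
    hq.surjective.comp Ψ.surjective, fun z => ?_, fun z z' => ?_⟩
  · exact IsLocalDiffeomorphAt.comp (K := 𝓘(ℝ, Plane)) (P := B)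
      ((smoothDiffeo hΨ).isLocalDiffeomorph z) (hq.isLocalDiffeomorph (Ψ z))
  · rw [Function.comp_apply, Function.comp_apply, hq.fibers]
    constructor
    · rintro ⟨_, ⟨g, hg, rfl⟩, h⟩
      exact ⟨g, hg, Ψ.injective (by simpa using h)⟩
    · rintro ⟨g, hg, rfl⟩
      exact ⟨_, ⟨g, hg, rfl⟩, by simp⟩

theorem conj_eq_of_comp {Ψ a a' : Equiv.Perm Plane} (h : ∀ z, Ψ (a' z) = a (Ψ z)) :
    (MulAut.conj Ψ).toMonoidHom a' = a := by
  ext1 z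
  obtain ⟨z, rfl⟩ := Ψ.surjective z
  simp [h]

theorem IsQuotientBy.comp_perm_pair {a b a' b' : Equiv.Perm Plane} {q : Plane → B}
    (hq : IsQuotientBy (Subgroup.closure {a, b}) q) {Ψ : Equiv.Perm Plane} (hΨ : Ψ ∈ smoothPerms)
    (ha : ∀ z, Ψ (a' z) = a (Ψ z)) (hb : ∀ z, Ψ (b' z) = b (Ψ z)) :
    IsQuotientBy (Subgroup.closure {a', b'}) (q ∘ Ψ) := by
  refine hq.comp_perm hΨ ?_
  rw [MonoidHom.map_closure, Set.image_pair, conj_eq_of_comp ha, conj_eq_of_comp hb]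

/-- The map `(s, t) ↦ (x s + α t² + β t, y t)`. -/
def shearPerm (x y : ℝ) (hx : x ≠ 0) (hy : y ≠ 0) (α β : ℝ) : Equiv.Perm Plane where
  toFun z := !₂[x * z 0 + (α * z 1 ^ 2 + β * z 1), y * z 1]
  invFun z := !₂[x⁻¹ * (z 0 - (α * (y⁻¹ * z 1) ^ 2 + β * (y⁻¹ * z 1))), y⁻¹ * z 1]
  left_inv z := by ext i; fin_cases i <;> simp [hx, hy]
  right_inv z := by ext i; fin_cases i <;> simp [hx, hy]

theorem shearPerm_apply {x y : ℝ} (hx : x ≠ 0) (hy : y ≠ 0) (α β : ℝ) (z : Plane) :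
    shearPerm x y hx hy α β z = !₂[x * z 0 + (α * z 1 ^ 2 + β * z 1), y * z 1] := rfl

theorem shearPerm_mem {x y : ℝ} (hx : x ≠ 0) (hy : y ≠ 0) (α β : ℝ) :
    shearPerm x y hx hy α β ∈ smoothPerms := by
  have h0 := contDiff_coord 0
  have h1 := contDiff_coord 1
  refine ⟨contDiff_mk ((contDiff_const.mul h0).add ((contDiff_const.mul (h1.pow 2)).add
    (contDiff_const.mul h1))) (contDiff_const.mul h1), ?_⟩
  have h2 : ContDiff ℝ ∞ (fun z : Plane => y⁻¹ * z 1) := contDiff_const.mul h1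
  exact contDiff_mk (contDiff_const.mul (h0.sub ((contDiff_const.mul (h2.pow 2)).add
    (contDiff_const.mul h2)))) h2

/-- The linear map of the plane that takes the standard basis to `(u, v)` and `(w, z)`. -/
def linPerm (u v w z : ℝ) (h : u * z - v * w ≠ 0) : Equiv.Perm Plane where
  toFun p := !₂[u * p 0 + w * p 1, v * p 0 + z * p 1]
  invFun p := !₂[(z * p 0 - w * p 1) / (u * z - v * w), (u * p 1 - v * p 0) / (u * z - v * w)]
  left_inv p := by
    ext i; fin_cases i <;> simp <;> rw [div_eq_iff h] <;> ring
  right_inv p := by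
    obtain ⟨D, hD⟩ : ∃ D, D = u * z - v * w := ⟨_, rfl⟩
    rw [← hD] at h ⊢
    ext i; fin_cases i <;> simp <;> field_simp <;> rw [hD] <;> ring

theorem linPerm_apply {u v w z : ℝ} (h : u * z - v * w ≠ 0) (p : Plane) :
    linPerm u v w z h p = !₂[u * p 0 + w * p 1, v * p 0 + z * p 1] := rfl

theorem linPerm_mem {u v w z : ℝ} (h : u * z - v * w ≠ 0) : linPerm u v w z h ∈ smoothPerms := by
  have h0 := contDiff_coord 0
  have h1 := contDiff_coord 1
  exact ⟨contDiff_mk ((contDiff_const.mul h0).add (contDiff_const.mul h1))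
    ((contDiff_const.mul h0).add (contDiff_const.mul h1)),
    contDiff_mk (((contDiff_const.mul h0).sub (contDiff_const.mul h1)).div_const _)
    (((contDiff_const.mul h1).sub (contDiff_const.mul h0)).div_const _)⟩

/-- In the coordinates of the basis `(u, v)`, `(w, z)` the group is standard. -/
theorem IsQuotientBy.torus {u v w z : ℝ} (h : u * z - v * w ≠ 0) {q : Plane → B}
    (hq : IsQuotientBy (torusGroup u v w z) q) :
    IsQuotientBy stdTorusGroup (q ∘ linPerm u v w z h) := by
  refine hq.comp_perm_pair (linPerm_mem h) (fun p => ?_) fun p => ?_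
  all_goals
    ext i; fin_cases i <;> simp [linPerm_apply, upperAff_apply] <;> ring

/-- The quadratic shear turns the generator with linear part `(1 n; 0 1)` into a translation. -/
theorem IsQuotientBy.shearTorus {n : ℕ} {y x : ℝ} (hy : y ≠ 0) (hx : x ≠ 0) {q : Plane → B}
    (hq : IsQuotientBy (shearTorusGroup n y x) q) :
    IsQuotientBy stdTorusGroup (q ∘ shearPerm x y hx hy (n * y / 2) (-(n * y / 2))) := by
  rw [shearTorusGroup, Set.pair_comm] at hq
  refine hq.comp_perm_pair (shearPerm_mem hx hy _ _) (fun p => ?_) fun p => ?_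
  all_goals
    ext i; fin_cases i <;> simp [shearPerm_apply, upperAff_apply] <;> ring

/-- The quadratic shear turns the generator with linear part `(1 m; 0 1)` into a translation; its
linear term removes the shear `δ` of the other generator. -/
theorem IsQuotientBy.klein {m δ : ℕ} {y x : ℝ} (hy : y ≠ 0) (hx : x ≠ 0) {q : Plane → B}
    (hq : IsQuotientBy (kleinGroup m y δ x) q) :
    IsQuotientBy stdKleinGroup (q ∘ shearPerm x y hx hy (m * y / 2) (-(δ * y / 2))) := by
  refine hq.comp_perm_pair (shearPerm_mem hx hy _ _) (fun p => ?_) fun p => ?_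
  all_goals
    ext i; fin_cases i <;> simp [shearPerm_apply, upperAff_apply] <;> ring

end Conjugation

/-! ### De Rham cohomology of the torus -/

section TorusDeRham

variable {B : Type*} [TopologicalSpace B] [ChartedSpace Plane B]

theorem oneForm_mem_formStabilizer_iff {c d : ℝ} {P Q : Plane → ℝ} :
    upperAff 0 1 c d ∈ formStabilizer (oneForm P Q) ↔
      (∀ z, P (upperAff 0 1 c d z) = P z) ∧ ∀ z, Q (upperAff 0 1 c d z) = Q z := by
  constructor
  · intro h
    have h1 : ∀ z, (oneForm P Q (upperAff 0 1 c d z)).compContinuousLinearMap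
      (fderiv ℝ (upperAff 0 1 c d) z) = oneForm P Q z := h.2
    simp only [fderiv_upperAff] at h1
    constructor <;> intro z
    · have h2 := congrArg (fun f => f fun _ => EuclideanSpace.single 0 1) (h1 z)
      simpa [oneForm_apply, upperLin_apply] using h2
    · have h2 := congrArg (fun f => f fun _ => EuclideanSpace.single 1 1) (h1 z)
      simpa [oneForm_apply, upperLin_apply] using h2
  · rintro ⟨hP, hQ⟩
    exact upperAff_mem_formStabilizer_oneForm hP (by simpa using hQ)

/-- The integral over the unit square of the differential of a `1`-form. -/
theorem squareIntegral_eq_of_extDeriv {P Q h : Plane → ℝ} (hP : ContDiff ℝ ∞ P)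
    (hQ : ContDiff ℝ ∞ Q) (hd : ∀ z, extDeriv (oneForm P Q) z = twoForm h z) :
    squareIntegral h = (∫ y in (0 : ℝ)..1, (Q !₂[1, y] - Q !₂[0, y])) -
      ∫ x in (0 : ℝ)..1, (P !₂[x, 1] - P !₂[x, 0]) := by
  rw [← squareIntegral_stokes hP hQ]
  congr 1
  funext z
  have h1 := hd z
  rw [extDeriv_oneForm hP hQ] at h1
  have h2 := congrArg (fun f => f ![EuclideanSpace.single 0 1, EuclideanSpace.single 1 1]) h1
  rw [← sub_eq_zero] at h2
  simp [twoForm, areaForm_apply] at h2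
  linarith

theorem coeff_add (q : Plane → B) (η θ : FormField B 2) :
    coeff q (η + θ) = coeff q η + coeff q θ := by
  funext z; simp only [coeff, pullbackForm_add]; rfl

theorem coeff_smul (q : Plane → B) (c : ℝ) (η : FormField B 2) :
    coeff q (c • η) = c • coeff q η := by
  funext z; simp only [coeff, pullbackForm_smul]; rfl

theorem squareIntegral_add {f g : Plane → ℝ} (hf : Continuous f) (hg : Continuous g) :
    squareIntegral (f + g) = squareIntegral f + squareIntegral g := by
  have hi : ∀ {f : Plane → ℝ}, Continuous f →
      Continuous fun y : ℝ => ∫ x in (0 : ℝ)..1, f !₂[x, y] := fun {f} hf =>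
    intervalIntegral.continuous_parametric_intervalIntegral_of_continuous'
        (f := fun y x => f !₂[x, y])
      (hf.comp (contDiff_mk (n := 0) contDiff_snd contDiff_fst).continuous) 0 1
  rw [squareIntegral, squareIntegral, squareIntegral, ← intervalIntegral.integral_add
    ((hi hf).intervalIntegrable _ _) ((hi hg).intervalIntegrable _ _)]
  refine intervalIntegral.integral_congr fun y _ => ?_
  exact intervalIntegral.integral_add ((continuous_lineX hf y).intervalIntegrable _ _)
    ((continuous_lineX hg y).intervalIntegrable _ _)

theorem squareIntegral_smul (c : ℝ) (f : Plane → ℝ) :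
    squareIntegral (c • f) = c * squareIntegral f := by
  simp [squareIntegral]

theorem squareIntegral_const (c : ℝ) : squareIntegral (fun _ => c) = c := by simp [squareIntegral]

variable [IsManifold 𝓘(ℝ, Plane) ∞ B] {q : Plane → B}

/-- Stokes' theorem on the torus. -/
theorem squareIntegral_eq_zero_of_exact (hq : IsQuotientBy stdTorusGroup q) {η : FormField B 2}
    (hη : η ∈ exactTwoForms B) : squareIntegral (coeff q η) = 0 := by
  obtain ⟨-, α, hα, hd⟩ := hη
  have hs : ∀ z, ContDiffAt ℝ ∞ (pullbackForm q (toForm α)) z := fun z =>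
    SmoothOn.contDiffAt_pullback hq.isLocalDiffeomorph hα isOpen_univ (mem_univ _)
  have he := eq_oneForm (pullbackForm q (toForm α))
  set P := fun z => pullbackForm q (toForm α) z fun _ => EuclideanSpace.single 0 1 with hPdef
  set Q := fun z => pullbackForm q (toForm α) z fun _ => EuclideanSpace.single 1 1 with hQdef
  have hP : ContDiff ℝ ∞ P := contDiff_iff_contDiffAt.2 fun z => contDiffAt_alternating_apply
      (hs z) _
  have hQ : ContDiff ℝ ∞ Q := contDiff_iff_contDiffAt.2 fun z => contDiffAt_alternating_apply
      (hs z) _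
  have hst := hq.le_formStabilizer stdTorusGroup_le (toForm α)
  rw [he] at hst
  have h1 := (oneForm_mem_formStabilizer_iff.1 (hst (Subgroup.subset_closure (Or.inl rfl)))).2
  have h2 := (oneForm_mem_formStabilizer_iff.1 (hst (Subgroup.subset_closure (Or.inr rfl)))).1
  have h3 : ∀ y, Q !₂[1, y] - Q !₂[0, y] = 0 := fun y => by
    have := h1 !₂[0, y]
    rw [sub_eq_zero, ← this]
    simp [upperAff_apply]
  have h4 : ∀ x, P !₂[x, 1] - P !₂[x, 0] = 0 := fun y => by
    have := h2 !₂[y, 0]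
    rw [sub_eq_zero, ← this]
    simp [upperAff_apply]
  rw [squareIntegral_eq_of_extDeriv hP hQ fun z => ?_]
  · simp only [h3, h4, intervalIntegral.integral_zero, sub_zero]
  · rw [← he, ← pullbackForm_eq_twoForm]
    exact hd.extDeriv_pullback hq.isLocalDiffeomorph isOpen_univ hα (mem_univ _)

/-- An invariant multiple of the area form descends to a closed form. -/
theorem IsQuotientBy.exists_coeff_eq_const {G : Subgroup (Equiv.Perm Plane)}
    (hq : IsQuotientBy G q) {c : ℝ} (hG : G ≤ formStabilizer (twoForm fun _ => c)) :
    ∃ η ∈ closedTwoForms B, coeff q η = fun _ => c := by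
  obtain ⟨η, hη⟩ := hq.exists_pullbackForm_eq hG
  refine ⟨η, ⟨smoothOn_of_pullback hq.isLocalDiffeomorph fun y _ => ?_, isDiffOn_twoForm _ _⟩, ?_⟩
  · obtain ⟨z, rfl⟩ := hq.surjective y
    refine ⟨z, rfl, ?_⟩
    rw [hη]
    exact (contDiff_twoForm contDiff_const).contDiffAt
  · funext z
    rw [coeff, hη]
    simp [twoForm_apply]

theorem torus_le_formStabilizer_const {S : Set (Equiv.Perm Plane)}
    (hS : ∀ g ∈ S, ∃ k a b, g = upperAff k 1 a b) (c : ℝ) :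
    Subgroup.closure S ≤ formStabilizer (twoForm fun _ => c) := by
  refine (Subgroup.closure_le _).2 fun g hg => ?_
  obtain ⟨k, a, b, rfl⟩ := hS g hg
  exact mem_formStabilizer_twoForm_iff.2 fun z => by simp

/-- Integration over the torus is an isomorphism `H²(B, ℝ) ≃ ℝ`. -/
theorem IsQuotientBy.exists_deRhamH2_equiv (hq : IsQuotientBy stdTorusGroup q) :
    ∃ Φ : DeRhamH2 B ≃ₗ[ℝ] ℝ, ∀ η : closedTwoForms B,
      Φ (Submodule.Quotient.mk η) = squareIntegral (coeff q η) := by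
  have hc : ∀ η : closedTwoForms B, Continuous (coeff q η) := fun η =>
    (contDiff_coeff hq.isLocalDiffeomorph η.2.1).continuous
  let φ : closedTwoForms B →ₗ[ℝ] ℝ :=
    { toFun := fun η => squareIntegral (coeff q η)
      map_add' := fun η θ => by
        rw [Submodule.coe_add, coeff_add, squareIntegral_add (hc η) (hc θ)]
      map_smul' := fun c η => by
        rw [Submodule.coe_smul, coeff_smul, squareIntegral_smul]; rfl }
  have hker : (exactTwoForms B).submoduleOf (closedTwoForms B) = LinearMap.ker φ := by
    ext η
    exact ⟨fun h => squareIntegral_eq_zero_of_exact hq h,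
      fun h => exact_of_squareIntegral_eq_zero hq η.2.1 h⟩
  have hsurj : Function.Surjective φ := fun c => by
    obtain ⟨η, hη, h⟩ := hq.exists_coeff_eq_const (torus_le_formStabilizer_const (by
      rintro g (rfl | rfl) <;> exact ⟨_, _, _, rfl⟩) c)
    refine ⟨⟨η, hη⟩, ?_⟩
    change squareIntegral (coeff q η) = c
    rw [h, squareIntegral_const]
  exact ⟨(Submodule.quotEquivOfEq _ _ hker).trans (φ.quotKerEquivOfSurjective hsurj), fun η => rfl⟩

end TorusDeRham

/-! ### Integration over parallelograms -/

section Integration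

/-- The half-open unit square. -/
def unitSquare : Set Plane := {p | p 0 ∈ Ico (0 : ℝ) 1 ∧ p 1 ∈ Ico (0 : ℝ) 1}

theorem parallelogram_eq_image {u v w z : ℝ} (h : u * z - v * w ≠ 0) :
    parallelogram !₂[u, v] !₂[w, z] = linPerm u v w z h '' unitSquare := by
  ext p
  constructor
  · rintro ⟨s, hs, t, ht, rfl⟩
    refine ⟨!₂[s, t], ⟨hs, ht⟩, ?_⟩
    ext i; fin_cases i <;> simp [linPerm_apply] <;> ring
  · rintro ⟨p, ⟨hs, ht⟩, rfl⟩
    refine ⟨p 0, hs, p 1, ht, ?_⟩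
    ext i; fin_cases i <;> simp [linPerm_apply] <;> ring

theorem measurableSet_unitSquare : MeasurableSet unitSquare := by
  have h : ∀ i : Fin 2, Measurable fun p : Plane => p i :=
      fun i => (contDiff_coord i).continuous.measurable
  exact (h 0 measurableSet_Ico).inter (h 1 measurableSet_Ico)

theorem setIntegral_unitSquare {f : Plane → ℝ} (hf : Continuous f) :
    ∫ p in unitSquare, f p = squareIntegral f := by
  have h1 := EuclideanSpace.volume_preserving_symm_measurableEquiv_toLp (Fin 2)
  have h2 := MeasureTheory.volume_preserving_finTwoArrow ℝ
  have h3 := (h2.comp h1).symm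
    ((MeasurableEquiv.toLp 2 (Fin 2 → ℝ)).symm.trans MeasurableEquiv.finTwoArrow)
  have h4 : ∀ p : ℝ × ℝ, ((MeasurableEquiv.toLp 2 (Fin 2 → ℝ)).symm.trans
      MeasurableEquiv.finTwoArrow).symm p = !₂[p.1, p.2] := fun p => rfl
  have h5 := h3.setIntegral_preimage_emb (MeasurableEquiv.measurableEmbedding _) f unitSquare
  have hpre : ((MeasurableEquiv.toLp 2 (Fin 2 → ℝ)).symm.trans
      MeasurableEquiv.finTwoArrow).symm ⁻¹' unitSquare = Ico (0 : ℝ) 1 ×ˢ Ico (0 : ℝ) 1 := by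
    ext p
    simp [unitSquare, mem_prod]
  rw [← h5, hpre]
  simp only [h4]
  have hc : Continuous fun p : ℝ × ℝ => f !₂[p.1, p.2] :=
    hf.comp (contDiff_mk (n := 0) contDiff_fst contDiff_snd).continuous
  rw [squareIntegral_comm hf, Measure.volume_eq_prod, setIntegral_prod]
  · rw [intervalIntegral.integral_of_le zero_le_one, integral_Ico_eq_integral_Ioc]
    refine integral_congr_ae (Eventually.of_forall fun x => ?_)
    simp only
    rw [intervalIntegral.integral_of_le zero_le_one, integral_Ico_eq_integral_Ioc]
  · exact (hc.continuousOn.integrableOn_compact (isCompact_Icc.prod isCompact_Icc)).mono_set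
      (prod_mono Ico_subset_Icc_self Ico_subset_Icc_self)

/-- Change of variables from the parallelogram to the unit square. -/
theorem setIntegral_parallelogram {u v w z : ℝ} (h : u * z - v * w ≠ 0) {f : Plane → ℝ}
    (hf : Continuous f) : ∫ p in parallelogram !₂[u, v] !₂[w, z], f p =
      |u * z - v * w| * squareIntegral (fun p => f (linPerm u v w z h p)) := by
  let A : Plane →L[ℝ] Plane := LinearMap.toContinuousLinearMap
    (Matrix.toLin (EuclideanSpace.basisFun (Fin 2) ℝ).toBasis
      (EuclideanSpace.basisFun (Fin 2) ℝ).toBasis !![u, w; v, z])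
  have hA : ⇑(linPerm u v w z h) = A := by
    funext p
    change _ = Matrix.toLin (EuclideanSpace.basisFun (Fin 2) ℝ).toBasis
      (EuclideanSpace.basisFun (Fin 2) ℝ).toBasis !![u, w; v, z] p
    rw [← Matrix.toEuclideanLin_eq_toLin_orthonormal]
    ext i; fin_cases i <;> simp [linPerm_apply, Matrix.toLpLin_apply, dotProduct, Fin.sum_univ_two]
  have hdet : A.det = u * z - v * w := by
    change LinearMap.det (Matrix.toLin (EuclideanSpace.basisFun (Fin 2) ℝ).toBasis
      (EuclideanSpace.basisFun (Fin 2) ℝ).toBasis !![u, w; v, z]) = _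
    rw [LinearMap.det_toLin, Matrix.det_fin_two_of]; ring
  have h1 := integral_image_eq_integral_abs_det_fderiv_smul (μ := volume) (f' := fun _ => A)
    (f := linPerm u v w z h) measurableSet_unitSquare
    (fun p _ => by rw [hA]; exact A.hasFDerivWithinAt) (linPerm u v w z h).injective.injOn f
  rw [parallelogram_eq_image h, h1, hdet]
  simp only [smul_eq_mul]
  rw [integral_const_mul, setIntegral_unitSquare (f := fun p => f (linPerm u v w z h p))
    (hf.comp (linPerm_mem h).1.continuous)]

variable {B : Type*} [TopologicalSpace B] [ChartedSpace Plane B]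

theorem integralOver_eq (q : Plane → B) (D : Set Plane) (η : FormField B 2) :
    integralOver q D η = ∫ p in D, coeff q η p := rfl

theorem coeff_comp {q : Plane → B} (hq : IsLocalDiffeomorph 𝓘(ℝ, Plane) 𝓘(ℝ, Plane) ∞ q)
    {Ψ : Plane → Plane} (hΨ : ContDiff ℝ ∞ Ψ) (η : FormField B 2) (p : Plane) :
    coeff (q ∘ Ψ) η p = coeff q η (Ψ p) *
      (fderiv ℝ Ψ p (EuclideanSpace.single 0 1) 0 * fderiv ℝ Ψ p (EuclideanSpace.single 1 1) 1 -
      fderiv ℝ Ψ p (EuclideanSpace.single 1 1) 0 * fderiv ℝ Ψ p (EuclideanSpace.single 0 1) 1) := by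
  rw [coeff, pullbackForm_comp η (hq.mdifferentiable (by simp) _) (hΨ.differentiable (by simp) _),
    pullbackForm_eq_twoForm, ContinuousAlternatingMap.compContinuousLinearMap_apply, twoForm_apply]
  rfl

theorem hasFDerivAt_coord (i : Fin 2) (p : Plane) :
    HasFDerivAt (fun p : Plane => p i) (EuclideanSpace.proj (𝕜 := ℝ) i) p :=
  (EuclideanSpace.proj (𝕜 := ℝ) i).hasFDerivAt

theorem fderiv_apply_coord {Ψ : Plane → Plane} (hΨ : ContDiff ℝ ∞ Ψ) (p v : Plane) (i : Fin 2) :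
    fderiv ℝ Ψ p v i = fderiv ℝ (fun p => Ψ p i) p v := by
  have h := (hasFDerivAt_coord i (Ψ p)).comp p (hΨ.differentiable (by simp) p).hasFDerivAt
  rw [show (fun p => Ψ p i) = (fun p : Plane => p i) ∘ Ψ from rfl, h.fderiv]
  rfl

theorem fderiv_linPerm {u v w z : ℝ} (h : u * z - v * w ≠ 0) (p a : Plane) :
    fderiv ℝ (linPerm u v w z h) p a = linPerm u v w z h a := by
  ext i
  rw [fderiv_apply_coord (linPerm_mem h).1]
  have h0 := hasFDerivAt_coord 0 p
  have h1 := hasFDerivAt_coord 1 p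
  fin_cases i
  · exact congrArg (fun L : Plane →L[ℝ] ℝ => L a) ((h0.const_mul u).add (h1.const_mul w)).fderiv
  · exact congrArg (fun L : Plane →L[ℝ] ℝ => L a) ((h0.const_mul v).add (h1.const_mul z)).fderiv

theorem fderiv_shearPerm {x y : ℝ} (hx : x ≠ 0) (hy : y ≠ 0) (α β : ℝ) (p a : Plane) :
    fderiv ℝ (shearPerm x y hx hy α β) p a =
      !₂[x * a 0 + (2 * α * p 1 + β) * a 1, y * a 1] := by
  ext i
  rw [fderiv_apply_coord (shearPerm_mem hx hy α β).1]
  have h0 := hasFDerivAt_coord 0 p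
  have h1 := hasFDerivAt_coord 1 p
  fin_cases i
  · refine (congrArg (fun L : Plane →L[ℝ] ℝ => L a) ((h0.const_mul x).add
      (((h1.pow 2).const_mul α).add (h1.const_mul β))).fderiv).trans ?_
    simp
    ring
  · exact congrArg (fun L : Plane →L[ℝ] ℝ => L a) (h1.const_mul y).fderiv

variable [IsManifold 𝓘(ℝ, Plane) ∞ B]

/-- Integration over the parallelogram, in the coordinates of the standard torus. The sign is that
of the determinant. -/
theorem integralOver_torus {u v w z : ℝ} (h : u * z - v * w ≠ 0) {q : Plane → B}
    (hq : IsLocalDiffeomorph 𝓘(ℝ, Plane) 𝓘(ℝ, Plane) ∞ q) {η : FormField B 2}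
    (hη : SmoothOn η Set.univ) :
    integralOver q (parallelogram !₂[u, v] !₂[w, z]) η =
      SignType.sign (u * z - v * w) * squareIntegral (coeff (q ∘ linPerm u v w z h) η) := by
  rw [integralOver_eq, setIntegral_parallelogram h (contDiff_coeff hq hη).continuous]
  have h1 : coeff (q ∘ linPerm u v w z h) η =
      (u * z - v * w) • fun p => coeff q η (linPerm u v w z h p) := by
    funext p
    rw [coeff_comp hq (linPerm_mem h).1, fderiv_linPerm, fderiv_linPerm]
    simp [linPerm_apply]; ring
  rw [h1, squareIntegral_smul, ← mul_assoc, sign_mul_self]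

/-- Integration over the rectangle, in the coordinates of the standard torus. The shear `(x s + α
t² + β t, y t)` has Jacobian `x y`, and on each horizontal line it only shifts a full period, which
does not change the integral. -/
theorem integralOver_shearTorus {n : ℕ} {y x : ℝ} (hy : 0 < y) (hx : 0 < x) {q : Plane → B}
    (hq : IsQuotientBy (shearTorusGroup n y x) q) {η : FormField B 2}
    (hη : SmoothOn η Set.univ) (α β : ℝ) :
    integralOver q (parallelogram !₂[x, 0] !₂[0, y]) η =
      squareIntegral (coeff (q ∘ shearPerm x y hx.ne' hy.ne' α β) η) := by
  have hdet : x * y - 0 * 0 ≠ 0 := by simp [hx.ne', hy.ne']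
  have hc := (contDiff_coeff hq.isLocalDiffeomorph hη).continuous
  rw [integralOver_eq, setIntegral_parallelogram hdet hc, ← squareIntegral_smul]
  have hG : shearTorusGroup n y x ≤ smoothPerms := closure_le_smoothPerms (by
    rintro g (rfl | rfl) <;> exact ⟨_, _, _, _, rfl⟩)
  have hper : ∀ X Y, coeff q η !₂[X + x, Y] = coeff q η !₂[X, Y] := fun X Y => by
    have := hq.coeff_upperAff hG η (Subgroup.subset_closure (Or.inr rfl)) !₂[X, Y]
    simpa [upperAff_apply] using this
  refine intervalIntegral.integral_congr fun t _ => ?_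
  have h1 : ∀ s, coeff (q ∘ shearPerm x y hx.ne' hy.ne' α β) η !₂[s, t] =
      x * y * coeff q η !₂[x * s + (α * t ^ 2 + β * t), y * t] := fun s => by
    rw [coeff_comp hq.isLocalDiffeomorph (shearPerm_mem hx.ne' hy.ne' α β).1, fderiv_shearPerm,
        fderiv_shearPerm]
    simp [shearPerm_apply]; ring
  have h2 : ∀ s, ((|x * y - 0 * 0| • fun p => coeff q η
      (linPerm x 0 0 y hdet p)) : Plane → ℝ) !₂[s, t] =
      x * y * coeff q η !₂[x * s, y * t] := fun s => by
    simp [linPerm_apply, abs_of_pos hx, abs_of_pos hy]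
  simp only [h1, h2]
  rw [intervalIntegral.integral_const_mul, intervalIntegral.integral_const_mul]
  congr 1
  have hp : Function.Periodic (fun s => coeff q η !₂[x * s, y * t]) 1 := fun s => by
    simp only [mul_add, mul_one]; exact hper _ _
  have h3 := hp.intervalIntegral_add_eq ((α * t ^ 2 + β * t) / x) 0
  rw [zero_add] at h3
  rw [← h3]
  have h4 := intervalIntegral.integral_comp_add_right (a := 0) (b := 1)
    (fun s => coeff q η !₂[x * s, y * t]) ((α * t ^ 2 + β * t) / x)
  rw [zero_add, add_comm 1 _] at h4
  rw [← h4]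
  refine intervalIntegral.integral_congr fun s _ => ?_
  rw [mul_add, mul_div_cancel₀ _ hx.ne']

end Integration

/-! ### Latticed forms as quasi-periodic forms on the plane -/

section Latticed

/-- The covector `a dX + b dY`. -/
def realCovec (a b : ℝ) : Plane →L[ℝ] ℝ :=
  a • EuclideanSpace.proj (0 : Fin 2) + b • EuclideanSpace.proj (1 : Fin 2)

theorem realCovec_apply (a b : ℝ) (v : Plane) : realCovec a b v = a * v 0 + b * v 1 := rfl

theorem oneForm_eq (P Q : Plane → ℝ) (z : Plane) : oneForm P Q z =
    ContinuousAlternatingMap.ofSubsingleton ℝ Plane ℝ (0 : Fin 1) (realCovec (P z) (Q z)) := rfl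

theorem mem_stdLattice_iff {ℓ : Plane →L[ℝ] ℝ} :
    ℓ ∈ stdLattice ↔ ∃ m n : ℤ, ℓ !₂[1, 0] = m ∧ ℓ !₂[0, 1] = n := by
  rw [mem_stdLattice]
  constructor
  · rintro ⟨p, rfl⟩
    exact ⟨p.1, p.2, by simp [covec_apply], by simp [covec_apply]⟩
  · rintro ⟨m, n, h0, h1⟩
    refine ⟨(m, n), ContinuousLinearMap.ext fun v => ?_⟩
    have hv : v = v 0 • !₂[1, 0] + v 1 • !₂[0, 1] := by ext i; fin_cases i <;> simp
    rw [covec_apply]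
    conv_rhs => rw [hv, map_add, map_smul, map_smul, h0, h1]
    simp [mul_comm]

variable {B : Type*} [TopologicalSpace B] [ChartedSpace Plane B] {P : CotangentLattice B}
  {q : C(Plane, B)}

/-- Transport of a representative along an equality of points. The cotangent spaces at all points
are the same type by definition, and the underlying covector does not change. -/
theorem exists_transport_class {s : ∀ x : B, Cotangent x ⧸ P.fiber x} {x y : B} (h : x = y)
    (α : Cotangent x) (hα : QuotientAddGroup.mk α = s x) :
    ∃ β : Cotangent y, QuotientAddGroup.mk β = s y ∧ (β : Plane →L[ℝ] ℝ) = α := by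
  subst h; exact ⟨α, hα, rfl⟩

/-- Transport of an element of the lattice along an equality of points. -/
theorem exists_transport_fiber {x y : B} (h : x = y) (α : Cotangent x) (hα : α ∈ P.fiber x) :
    ∃ β : Cotangent y, β ∈ P.fiber y ∧ (β : Plane →L[ℝ] ℝ) = α := by
  subst h; exact ⟨α, hα, rfl⟩

theorem IsLatticeCover.pullCovector_comp (hq : IsLatticeCover P q) {g : Equiv.Perm Plane}
    (hg : g ∈ smoothPerms) (hqg : ∀ z, q (g z) = q z) {z : Plane} {α : Cotangent (q (g z))}
    {β : Cotangent (q z)} (h : (β : Plane →L[ℝ] ℝ) = α) :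
    (pullCovector q (g z) α).comp (fderiv ℝ g z) = pullCovector q z β := by
  refine ContinuousLinearMap.ext fun v => ?_
  change (α : Plane →L[ℝ] ℝ) (hq.diff (g z) (fderiv ℝ g z v)) = (β : Plane →L[ℝ] ℝ) (hq.diff z v)
  rw [hq.diff_comp hg hqg, h]
  rfl

/-- Deck transformations preserve the standard lattice. -/
theorem IsLatticeCover.comp_fderiv_mem (hq : IsLatticeCover P q) {g : Equiv.Perm Plane}
    (hg : g ∈ smoothPerms) (hqg : ∀ z, q (g z) = q z) {z : Plane} {ℓ : Plane →L[ℝ] ℝ}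
    (hℓ : ℓ ∈ stdLattice) : ℓ.comp (fderiv ℝ g z) ∈ stdLattice := by
  have h1 := hℓ
  rw [hq.lattice (g z)] at h1
  obtain ⟨α, hα, rfl⟩ := h1
  obtain ⟨β, hβ, h⟩ := exists_transport_fiber (hqg z) α hα
  have h2 := hq.pullCovector_comp hg hqg h
  have h3 := (hq.mem_fiber_iff z β).1 hβ
  rw [← h2] at h3
  exact h3

theorem pullCovector_sub_mem (hq : IsLatticeCover P q) {s : ∀ x : B, Cotangent x ⧸ P.fiber x}
    {z : Plane} {α β : Cotangent (q z)} (hα : QuotientAddGroup.mk α = s (q z))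
    (hβ : QuotientAddGroup.mk β = s (q z)) :
    pullCovector q z α - pullCovector q z β ∈ stdLattice := by
  rw [← map_sub]
  refine (hq.mem_fiber_iff z _).1 ?_
  have := QuotientAddGroup.eq.1 (hβ.trans hα.symm)
  rwa [neg_add_eq_sub] at this

theorem extDeriv_const_form {k : ℕ} (c : Plane [⋀^Fin k]→L[ℝ] ℝ) (z : Plane) :
    extDeriv (fun _ => c) z = 0 := by
  ext v
  rw [extDeriv_apply (differentiableAt_const c)]
  simp

variable [IsManifold 𝓘(ℝ, Plane) ∞ B]

/-- A latticed `1`-form on `B` is represented by a `1`-form on the plane, which is defined up to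
addition of an integral covector. -/
theorem IsLatticeCover.exists_covector_lift (hq : IsLatticeCover P q)
    {s : ∀ x : B, Cotangent x ⧸ P.fiber x} {η : FormField B 2} (h : HasLatticedDiff P s η) :
    ∃ A₀ A₁ : C(Plane, ℝ), ∀ z, ∀ β : Cotangent (q z), QuotientAddGroup.mk β = s (q z) →
      realCovec (A₀ z) (A₁ z) - pullCovector q z β ∈ stdLattice := by
  choose V hV hxV α hα hαs hd using h
  -- The component of the form along an integral vector `v` is well defined modulo `ℤ`. It is a
  -- continuous map to the circle `ℝ/ℤ`, which lifts to `ℝ` since the plane is simply connected.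
  have key : ∀ v : Plane, (∀ ℓ ∈ stdLattice, ∃ m : ℤ, ℓ v = m) →
      ∃ A : C(Plane, ℝ), ∀ z, ∀ β : Cotangent (q z), QuotientAddGroup.mk β = s (q z) →
        ∃ m : ℤ, A z - pullCovector q z β v = m := by
    intro v hv
    let C : Plane → AddCircle (1 : ℝ) := fun z => (pullCovector q z (α (q z) (q z)) v : ℝ)
    have hC : ∀ (z : Plane) (β : Cotangent (q z)), QuotientAddGroup.mk β = s (q z) →
        C z = ((pullCovector q z β v : ℝ) : AddCircle (1 : ℝ)) := fun z β hβ => by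
      obtain ⟨m, hm⟩ := hv _ (pullCovector_sub_mem hq (hαs (q z) (q z) (hxV _)) hβ)
      rw [← sub_eq_zero, ← AddCircle.coe_sub]
      refine (AddCircle.coe_eq_zero_iff (1 : ℝ)).2 ⟨m, ?_⟩
      rw [zsmul_one, ← hm]; rfl
    have hcont : Continuous C := continuous_iff_continuousAt.2 fun z => by
      have h1 := continuousAt_pullCovector hq.isLocalDiffeomorph (hα (q z)) (hV (q z)) (hxV (q z))
      have h2 : ContinuousAt (fun w => ((pullCovector q w (α (q z) (q w)) v : ℝ) : AddCircle
          (1 : ℝ))) z :=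
        (AddCircle.continuous_mk' (1 : ℝ)).continuousAt.comp
          ((ContinuousLinearMap.apply ℝ ℝ v).continuous.continuousAt.comp h1)
      refine h2.congr ?_
      filter_upwards [q.continuous.continuousAt.eventually
          ((hV (q z)).mem_nhds (hxV (q z)))] with w hw
      exact (hC w _ (hαs (q z) (q w) hw)).symm
    obtain ⟨A, ⟨-, hA⟩, -⟩ := (AddCircle.isCoveringMap_coe (1 : ℝ)).existsUnique_continuousMap_lifts
      ⟨C, hcont⟩ 0 (pullCovector q 0 (α (q 0) (q 0)) v) rfl
    refine ⟨A, fun z β hβ => ?_⟩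
    have h1 : ((A z : ℝ) : AddCircle (1 : ℝ)) = C z := congrFun hA z
    rw [hC z β hβ, ← sub_eq_zero, ← AddCircle.coe_sub, AddCircle.coe_eq_zero_iff] at h1
    obtain ⟨m, hm⟩ := h1
    exact ⟨m, by rw [← hm]; simp⟩
  obtain ⟨A₀, hA₀⟩ := key !₂[1, 0] fun ℓ hℓ => by
    obtain ⟨m, -, h, -⟩ := mem_stdLattice_iff.1 hℓ
    exact ⟨m, h⟩
  obtain ⟨A₁, hA₁⟩ := key !₂[0, 1] fun ℓ hℓ => by
    obtain ⟨-, m, -, h⟩ := mem_stdLattice_iff.1 hℓ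
    exact ⟨m, h⟩
  refine ⟨A₀, A₁, fun z β hβ => mem_stdLattice_iff.2 ?_⟩
  obtain ⟨m, hm⟩ := hA₀ z β hβ
  obtain ⟨n, hn⟩ := hA₁ z β hβ
  refine ⟨m, n, ?_, ?_⟩
  · rw [← hm]; simp [realCovec_apply]
  · rw [← hn]; simp [realCovec_apply]

theorem continuous_realCovec {A₀ A₁ : Plane → ℝ} (h0 : Continuous A₀) (h1 : Continuous A₁) :
    Continuous fun z => realCovec (A₀ z) (A₁ z) :=
  (h0.smul continuous_const).add (h1.smul continuous_const)

/-- The lift of a latticed `1`-form is smooth; its differential is the lift of the differential; and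
under a deck transformation it changes by a constant integral covector. -/
theorem IsLatticeCover.exists_lift_latticed (hq : IsLatticeCover P q)
    {s : ∀ x : B, Cotangent x ⧸ P.fiber x} {η : FormField B 2} (h : HasLatticedDiff P s η) :
    ∃ A₀ A₁ : Plane → ℝ, ContDiff ℝ ∞ A₀ ∧ ContDiff ℝ ∞ A₁ ∧
      (∀ z, extDeriv (oneForm A₀ A₁) z = pullbackForm q η z) ∧
      ∀ g ∈ smoothPerms, (∀ z, q (g z) = q z) → ∃ p, ∀ z,
        (realCovec (A₀ (g z)) (A₁ (g z))).comp (fderiv ℝ g z) =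
            realCovec (A₀ z) (A₁ z) + covec p := by
  obtain ⟨A₀, A₁, hA⟩ := hq.exists_covector_lift h
  have hAc : Continuous fun z => realCovec (A₀ z) (A₁ z) :=
      continuous_realCovec A₀.continuous A₁.continuous
  have hloc : ∀ z, ContDiffAt ℝ ∞ (oneForm A₀ A₁) z ∧
      extDeriv (oneForm A₀ A₁) z = pullbackForm q η z := by
    intro z
    obtain ⟨V, hV, hzV, α, hα, hαs, hd⟩ := h (q z)
    have hVz := q.continuous.continuousAt.eventually (hV.mem_nhds hzV)
    have h1 := continuousAt_pullCovector hq.isLocalDiffeomorph hα hV hzV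
    have h2 := eventually_eq_of_mem_stdLattice (hAc.continuousAt.sub h1) (by
      filter_upwards [hVz] with w hw
      exact hA w _ (hαs _ hw))
    have h3 : oneForm A₀ A₁ =ᶠ[𝓝 z] pullbackForm q (toForm α) + fun _ =>
        ContinuousAlternatingMap.ofSubsingleton ℝ Plane ℝ (0 : Fin 1)
          (realCovec (A₀ z) (A₁ z) - pullCovector q z (α (q z))) := by
      filter_upwards [h2] with w hw
      have hw' : realCovec (A₀ w) (A₁ w) - pullCovector q w (α (q w)) =
        realCovec (A₀ z) (A₁ z) - pullCovector q z (α (q z)) := hw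
      rw [Pi.add_apply, pullbackForm_toForm, oneForm_eq, ← hw']
      ext v
      change realCovec (A₀ w) (A₁ w) (v 0) = pullCovector q w (α (q w)) (v 0) +
        (realCovec (A₀ w) (A₁ w) (v 0) - pullCovector q w (α (q w)) (v 0))
      ring
    have h4 := SmoothOn.contDiffAt_pullback hq.isLocalDiffeomorph hα hV hzV
    refine ⟨(h4.add contDiffAt_const).congr_of_eventuallyEq h3, ?_⟩
    rw [h3.extDeriv_eq, extDeriv_add (h4.differentiableAt (by simp)) (differentiableAt_const _),
      extDeriv_const_form, add_zero]
    exact hd.extDeriv_pullback hq.isLocalDiffeomorph hV hα hzV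
  have hsm : ∀ v : Plane, ContDiff ℝ ∞ fun z => oneForm A₀ A₁ z fun _ => v := fun v =>
    contDiff_iff_contDiffAt.2 fun z => contDiffAt_alternating_apply (hloc z).1 _
  refine ⟨A₀, A₁, ?_, ?_, fun z => (hloc z).2, fun g hg hqg => ?_⟩
  · have := hsm !₂[1, 0]
    simpa [oneForm_apply] using this
  · have := hsm !₂[0, 1]
    simpa [oneForm_apply] using this
  · have hmem : ∀ z, (realCovec (A₀ (g z)) (A₁ (g z))).comp (fderiv ℝ g z) - realCovec (A₀ z)
      (A₁ z) ∈
        stdLattice := fun z => by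
      obtain ⟨α, hα⟩ := QuotientAddGroup.mk_surjective (s (q (g z)))
      obtain ⟨β, hβ, hαβ⟩ := exists_transport_class (hqg z) α hα
      have h1 := hq.comp_fderiv_mem hg hqg (z := z) (hA (g z) α hα)
      have h2 := hA z β hβ
      have h3 := sub_mem h1 h2
      rw [ContinuousLinearMap.sub_comp, hq.pullCovector_comp hg hqg hαβ] at h3
      rwa [sub_sub_sub_cancel_right] at h3
    have hc : Continuous fun z => (realCovec (A₀ (g z)) (A₁ (g z))).comp (fderiv ℝ g z) -
        realCovec (A₀ z) (A₁ z) :=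
      ((hAc.comp hg.1.continuous).clm_comp (hg.1.continuous_fderiv (by simp))).sub hAc
    have hl : IsLocallyConstant fun z => (realCovec (A₀ (g z)) (A₁ (g z))).comp (fderiv ℝ g z) -
        realCovec (A₀ z) (A₁ z) := (IsLocallyConstant.iff_eventually_eq _).2 fun z =>
      eventually_eq_of_mem_stdLattice hc.continuousAt (Eventually.of_forall hmem)
    obtain ⟨p, hp⟩ := mem_stdLattice.1 (hmem 0)
    refine ⟨p, fun z => ?_⟩
    rw [hp, ← hl.apply_eq_of_preconnectedSpace z 0, add_sub_cancel]

/-- The diffeomorphisms of the plane which preserve the standard lattice, and which change the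
field of covectors `A` by integral covectors. -/
def quasiStabilizer (A : Plane → Plane →L[ℝ] ℝ) : Subgroup (Equiv.Perm Plane) where
  carrier := {g | g ∈ smoothPerms ∧
    (∀ z ℓ, ℓ ∈ stdLattice ↔ ℓ.comp (fderiv ℝ g z) ∈ stdLattice) ∧
    ∀ z, (A (g z)).comp (fderiv ℝ g z) - A z ∈ stdLattice}
  mul_mem' := by
    rintro a b ⟨ha, ha', ha''⟩ ⟨hb, hb', hb''⟩
    have h1 : ∀ z, fderiv ℝ (⇑(a * b)) z = (fderiv ℝ a (b z)).comp (fderiv ℝ b z) := fun z =>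
      fderiv_comp z (ha.1.differentiable (by simp) _) (hb.1.differentiable (by simp) _)
    refine ⟨mul_mem ha hb, fun z ℓ => ?_, fun z => ?_⟩
    · rw [h1, ← ContinuousLinearMap.comp_assoc, ← hb', ← ha']
    · have h2 := add_mem ((hb' z _).1 (ha'' (b z))) (hb'' z)
      rw [ContinuousLinearMap.sub_comp, sub_add_sub_cancel] at h2
      rw [h1, ← ContinuousLinearMap.comp_assoc]
      exact h2
  one_mem' := by
    have h1 : ∀ z, fderiv ℝ (⇑(1 : Equiv.Perm Plane)) z = ContinuousLinearMap.id ℝ Plane :=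
      fun z => fderiv_id
    refine ⟨one_mem _, fun z ℓ => by rw [h1, ContinuousLinearMap.comp_id], fun z => ?_⟩
    rw [h1, ContinuousLinearMap.comp_id]
    simp
  inv_mem' := by
    rintro a ⟨ha, ha', ha''⟩
    have h1 : ∀ z, (fderiv ℝ a (a⁻¹ z)).comp (fderiv ℝ (⇑(a⁻¹)) z) =
        ContinuousLinearMap.id ℝ Plane := fun z => by
      have h0 := fderiv_comp (𝕜 := ℝ) (g := ⇑a) (f := ⇑(a⁻¹)) z
        (ha.1.differentiable (by simp) _) (ha.2.differentiable (by simp) _)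
      have : ⇑a ∘ ⇑(a⁻¹) = id := by ext1 w; simp
      rw [← h0, this]; exact fderiv_id
    have h2 : ∀ z, (fderiv ℝ (⇑(a⁻¹)) z).comp (fderiv ℝ a (a⁻¹ z)) =
        ContinuousLinearMap.id ℝ Plane := fun z => by
      have h0 := fderiv_comp (𝕜 := ℝ) (g := ⇑(a⁻¹)) (f := ⇑a) (a⁻¹ z)
        (ha.2.differentiable (by simp) _) (ha.1.differentiable (by simp) _)
      have : ⇑(a⁻¹) ∘ ⇑a = id := by ext1 w; simp
      rw [this, fderiv_id, show a (a⁻¹ z) = z by simp] at h0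
      exact h0.symm
    have h3 : ∀ z ℓ, ℓ ∈ stdLattice ↔ ℓ.comp (fderiv ℝ (⇑(a⁻¹)) z) ∈ stdLattice := fun z ℓ => by
      refine Iff.trans ?_ (ha' (a⁻¹ z) _).symm
      rw [ContinuousLinearMap.comp_assoc, h2, ContinuousLinearMap.comp_id]
    refine ⟨inv_mem ha, h3, fun z => ?_⟩
    have h4 := (h3 z _).1 (ha'' (a⁻¹ z))
    rw [ContinuousLinearMap.sub_comp, ContinuousLinearMap.comp_assoc, h1,
      ContinuousLinearMap.comp_id, show a (a⁻¹ z) = z by simp] at h4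
    have h5 := neg_mem h4
    rwa [neg_sub] at h5

/-- A field of covectors on the plane which is invariant under the deck transformations up to
integral covectors descends to a latticed `1`-form. -/
theorem IsLatticeCover.exists_hasLatticedDiff (hq : IsLatticeCover P q)
    {G : Subgroup (Equiv.Perm Plane)} (hfib : ∀ z z' : Plane, q z = q z' ↔ ∃ g ∈ G, g z = z')
    {A₀ A₁ : Plane → ℝ} (h0 : ContDiff ℝ ∞ A₀) (h1 : ContDiff ℝ ∞ A₁)
    (hG : G ≤ quasiStabilizer fun z => realCovec (A₀ z) (A₁ z)) {η : FormField B 2}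
    (hd : ∀ z, extDeriv (oneForm A₀ A₁) z = pullbackForm q η z) :
    ∃ s, HasLatticedDiff P s η := by
  have hqg : ∀ g ∈ G, ∀ z, q (g z) = q z := fun g hg z => ((hfib z (g z)).2 ⟨g, hg, rfl⟩).symm
  let A : Plane → Plane →L[ℝ] ℝ := fun z => realCovec (A₀ z) (A₁ z)
  let σ : B → Plane := Function.surjInv hq.surjective
  have hmk : ∀ z z', q z' = q z → ∀ x : B, x = q z → (QuotientAddGroup.mk
      (hq.pushCovector z (A z) : Cotangent x) : Cotangent x ⧸ P.fiber x) =
      QuotientAddGroup.mk (hq.pushCovector z' (A z') : Cotangent x) := by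
    rintro z z' h x rfl
    obtain ⟨g, hg, rfl⟩ := (hfib z z').1 h.symm
    refine QuotientAddGroup.eq.2 ((hq.mem_fiber_iff z _).2 ?_)
    have h2 : pullCovector q z (hq.pushCovector (g z) (A (g z))) =
        (A (g z)).comp (fderiv ℝ g z) := by
      refine ContinuousLinearMap.ext fun v => ?_
      change A (g z) ((hq.diff (g z)).symm (hq.diff z v)) = A (g z) (fderiv ℝ g z v)
      rw [← hq.diff_comp (hG hg).1 (hqg g hg), ContinuousLinearEquiv.symm_apply_apply]
    refine (congrArg (· ∈ stdLattice) ?_).mpr ((hG hg).2.2 z)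
    refine (map_add (pullCovector q z) (-(hq.pushCovector z (A z) : Cotangent (q z))) _).trans ?_
    refine (congrArg (· + _) (map_neg (pullCovector q z)
      (hq.pushCovector z (A z) : Cotangent (q z)))).trans ?_
    refine (congrArg₂ (fun a b => -a + b) (hq.pullCovector_pushCovector z (A z)) h2).trans ?_
    rw [neg_add_eq_sub]
  refine ⟨fun y => QuotientAddGroup.mk (hq.pushCovector (σ y) (A (σ y)) : Cotangent y), fun y => ?_⟩
  obtain ⟨z₀, rfl⟩ := hq.surjective y
  obtain ⟨e, he, hqe⟩ := hq.isCoveringMap.isLocalHomeomorph z₀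
  let β : CovectorField B := fun y => hq.pushCovector (e.symm y) (A (e.symm y))
  have hβ : ∀ z ∈ e.source, β (q z) = hq.pushCovector z (A z) := fun z hz => by
    have h1 : e.symm (q z) = z := by rw [hqe]; exact e.left_inv hz
    change hq.pushCovector (e.symm (q z)) (A (e.symm (q z))) = _
    rw [h1]
  have hV : ∀ y ∈ e.target, ∃ z ∈ e.source, q z = y := fun y hy =>
    ⟨e.symm y, e.map_target hy, by rw [hqe]; exact e.right_inv hy⟩
  have hpull : ∀ z ∈ e.source, pullbackForm q (toForm β) =ᶠ[𝓝 z] oneForm A₀ A₁ := fun z hz => by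
    filter_upwards [e.open_source.mem_nhds hz] with w hw
    rw [pullbackForm_toForm, hβ w hw, oneForm_eq]
    exact congrArg _ (hq.pullCovector_pushCovector _ _)
  have hsm : ∀ z ∈ e.source, ContDiffAt ℝ ∞ (pullbackForm q (toForm β)) z := fun z hz =>
    (contDiff_oneForm h0 h1).contDiffAt.congr_of_eventuallyEq (hpull z hz)
  refine ⟨e.target, e.open_target, ?_, β, ?_, ?_, ?_⟩
  · have := e.map_source he
    rw [← hqe] at this; exact this
  · refine smoothOn_of_pullback hq.isLocalDiffeomorph fun y hy => ?_
    obtain ⟨z, hz, rfl⟩ := hV y hy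
    exact ⟨z, rfl, hsm z hz⟩
  · intro y hy
    obtain ⟨z, hz, rfl⟩ := hV y hy
    rw [hβ z hz]
    exact hmk z (σ (q z)) (Function.surjInv_eq hq.surjective _) _ rfl
  · refine isDiffOn_of_pullback hq.isLocalDiffeomorph fun y hy => ?_
    obtain ⟨z, hz, rfl⟩ := hV y hy
    exact ⟨z, rfl, hsm z hz, (hpull z hz).extDeriv_eq.trans (hd z)⟩

end Latticed

/-! ### Differentials of latticed forms on the torus -/

section LatticedTorus

theorem fderiv_single_zero_eq {F : Plane → ℝ} (hF : ContDiff ℝ ∞ F) {z : Plane} {d : ℝ}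
    (h : HasDerivAt (fun s => F !₂[s, z 1]) d (z 0)) :
    fderiv ℝ F z (EuclideanSpace.single 0 1) = d := by
  have h1 := hasDerivAt_lineX hF (z 0) (z 1)
  rw [mk_coord] at h1
  exact h1.unique h

theorem fderiv_single_one_eq {F : Plane → ℝ} (hF : ContDiff ℝ ∞ F) {z : Plane} {d : ℝ}
    (h : HasDerivAt (fun s => F !₂[z 0, s]) d (z 1)) :
    fderiv ℝ F z (EuclideanSpace.single 1 1) = d := by
  have h1 := hasDerivAt_lineY hF (z 0) (z 1)
  rw [mk_coord] at h1
  exact h1.unique h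

theorem realCovec_comp_fderiv_upperAff (a b : ℝ) (k : ℤ) (ε : ℤˣ) (c d : ℝ) (z : Plane) :
    (realCovec a b).comp (fderiv ℝ (upperAff k ε c d) z) = realCovec a (k * a + (ε : ℤ) * b) := by
  ext v
  rw [fderiv_upperAff, ContinuousLinearMap.comp_apply, upperLin_apply, realCovec_apply,
    realCovec_apply]
  simp
  ring

theorem realCovec_inj {a b a' b' : ℝ} : realCovec a b = realCovec a' b' ↔ a = a' ∧ b = b' := by
  refine ⟨fun h => ?_, fun h => by rw [h.1, h.2]⟩
  have h0 := congrArg (fun f : Plane →L[ℝ] ℝ => f !₂[1, 0]) h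
  have h1 := congrArg (fun f : Plane →L[ℝ] ℝ => f !₂[0, 1]) h
  simp [realCovec_apply] at h0 h1
  exact ⟨h0, h1⟩

theorem realCovec_add_covec (a b : ℝ) (p : ℤ × ℤ) :
    realCovec a b + covec p = realCovec (a + p.1) (b + p.2) := by
  ext v
  simp only [add_apply, realCovec_apply, covec_apply]
  ring

theorem realCovec_mem {a b : ℝ} (ha : ∃ m : ℤ, a = m) (hb : ∃ n : ℤ, b = n) :
    realCovec a b ∈ stdLattice := by
  obtain ⟨m, rfl⟩ := ha
  obtain ⟨n, rfl⟩ := hb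
  exact mem_stdLattice.2 ⟨(m, n), rfl⟩

/-- The quasi-periodicity of `A₀ dX + A₁ dY` under `upperAff k ε c d`, in coordinates. -/
theorem upperAff_mem_quasiStabilizer {A₀ A₁ : Plane → ℝ} {k : ℤ} {ε : ℤˣ} {c d : ℝ}
    (h0 : ∀ z, ∃ m : ℤ, A₀ (upperAff k ε c d z) - A₀ z = m)
    (h1 : ∀ z, ∃ m : ℤ, k * A₀ (upperAff k ε c d z) + (ε : ℤ) * A₁ (upperAff k ε c d z) -
        A₁ z = m) :
    upperAff k ε c d ∈ quasiStabilizer fun z => realCovec (A₀ z) (A₁ z) := by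
  refine ⟨upperAff_mem_smoothPerms _ _ _ _, fun z ℓ => ?_, fun z => ?_⟩
  · rw [mem_stdLattice, mem_stdLattice]
    have h := (isTwist_affHomeo k ε c d).comp_fderiv
    have h2 : ∀ p, (covec p).comp (fderiv ℝ (upperAff k ε c d) z) =
        covec ((upperTwist k ε).symm p) :=
      fun p => by
        have := h ((upperTwist k ε).symm p) z
        rw [AddEquiv.apply_symm_apply] at this
        exact this
    constructor
    · rintro ⟨p, rfl⟩
      exact ⟨_, (h2 p).symm⟩
    · rintro ⟨p, hp⟩
      refine ⟨upperTwist k ε p, ContinuousLinearMap.ext fun v => ?_⟩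
      have h3 := h p z
      rw [hp] at h3
      have h4 := congrArg (fun f : Plane →L[ℝ] ℝ => f (upperAff k ε 0 0 |>.symm v)) h3
      simp only [ContinuousLinearMap.comp_apply] at h4
      have h5 : fderiv ℝ (upperAff k ε c d) z ((upperAff k ε 0 0).symm v) = v := by
        rw [fderiv_upperAff]
        conv_rhs => rw [← (upperAff k ε 0 0).apply_symm_apply v]
        rw [upperLin_apply, upperAff_apply, add_zero, add_zero]
      have h6 : fderiv ℝ (affHomeo k ε c d) z ((upperAff k ε 0 0).symm v) = v := h5
      rwa [h5, h6] at h4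
  · rw [realCovec_comp_fderiv_upperAff]
    have h2 : realCovec (A₀ (upperAff k ε c d z)) (k * A₀ (upperAff k ε c d z) +
        (ε : ℤ) * A₁ (upperAff k ε c d z)) - realCovec (A₀ z) (A₁ z) =
        realCovec (A₀ (upperAff k ε c d z) - A₀ z)
          (k * A₀ (upperAff k ε c d z) + (ε : ℤ) * A₁ (upperAff k ε c d z) - A₁ z) := by
      ext v
      simp only [sub_apply, realCovec_apply]
      ring
    rw [h2]
    exact realCovec_mem (h0 z) (h1 z)

variable {B : Type*} [TopologicalSpace B] [ChartedSpace Plane B] {P : CotangentLattice B}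

/-- The two inclusions needed to compute the image of `latticedH2 P` under integration. -/
theorem map_latticedH2_eq {Φ : DeRhamH2 B ≃ₗ[ℝ] ℝ} {T : Set ℝ}
    (h1 : ∀ η ∈ latticedDiffs P, Φ (Submodule.Quotient.mk η) ∈ AddSubgroup.closure T)
    (h2 : ∀ x ∈ T, ∃ η ∈ latticedDiffs P, Φ (Submodule.Quotient.mk η) = x) :
    (latticedH2 P).map Φ.toLinearMap.toAddMonoidHom = AddSubgroup.closure T := by
  refine le_antisymm ?_ ((AddSubgroup.closure_le _).2 fun x hx => ?_)
  · rintro _ ⟨_, ⟨η, hη, rfl⟩, rfl⟩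
    exact h1 η hη
  · obtain ⟨η, hη, rfl⟩ := h2 x hx
    exact ⟨_, ⟨η, hη, rfl⟩, rfl⟩

variable {q : Plane → B}

/-- The integral over the unit square of the differential of a `1`-form on the plane, in the
coordinates defined by `Ψ`. -/
theorem squareIntegral_coeff_comp (hq : IsLocalDiffeomorph 𝓘(ℝ, Plane) 𝓘(ℝ, Plane) ∞ q)
    {Ψ : Equiv.Perm Plane} (hΨ : Ψ ∈ smoothPerms) {A₀ A₁ : Plane → ℝ} (h0 : ContDiff ℝ ∞ A₀)
    (h1 : ContDiff ℝ ∞ A₁) {η : FormField B 2}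
    (hd : ∀ z, extDeriv (oneForm A₀ A₁) z = pullbackForm q η z) {e₀ e₁ : Plane → Plane}
    (he₀ : ∀ z, fderiv ℝ Ψ z (EuclideanSpace.single 0 1) = e₀ z)
    (he₁ : ∀ z, fderiv ℝ Ψ z (EuclideanSpace.single 1 1) = e₁ z) :
    squareIntegral (coeff (q ∘ Ψ) η) =
      (∫ y in (0 : ℝ)..1, (realCovec (A₀ (Ψ !₂[1, y])) (A₁ (Ψ !₂[1, y])) (e₁ !₂[1, y]) -
        realCovec (A₀ (Ψ !₂[0, y])) (A₁ (Ψ !₂[0, y])) (e₁ !₂[0, y]))) -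
      ∫ x in (0 : ℝ)..1, (realCovec (A₀ (Ψ !₂[x, 1])) (A₁ (Ψ !₂[x, 1])) (e₀ !₂[x, 1]) -
        realCovec (A₀ (Ψ !₂[x, 0])) (A₁ (Ψ !₂[x, 0])) (e₀ !₂[x, 0])) := by
  have hs : ∀ v : Plane, ContDiff ℝ ∞ fun z => realCovec (A₀ (Ψ z)) (A₁ (Ψ z)) (fderiv ℝ Ψ z v) :=
    fun v => by
      have h2 : ContDiff ℝ ∞ fun z => fderiv ℝ Ψ z v :=
          (hΨ.1.fderiv_right (by simp)).clm_apply contDiff_const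
      simp only [realCovec_apply]
      exact ((h0.comp hΨ.1).mul ((contDiff_coord 0).comp h2)).add
        ((h1.comp hΨ.1).mul ((contDiff_coord 1).comp h2))
  have hP := hs (EuclideanSpace.single 0 1)
  have hQ := hs (EuclideanSpace.single 1 1)
  simp only [he₀] at hP
  simp only [he₁] at hQ
  refine squareIntegral_eq_of_extDeriv hP hQ fun z => ?_
  have h3 : oneForm (fun z => realCovec (A₀ (Ψ z)) (A₁ (Ψ z)) (e₀ z))
      (fun z => realCovec (A₀ (Ψ z)) (A₁ (Ψ z)) (e₁ z)) =
      fun z => (oneForm A₀ A₁ (Ψ z)).compContinuousLinearMap (fderiv ℝ Ψ z) := by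
    funext z
    refine alternating_ext_basis fun r => ?_
    rw [oneForm_apply, ContinuousAlternatingMap.compContinuousLinearMap_apply, oneForm_apply]
    rcases Fin.exists_fin_two.1 ⟨r 0, rfl⟩ with h | h
    · simp [h, he₀, realCovec_apply]
    · simp [h, he₁, realCovec_apply]
  rw [h3, extDeriv_pullback ((contDiff_oneForm h0 h1).contDiffAt.differentiableAt (by simp))
      (hΨ.1.contDiffAt) (r := ∞)
    (by rw [minSmoothness_of_isRCLikeNormedField]; exact WithTop.coe_le_coe.2 le_top), hd,
        ← pullbackForm_comp η (hq.mdifferentiable (by simp) _)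
    (hΨ.1.differentiable (by simp) _), pullbackForm_eq_twoForm]

variable [IsManifold 𝓘(ℝ, Plane) ∞ B]

/-- A `1`-form `A₀ dX + A₁ dY` with integral quasi-periods whose differential is a constant
multiple `(c - d) dX ∧ dY` of the area form descends to a latticed `1`-form. -/
theorem IsPresentation.exists_latticedDiff_const {S : Set (Equiv.Perm Plane)}
    (hq : IsPresentation P (Subgroup.closure S) q) (hS : ∀ g ∈ S, ∃ k a b, g = upperAff k 1 a b)
    {A₀ A₁ : Plane → ℝ} (h0 : ContDiff ℝ ∞ A₀) (h1 : ContDiff ℝ ∞ A₁)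
    (hA : ∀ g ∈ S, g ∈ quasiStabilizer fun z => realCovec (A₀ z) (A₁ z)) {c d : ℝ}
    (hc : ∀ z : Plane, HasDerivAt (fun s => A₁ !₂[s, z 1]) c (z 0))
    (hd : ∀ z : Plane, HasDerivAt (fun s => A₀ !₂[z 0, s]) d (z 1)) :
    ∃ η ∈ latticedDiffs P, coeff q η = fun _ => c - d := by
  obtain ⟨η, hη, h⟩ := hq.isQuotientBy.exists_coeff_eq_const
    (torus_le_formStabilizer_const hS (c - d))
  refine ⟨⟨η, hη⟩, ?_, h⟩
  refine hq.isLatticeCover.exists_hasLatticedDiff hq.fibers h0 h1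
    ((Subgroup.closure_le _).2 hA) fun z => ?_
  rw [extDeriv_oneForm h0 h1, fderiv_single_zero_eq h1 (hc z), fderiv_single_one_eq h0 (hd z)]
  change _ = pullbackForm q η z
  rw [pullbackForm_eq_twoForm, h]
  rfl

/-- The lift `A₀ dX + A₁ dY` of a latticed `1`-form and its quasi-periods, in coordinates. -/
theorem IsPresentation.exists_quasiPeriods {G : Subgroup (Equiv.Perm Plane)}
    (hq : IsPresentation P G q) {η : closedTwoForms B} (hη : η ∈ latticedDiffs P) :
    ∃ A₀ A₁ : Plane → ℝ, ContDiff ℝ ∞ A₀ ∧ ContDiff ℝ ∞ A₁ ∧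
      (∀ z, extDeriv (oneForm A₀ A₁) z = pullbackForm q (η : FormField B 2) z) ∧
      ∀ k ε c d, upperAff k ε c d ∈ G → ∃ p : ℤ × ℤ, ∀ z,
        A₀ (upperAff k ε c d z) = A₀ z + p.1 ∧
        k * A₀ (upperAff k ε c d z) + (ε : ℤ) * A₁ (upperAff k ε c d z) = A₁ z + p.2 := by
  obtain ⟨s, hs⟩ := hη
  obtain ⟨A₀, A₁, h0, h1, hd, hA⟩ := hq.isLatticeCover.exists_lift_latticed hs
  refine ⟨A₀, A₁, h0, h1, hd, fun k ε c d hg => ?_⟩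
  obtain ⟨p, hp⟩ := hA _ (upperAff_mem_smoothPerms k ε c d)
    fun z => ((hq.fibers z _).2 ⟨_, hg, rfl⟩).symm
  refine ⟨p, fun z => ?_⟩
  have h2 := hp z
  rw [realCovec_comp_fderiv_upperAff, realCovec_add_covec] at h2
  exact realCovec_inj.1 h2

/-- By Stokes' theorem, the integral of the differential of a form with quasi-periods `m` and `n`
along `(u, v)` and `(w, z)` is, up to sign, `m₁ w + m₂ z - n₁ u - n₂ v`. -/
theorem deRham_torus {u v w z : ℝ} (hdet : u * z - v * w ≠ 0)
    (hq : IsPresentation P (torusGroup u v w z) q) :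
    ∃ Φ : DeRhamH2 B ≃ₗ[ℝ] ℝ,
      (∀ η : closedTwoForms B, Φ (Submodule.Quotient.mk η) =
        integralOver q (parallelogram !₂[u, v] !₂[w, z]) η) ∧
      (latticedH2 P).map Φ.toLinearMap.toAddMonoidHom =
        AddSubgroup.closure ({u, v, w, z} : Set ℝ) := by
  obtain ⟨Φ₀, hΦ₀⟩ := (hq.isQuotientBy.torus hdet).exists_deRhamH2_equiv
  -- `e` is the orientation of the basis `(u, v)`, `(w, z)`
  obtain ⟨e, he, heD⟩ : ∃ e : ℤ, (e = 1 ∨ e = -1) ∧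
      ((SignType.sign (u * z - v * w) : SignType) : ℝ) = e := by
    rcases hdet.lt_or_gt with h | h
    · exact ⟨-1, Or.inr rfl, by simp [sign_neg h]⟩
    · exact ⟨1, Or.inl rfl, by simp [sign_pos h]⟩
  have he2 : (e : ℝ) * e = 1 := by rcases he with rfl | rfl <;> simp
  have he0 : (e : ℝ) ≠ 0 := fun h => by simp [h] at he2
  have hint : ∀ η : closedTwoForms B, integralOver q (parallelogram !₂[u, v] !₂[w, z]) η =
      e * squareIntegral (coeff (q ∘ linPerm u v w z hdet) η) := fun η => by
    rw [integralOver_torus hdet hq.isLocalDiffeomorph η.2.1, heD]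
  have hΦ : ∀ η : closedTwoForms B, (Φ₀.trans (LinearEquiv.smulOfNeZero ℝ ℝ (e : ℝ) he0))
      (Submodule.Quotient.mk η) = integralOver q (parallelogram !₂[u, v] !₂[w, z]) η := fun η => by
    rw [hint, ← hΦ₀]; rfl
  refine ⟨Φ₀.trans (LinearEquiv.smulOfNeZero ℝ ℝ (e : ℝ) he0), hΦ, map_latticedH2_eq ?_ ?_⟩
  · intro η hη
    rw [hΦ, hint]
    obtain ⟨A₀, A₁, h0, h1, hd, hA⟩ := hq.exists_quasiPeriods hη
    obtain ⟨m, hm⟩ := hA 0 1 u v (Subgroup.subset_closure (Or.inl rfl))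
    obtain ⟨n, hn⟩ := hA 0 1 w z (Subgroup.subset_closure (Or.inr rfl))
    have hm' : ∀ y, linPerm u v w z hdet !₂[1, y] =
        upperAff 0 1 u v (linPerm u v w z hdet !₂[0, y]) :=
      fun y => by
        ext i; fin_cases i <;> simp [linPerm_apply, upperAff_apply] <;> ring
    have hn' : ∀ x, linPerm u v w z hdet !₂[x, 1] =
        upperAff 0 1 w z (linPerm u v w z hdet !₂[x, 0]) :=
      fun y => by
        ext i; fin_cases i <;> simp [linPerm_apply, upperAff_apply]
    rw [squareIntegral_coeff_comp hq.isLocalDiffeomorph (linPerm_mem hdet) h0 h1 hd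
      (e₀ := fun _ => !₂[u, v]) (e₁ := fun _ => !₂[w, z])
      (fun p => by rw [fderiv_linPerm]; ext i; fin_cases i <;> simp [linPerm_apply])
      (fun p => by rw [fderiv_linPerm]; ext i; fin_cases i <;> simp [linPerm_apply])]
    have hQ : ∀ y, realCovec (A₀ (linPerm u v w z hdet !₂[1, y])) (A₁
        (linPerm u v w z hdet !₂[1, y])) !₂[w, z] -
        realCovec (A₀ (linPerm u v w z hdet !₂[0, y])) (A₁
            (linPerm u v w z hdet !₂[0, y])) !₂[w, z] =
        m.1 * w + m.2 * z := fun y => by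
      have h2 := hm (linPerm u v w z hdet !₂[0, y])
      rw [← hm'] at h2
      simp only [Int.cast_zero, Units.val_one, Int.cast_one, zero_mul, one_mul, zero_add] at h2
      rw [realCovec_apply, realCovec_apply, h2.1, h2.2]
      simp; ring
    have hP : ∀ x, realCovec (A₀ (linPerm u v w z hdet !₂[x, 1])) (A₁
        (linPerm u v w z hdet !₂[x, 1])) !₂[u, v] -
        realCovec (A₀ (linPerm u v w z hdet !₂[x, 0])) (A₁
            (linPerm u v w z hdet !₂[x, 0])) !₂[u, v] =
        n.1 * u + n.2 * v := fun y => by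
      have h2 := hn (linPerm u v w z hdet !₂[y, 0])
      rw [← hn'] at h2
      simp only [Int.cast_zero, Units.val_one, Int.cast_one, zero_mul, one_mul, zero_add] at h2
      rw [realCovec_apply, realCovec_apply, h2.1, h2.2]
      simp; ring
    simp only [hQ, hP, intervalIntegral.integral_const, sub_zero, one_smul]
    have hmem : ∀ x ∈ ({u, v, w, z} : Set ℝ), ∀ k : ℤ, k * x ∈ AddSubgroup.closure
        ({u, v, w, z} : Set ℝ) :=
      fun x hx k => by
        rw [← zsmul_eq_mul]; exact zsmul_mem (AddSubgroup.subset_closure hx) k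
    rw [← zsmul_eq_mul]
    exact zsmul_mem (sub_mem (add_mem (hmem w (by simp) _) (hmem z (by simp) _))
      (add_mem (hmem u (by simp) _) (hmem v (by simp) _))) e
  · -- the linear `1`-forms with quasi-periods `(m₀, m₁)` along `(u, v)` and `(n₀, n₁)` along `(w,
    -- z)`
    have key : ∀ m₀ m₁ n₀ n₁ : ℤ, ∃ η ∈ latticedDiffs P,
        integralOver q (parallelogram !₂[u, v] !₂[w, z]) η =
          e * (m₁ * z - n₁ * v - n₀ * u + m₀ * w) := by
      intro m₀ m₁ n₀ n₁
      obtain ⟨D, hD⟩ : ∃ D, D = u * z - v * w := ⟨_, rfl⟩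
      have hD0 : D ≠ 0 := hD ▸ hdet
      have hlin : ∀ a b : ℝ, ContDiff ℝ ∞ fun p : Plane => (a * p 0 + b * p 1) / D := fun a b =>
        ((contDiff_const.mul (contDiff_coord 0)).add (contDiff_const.mul
            (contDiff_coord 1))).div_const D
      have hper : ∀ (m n : ℤ) (p : Plane),
          ((m * z - n * v) * (p 0 + u) + (n * u - m * w) * (p 1 + v)) / D -
            ((m * z - n * v) * p 0 + (n * u - m * w) * p 1) / D = m ∧
          ((m * z - n * v) * (p 0 + w) + (n * u - m * w) * (p 1 + z)) / D -
            ((m * z - n * v) * p 0 + (n * u - m * w) * p 1) / D = n := fun m n p => by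
        constructor <;> (field_simp; rw [hD]; ring)
      obtain ⟨η, hη, hc⟩ := hq.exists_latticedDiff_const (c := (m₁ * z - n₁ * v) / D)
        (d := (n₀ * u - m₀ * w) / D)
        (by rintro g (rfl | rfl) <;> exact ⟨_, _, _, rfl⟩)
        (hlin (m₀ * z - n₀ * v) (n₀ * u - m₀ * w)) (hlin (m₁ * z - n₁ * v) (n₁ * u - m₁ * w)) (by
          rintro g (rfl | rfl)
          · refine upperAff_mem_quasiStabilizer (fun p => ⟨m₀, ?_⟩) fun p => ⟨m₁, ?_⟩
            · refine Eq.trans ?_ (hper m₀ n₀ p).1; simp [upperAff_apply]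
            · refine Eq.trans ?_ (hper m₁ n₁ p).1; simp [upperAff_apply]
          · refine upperAff_mem_quasiStabilizer (fun p => ⟨n₀, ?_⟩) fun p => ⟨n₁, ?_⟩
            · refine Eq.trans ?_ (hper m₀ n₀ p).2; simp [upperAff_apply]
            · refine Eq.trans ?_ (hper m₁ n₁ p).2; simp [upperAff_apply])
        (fun p => by
          simpa using (((hasDerivAt_id (p 0)).const_mul (m₁ * z - n₁ * v : ℝ)).add_const
            ((n₁ * u - m₁ * w : ℝ) * p 1)).div_const D)
        (fun p => by
          simpa using (((hasDerivAt_id (p 1)).const_mul (n₀ * u - m₀ * w : ℝ)).const_add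
            ((m₀ * z - n₀ * v : ℝ) * p 0)).div_const D)
      refine ⟨η, hη, ?_⟩
      rw [integralOver_eq, hc, setIntegral_parallelogram hdet continuous_const,
        squareIntegral_const, ← hD, ← sign_mul_self D, hD, heD, ← hD]
      field_simp
      ring
    intro x hx
    simp only [hΦ]
    rcases hx with rfl | rfl | rfl | rfl
    · obtain ⟨η, hη, h⟩ := key 0 0 (-e) 0
      refine ⟨η, hη, h.trans ?_⟩
      push_cast; linear_combination x * he2
    · obtain ⟨η, hη, h⟩ := key 0 0 0 (-e)
      refine ⟨η, hη, h.trans ?_⟩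
      push_cast; linear_combination x * he2
    · obtain ⟨η, hη, h⟩ := key e 0 0 0
      refine ⟨η, hη, h.trans ?_⟩
      push_cast; linear_combination x * he2
    · obtain ⟨η, hη, h⟩ := key 0 e 0 0
      refine ⟨η, hη, h.trans ?_⟩
      push_cast; linear_combination x * he2

/-- By Stokes' theorem in the coordinates of the standard torus, the integral of the differential
of a latticed form is an integral combination of `x` and `y`: the shear contributes to the integral
over the horizontal period a term linear in `t`, which has mean zero. -/
theorem deRham_shearTorus {n : ℕ} {y x : ℝ} (hy : 0 < y) (hx : 0 < x)
    (hq : IsPresentation P (shearTorusGroup n y x) q) :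
    ∃ Φ : DeRhamH2 B ≃ₗ[ℝ] ℝ,
      (∀ η : closedTwoForms B, Φ (Submodule.Quotient.mk η) =
        integralOver q (parallelogram !₂[x, 0] !₂[0, y]) η) ∧
      (latticedH2 P).map Φ.toLinearMap.toAddMonoidHom =
        AddSubgroup.closure ({x, y} : Set ℝ) := by
  obtain ⟨Φ, hΦ⟩ := (hq.isQuotientBy.shearTorus hy.ne' hx.ne').exists_deRhamH2_equiv
  have hΦ' : ∀ η : closedTwoForms B, Φ (Submodule.Quotient.mk η) =
      integralOver q (parallelogram !₂[x, 0] !₂[0, y]) η := fun η => by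
    rw [hΦ, integralOver_shearTorus hy hx hq.isQuotientBy η.2.1]
  refine ⟨Φ, hΦ', map_latticedH2_eq ?_ ?_⟩
  · intro η hη
    rw [hΦ]
    set Ψ := shearPerm x y hx.ne' hy.ne' (n * y / 2) (-(n * y / 2)) with hΨdef
    obtain ⟨A₀, A₁, h0, h1, hd, hA⟩ := hq.exists_quasiPeriods hη
    obtain ⟨l, hl⟩ := hA n 1 0 y (Subgroup.subset_closure (Or.inl rfl))
    obtain ⟨m, hm⟩ := hA 0 1 x 0 (Subgroup.subset_closure (Or.inr rfl))
    have hm' : ∀ t, Ψ !₂[1, t] = upperAff 0 1 x 0 (Ψ !₂[0, t]) := fun t => by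
      ext i; fin_cases i <;> simp [hΨdef, shearPerm_apply, upperAff_apply]; ring
    have hl' : ∀ s, Ψ !₂[s, 1] = upperAff n 1 0 y (Ψ !₂[s, 0]) := fun s => by
      ext i; fin_cases i <;> simp [hΨdef, shearPerm_apply, upperAff_apply]
    rw [squareIntegral_coeff_comp hq.isLocalDiffeomorph (shearPerm_mem hx.ne' hy.ne' _ _) h0 h1 hd
      (e₀ := fun _ => !₂[x, 0]) (e₁ := fun p => !₂[2 * (n * y / 2) * p 1 + -(n * y / 2), y])
      (fun p => by rw [fderiv_shearPerm]; ext i; fin_cases i <;> simp)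
      (fun p => by rw [fderiv_shearPerm]; ext i; fin_cases i <;> simp)]
    rw [← hΨdef]
    have hQ : ∀ t, realCovec (A₀ (Ψ !₂[1, t])) (A₁ (Ψ !₂[1, t])) !₂[2 *
        (n * y / 2) * t + -(n * y / 2), y] -
        realCovec (A₀ (Ψ !₂[0, t])) (A₁ (Ψ !₂[0, t])) !₂[2 * (n * y / 2) * t + -(n * y / 2), y] =
        m.1 * (n * y) * t + (m.2 * y - m.1 * (n * y / 2)) := fun t => by
      have h2 := hm (Ψ !₂[0, t])
      rw [← hm'] at h2
      simp only [Int.cast_zero, Units.val_one, Int.cast_one, zero_mul, one_mul, zero_add] at h2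
      rw [realCovec_apply, realCovec_apply, h2.1, h2.2]
      simp; ring
    have hP : ∀ s, realCovec (A₀ (Ψ !₂[s, 1])) (A₁ (Ψ !₂[s, 1])) !₂[x, 0] -
        realCovec (A₀ (Ψ !₂[s, 0])) (A₁ (Ψ !₂[s, 0])) !₂[x, 0] = l.1 * x := fun s => by
      have h2 := hl (Ψ !₂[s, 0])
      rw [← hl'] at h2
      rw [realCovec_apply, realCovec_apply, h2.1]
      simp; ring
    simp only [Matrix.cons_val_one, Matrix.cons_val_fin_one, hQ, hP]
    rw [intervalIntegral.integral_add (Continuous.intervalIntegrable (by fun_prop) _ _)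
      (Continuous.intervalIntegrable (by fun_prop) _ _),
      intervalIntegral.integral_const_mul, integral_id]
    simp only [intervalIntegral.integral_const, sub_zero, one_smul]
    have h3 : (m.1 : ℝ) * (n * y) * ((1 ^ 2 - 0 ^ 2) / 2) + (m.2 * y - m.1 *
        (n * y / 2)) - l.1 * x =
        m.2 • y - l.1 • x := by
      rw [zsmul_eq_mul, zsmul_eq_mul]; ring
    rw [h3]
    exact sub_mem (zsmul_mem (AddSubgroup.subset_closure (by simp)) _)
      (zsmul_mem (AddSubgroup.subset_closure (by simp)) _)
  · have hdet : x * y - 0 * 0 ≠ 0 := by simp [hx.ne', hy.ne']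
    have hS : ∀ g ∈ ({upperAff n 1 0 y, upperAff 0 1 x 0} : Set (Equiv.Perm Plane)),
        ∃ k a b, g = upperAff k 1 a b := by rintro g (rfl | rfl) <;> exact ⟨_, _, _, rfl⟩
    have hval : ∀ {η : FormField B 2} {c : ℝ}, (coeff q η = fun _ => c) →
        integralOver q (parallelogram !₂[x, 0] !₂[0, y]) η = x * y * c := fun {η c} h => by
      rw [integralOver_eq, h, setIntegral_parallelogram hdet continuous_const, squareIntegral_const]
      simp [abs_of_pos hx, abs_of_pos hy]
    have c0 := contDiff_coord 0
    have c1 := contDiff_coord 1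
    intro r hr
    simp only [hΦ']
    rcases hr with rfl | rfl
    -- `A₀` decreases by `1` along the vertical generator `g`; the quadratic function `A₁` is chosen
    -- such that the `dY`-component `n A₀ ∘ g + A₁ ∘ g` of the pull-back is again `A₁`
    · obtain ⟨η, hη, h⟩ := hq.exists_latticedDiff_const hS (c := 0) (d := -(1 / y))
        (A₀ := fun p => -(p 1 / y)) (A₁ := fun p => n / (2 * y ^ 2) * p 1 ^ 2 + n / (2 * y) * p 1)
        (c1.div_const y).neg ((contDiff_const.mul (c1.pow 2)).add (contDiff_const.mul c1)) (by
          rintro g (rfl | rfl)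
          · refine upperAff_mem_quasiStabilizer (fun p => ⟨-1, ?_⟩) fun p => ⟨0, ?_⟩
            · simp [upperAff_apply]; field_simp; ring
            · simp [upperAff_apply]; field_simp; ring
          · refine upperAff_mem_quasiStabilizer (fun p => ⟨0, ?_⟩) fun p => ⟨0, ?_⟩
            · simp [upperAff_apply]
            · simp [upperAff_apply])
        (fun p => by simpa using hasDerivAt_const (p 0) _)
        (fun p => by simpa [Pi.neg_def] using ((hasDerivAt_id (p 1)).div_const y).neg)
      refine ⟨η, hη, (hval h).trans ?_⟩
      field_simp; ring
    -- `A₁` is the coordinate `X / x`, corrected to be invariant under the shear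
    · obtain ⟨η, hη, h⟩ := hq.exists_latticedDiff_const hS (c := 1 / x) (d := 0)
        (A₀ := fun p => 0) (A₁ := fun p => p 0 / x - n / x * (p 1 ^ 2 / (2 * r) - p 1 / 2))
        contDiff_const ((c0.div_const x).sub (contDiff_const.mul
          (((c1.pow 2).div_const _).sub (c1.div_const 2)))) (by
          rintro g (rfl | rfl)
          · refine upperAff_mem_quasiStabilizer (fun p => ⟨0, ?_⟩) fun p => ⟨0, ?_⟩
            · simp
            · simp [upperAff_apply]; field_simp; ring
          · refine upperAff_mem_quasiStabilizer (fun p => ⟨0, ?_⟩) fun p => ⟨1, ?_⟩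
            · simp
            · simp [upperAff_apply]; field_simp; ring)
        (fun p => by simpa using (((hasDerivAt_id (p 0)).div_const x).sub_const
          (n / x * (p 1 ^ 2 / (2 * r) - p 1 / 2))))
        (fun p => by simpa using hasDerivAt_const (p 1) (0 : ℝ))
      refine ⟨η, hη, (hval h).trans ?_⟩
      field_simp; ring

end LatticedTorus

/-! ### Free and proper groups of affine transformations of the plane -/

section AffineGroups

/-- `g` is the affine map of the plane with linear part `(a b; c d)` and translation part
`(e, f)`. -/
def IsAff (g : Equiv.Perm Plane) (a b c d e f : ℝ) : Prop :=
  ∀ z, g z = !₂[a * z 0 + b * z 1 + e, c * z 0 + d * z 1 + f]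

variable {g h : Equiv.Perm Plane} {a b c d e f a' b' c' d' e' f' : ℝ}

theorem isAff_upperAff (k : ℤ) (ε : ℤˣ) (c d : ℝ) :
    IsAff (upperAff k ε c d) 1 k 0 ((ε : ℤ) : ℝ) c d := fun z => by
  rw [upperAff_apply]; simp

theorem isAff_one : IsAff 1 1 0 0 1 0 0 := fun z => by
  ext i; fin_cases i <;> simp

theorem IsAff.mul (hg : IsAff g a b c d e f) (hh : IsAff h a' b' c' d' e' f') :
    IsAff (g * h) (a * a' + b * c') (a * b' + b * d') (c * a' + d * c') (c * b' + d * d')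
      (a * e' + b * f' + e) (c * e' + d * f' + f) := fun z => by
  rw [Equiv.Perm.mul_apply, hg, hh]
  ext i; fin_cases i <;> simp <;> ring

theorem IsAff.unique (hg : IsAff g a b c d e f) (hg' : IsAff g a' b' c' d' e' f') :
    a = a' ∧ b = b' ∧ c = c' ∧ d = d' ∧ e = e' ∧ f = f' := by
  have h0 := (hg 0).symm.trans (hg' 0)
  have h1 := (hg !₂[1, 0]).symm.trans (hg' !₂[1, 0])
  have h2 := (hg !₂[0, 1]).symm.trans (hg' !₂[0, 1])
  have i0 := congrArg (fun z : Plane => z 0) h0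
  have i1 := congrArg (fun z : Plane => z 1) h0
  have j0 := congrArg (fun z : Plane => z 0) h1
  have j1 := congrArg (fun z : Plane => z 1) h1
  have k0 := congrArg (fun z : Plane => z 0) h2
  have k1 := congrArg (fun z : Plane => z 1) h2
  simp at i0 i1 j0 j1 k0 k1
  subst i0 i1
  refine ⟨?_, ?_, ?_, ?_, rfl, rfl⟩ <;> linarith

theorem IsAff.eq (hg : IsAff g a b c d e f) (hh : IsAff h a b c d e f) : g = h :=
  Equiv.ext fun z => (hg z).trans (hh z).symm

theorem IsAff.eq_upperAff {ε : ℤˣ} (hg : IsAff g 1 0 0 ((ε : ℤ) : ℝ) e f) :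
    g = upperAff 0 ε e f :=
  hg.eq (by simpa using isAff_upperAff 0 ε e f)

/-- The group `G` acts on the plane freely and properly. -/
structure ActsProperly (G : Subgroup (Equiv.Perm Plane)) : Prop where
  eq_one : ∀ g ∈ G, ∀ z, g z = z → g = 1
  finite : ∀ (z : Plane) (K : Set Plane), IsCompact K → {g | g ∈ G ∧ g z ∈ K}.Finite

/-- The group `Ψ⁻¹ G Ψ`. -/
def conjBy (Ψ : Equiv.Perm Plane) (G : Subgroup (Equiv.Perm Plane)) :
    Subgroup (Equiv.Perm Plane) := G.comap (MulAut.conj Ψ).toMonoidHom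

variable {G : Subgroup (Equiv.Perm Plane)} {Ψ Φ : Equiv.Perm Plane}

theorem mem_conjBy : g ∈ conjBy Ψ G ↔ Ψ * g * Ψ⁻¹ ∈ G := Iff.rfl

theorem exists_of_mem_conjBy (h : g ∈ conjBy Ψ G) : ∃ g' ∈ G, ∀ z, Ψ (g z) = g' (Ψ z) :=
  ⟨_, h, fun z => by simp⟩

theorem conj_mem_conjBy (hg : g ∈ G) : Ψ⁻¹ * g * Ψ ∈ conjBy Ψ G := by
  rw [mem_conjBy]
  convert hg using 1
  group

theorem conjBy_conjBy : conjBy Ψ (conjBy Φ G) = conjBy (Φ * Ψ) G := by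
  ext g
  simp only [mem_conjBy, mul_inv_rev, mul_assoc]

theorem map_conjBy : (conjBy Ψ G).map (MulAut.conj Ψ).toMonoidHom = G :=
  Subgroup.map_comap_eq_self_of_surjective (MulAut.conj Ψ).surjective G

theorem ActsProperly.conjBy (hG : ActsProperly G) (hΨ : Ψ ∈ smoothPerms) :
    ActsProperly (conjBy Ψ G) := by
  refine ⟨fun g hg z hz => ?_, fun z K hK => ?_⟩
  · have h1 := hG.eq_one _ hg (Ψ z) (by simp [hz])
    simpa [mul_inv_eq_one] using h1
  · refine Set.Finite.of_finite_image (f := fun g => Ψ * g * Ψ⁻¹)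
      ((hG.finite (Ψ z) (Ψ '' K) (hK.image hΨ.1.continuous)).subset ?_) ?_
    · rintro _ ⟨g, ⟨hg, hgz⟩, rfl⟩
      exact ⟨hg, g z, hgz, by simp⟩
    · intro g _ g' _ h
      simpa using h

/-- Only finitely many elements of `G` take the origin into a given bounded box. -/
theorem ActsProperly.finite_box (hG : ActsProperly G) (r s : ℝ) :
    {g | g ∈ G ∧ (g 0) 0 ∈ Icc (-r) r ∧ (g 0) 1 ∈ Icc (-s) s}.Finite := by
  have hc : Continuous fun p : ℝ × ℝ => (!₂[p.1, p.2] : Plane) := by fun_prop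
  refine (hG.finite 0 _ ((isCompact_Icc (a := -r) (b := r)).prod
    (isCompact_Icc (a := -s) (b := s)) |>.image hc)).subset ?_
  rintro g ⟨hg, h0, h1⟩
  exact ⟨hg, ((g 0) 0, (g 0) 1), ⟨h0, h1⟩, mk_coord _⟩

/-- A subgroup of `ℝ` with finitely many elements in a neighbourhood of zero is cyclic. -/
theorem exists_eq_zmultiples {H : AddSubgroup ℝ} (hH : {d | d ∈ H ∧ |d| ≤ 1}.Finite) :
    ∃ y, H = AddSubgroup.zmultiples y := by
  have h1 := (hH.subset (fun d (hd : d ∈ H ∧ 0 < d ∧ d ≤ 1) =>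
    ⟨hd.1, abs_le.2 ⟨by linarith [hd.2.1], hd.2.2⟩⟩) : {d | d ∈ H ∧ 0 < d ∧ d ≤ 1}.Finite)
  obtain ⟨r, hr, hrH⟩ : ∃ r : ℝ, 0 < r ∧ ∀ d ∈ H, 0 < d → r ≤ d := by
    rcases Set.eq_empty_or_nonempty {d | d ∈ H ∧ 0 < d ∧ d ≤ 1} with h0 | h0
    · refine ⟨1, one_pos, fun d hd hd0 => le_of_not_ge fun h => ?_⟩
      exact Set.notMem_empty d (h0 ▸ (⟨hd, hd0, h⟩ : d ∈ {d | d ∈ H ∧ 0 < d ∧ d ≤ 1}))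
    · obtain ⟨r, hr, hmin⟩ := h1.exists_minimalFor id _ h0
      refine ⟨r, hr.2.1, fun d hd hd0 => ?_⟩
      rcases le_total d 1 with h | h
      · exact (le_total r d).elim id fun h' => hmin ⟨hd, hd0, h⟩ h'
      · exact hr.2.2.trans h
  obtain ⟨y, hy⟩ := AddSubgroup.cyclic_of_isolated_zero hr (by
    rw [Set.disjoint_left]
    exact fun d hd hd' => absurd (hrH d hd hd'.1) (not_le.2 hd'.2))
  exact ⟨y, by rw [hy, AddSubgroup.zmultiples_eq_closure]⟩

/-- The vectors of the translations in `G`. -/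
def translations (G : Subgroup (Equiv.Perm Plane)) : AddSubgroup (ℝ × ℝ) where
  carrier := {p | upperAff 0 1 p.1 p.2 ∈ G}
  add_mem' {p q} hp hq := by
    have h1 : upperAff 0 1 (p + q).1 (p + q).2 = upperAff 0 1 p.1 p.2 * upperAff 0 1 q.1 q.2 := by
      ext1 z
      simp only [Equiv.Perm.mul_apply, upperAff_apply]
      ext i; fin_cases i <;> simp <;> ring
    rw [Set.mem_ofPred_eq, h1]
    exact mul_mem hp hq
  zero_mem' := by
    have h1 : upperAff 0 1 (0 : ℝ × ℝ).1 (0 : ℝ × ℝ).2 = 1 := by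
      ext1 z
      rw [upperAff_apply]
      ext i; fin_cases i <;> simp
    rw [Set.mem_ofPred_eq, h1]
    exact one_mem G
  neg_mem' {p} hp := by
    have h1 : upperAff 0 1 (-p).1 (-p).2 = (upperAff 0 1 p.1 p.2)⁻¹ := by
      rw [eq_inv_iff_mul_eq_one]
      ext1 z
      simp only [Equiv.Perm.mul_apply, upperAff_apply]
      ext i; fin_cases i <;> simp
    rw [Set.mem_ofPred_eq, h1]
    exact inv_mem hp

theorem mem_translations {c d : ℝ} : (c, d) ∈ translations G ↔ upperAff 0 1 c d ∈ G := Iff.rfl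

theorem IsAff.mem_translations_iff (hg : IsAff g 1 0 0 1 c d) :
    (c, d) ∈ translations G ↔ g ∈ G := by
  rw [LagrangianFibration.mem_translations, ← IsAff.eq_upperAff (ε := 1) (by simpa using hg)]

theorem IsAff.mem_translations (hg : IsAff g 1 0 0 1 c d) (h : g ∈ G) : (c, d) ∈ translations G :=
  hg.mem_translations_iff.2 h

/-- The group of those `x` for which `G` contains the translation by `(x, 0)`. -/
def horizontals (G : Subgroup (Equiv.Perm Plane)) : AddSubgroup ℝ :=
  (translations G).comap (AddMonoidHom.inl ℝ ℝ)

theorem mem_horizontals {c : ℝ} : c ∈ horizontals G ↔ upperAff 0 1 c 0 ∈ G := Iff.rfl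

/-- The group of the pairs `(k, d)` such that `G` contains a map of the form
`(x, y) ↦ (x + k y + c, y + d)`. -/
def slopes (G : Subgroup (Equiv.Perm Plane)) : AddSubgroup (ℝ × ℝ) where
  carrier := {p | ∃ g ∈ G, ∃ c, IsAff g 1 p.1 0 1 c p.2}
  add_mem' := by
    rintro p p' ⟨g, hg, c, h⟩ ⟨g', hg', c', h'⟩
    exact ⟨g' * g, mul_mem hg' hg, c + p'.1 * p.2 + c', by
      simpa [add_comm] using h'.mul h⟩
  zero_mem' := ⟨1, one_mem G, 0, isAff_one⟩
  neg_mem' := by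
    rintro p ⟨g, hg, c, h⟩
    refine ⟨g⁻¹, inv_mem hg, p.1 * p.2 - c, fun z => ?_⟩
    rw [Equiv.Perm.inv_eq_iff_eq, h]
    ext i; fin_cases i
    · simp; ring
    · simp

/-- The group of the translation parts in `y` of those elements of `G` that have the form
`(x, y) ↦ (x + k y + c, y + d)`. -/
def heights (G : Subgroup (Equiv.Perm Plane)) : AddSubgroup ℝ :=
  (slopes G).map (AddMonoidHom.snd ℝ ℝ)

theorem mem_heights {d : ℝ} : d ∈ heights G ↔ ∃ g ∈ G, ∃ k c, IsAff g 1 k 0 1 c d := by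
  constructor
  · rintro ⟨⟨k, d⟩, ⟨g, hg, c, h⟩, rfl⟩
    exact ⟨g, hg, k, c, h⟩
  · rintro ⟨g, hg, k, c, h⟩
    exact ⟨(k, d), ⟨g, hg, c, h⟩, rfl⟩

/-- The group of horizontal translations is discrete. -/
theorem ActsProperly.exists_horizontals (hG : ActsProperly G) :
    ∃ x, horizontals G = AddSubgroup.zmultiples x := by
  refine exists_eq_zmultiples (((hG.finite_box 1 0).image fun g => (g 0) 0).subset ?_)
  rintro c ⟨hc, hc1⟩
  exact ⟨_, ⟨hc, by simpa [upperAff_apply] using abs_le.1 hc1, by simp [upperAff_apply]⟩,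
    by simp [upperAff_apply]⟩

/-- If there is a horizontal translation, then the group of heights is discrete: an element of
small height can be composed with horizontal translations so as to move the origin by a bounded
amount. -/
theorem ActsProperly.exists_heights (hG : ActsProperly G) {x : ℝ} (hx : x ≠ 0)
    (hxG : x ∈ horizontals G) : ∃ y, heights G = AddSubgroup.zmultiples y := by
  refine exists_eq_zmultiples (((hG.finite_box |x| 1).image fun g => (g 0) 1).subset ?_)
  rintro d ⟨hd, hd1⟩
  obtain ⟨g, hg, k, c, h⟩ := mem_heights.1 hd
  -- a horizontal translation moves the image of the origin into the box
  have h1 : upperAff 0 1 (-⌊c / x⌋ • x) 0 ∈ G := zsmul_mem hxG (-⌊c / x⌋)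
  have h2 := (isAff_upperAff 0 1 (-⌊c / x⌋ • x) 0).mul h
  have h3 : |c - ⌊c / x⌋ * x| ≤ |x| := by
    have h4 : c - ⌊c / x⌋ * x = Int.fract (c / x) * x := by
      rw [Int.fract]; field_simp
    rw [h4, abs_mul, abs_of_nonneg (Int.fract_nonneg _)]
    exact mul_le_of_le_one_left (abs_nonneg x) (Int.fract_lt_one _).le
  refine ⟨_, ⟨mul_mem h1 hg, ?_, ?_⟩, ?_⟩
  · rw [h2]
    simpa [sub_eq_add_neg] using abs_le.1 h3
  · rw [h2]
    simpa using abs_le.1 hd1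
  · simp only [h2 _]
    simp

/-- If `b ≠ 0`, then `(x, y) ↦ (x + b y + e, y)` fixes a horizontal line. -/
theorem ActsProperly.eq_zero_of_fixed_height (hG : ActsProperly G) (hg : g ∈ G)
    (h : IsAff g 1 b 0 1 e 0) : b = 0 := by
  by_contra hb
  have h1 := hG.eq_one g hg !₂[0, -e / b] (by rw [h]; ext i; fin_cases i <;> simp; field_simp; ring)
  subst h1
  exact hb (h.unique isAff_one).2.1

/-- A reflection in a horizontal line has fixed points. -/
theorem ActsProperly.ne_zero_of_reflection (hG : ActsProperly G) (hg : g ∈ G)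
    (h : IsAff g 1 0 0 (-1) e f) : e ≠ 0 := by
  rintro rfl
  have h1 := hG.eq_one g hg !₂[0, f / 2] (by rw [h]; ext i; fin_cases i <;> simp; ring)
  subst h1
  have := (h.unique isAff_one).2.2.2.1
  norm_num at this

end AffineGroups

/-! ### Normal forms of free and proper affine groups -/

section NormalForms

/-- `G` is trivial, or generated by `(x, y) ↦ (x + c, ±y)`, or the group of a torus or of a Klein
bottle. -/
inductive IsNormalForm : Subgroup (Equiv.Perm Plane) → Prop
  | bot : IsNormalForm ⊥
  | cyclic (ε : ℤˣ) (c : ℝ) (hc : c ≠ 0) : IsNormalForm (Subgroup.closure {upperAff 0 ε c 0})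
  | torus (u v w z : ℝ) (h : u * z - v * w ≠ 0) : IsNormalForm (torusGroup u v w z)
  | klein (x y : ℝ) (hx : x ≠ 0) (hy : y ≠ 0) : IsNormalForm (kleinGroup 0 y 0 x)

/-- Some diffeomorphism of the plane conjugates `G` to a group in normal form. -/
def IsNormalizable (G : Subgroup (Equiv.Perm Plane)) : Prop :=
  ∃ Ψ ∈ smoothPerms, IsNormalForm (conjBy Ψ G)

variable {G : Subgroup (Equiv.Perm Plane)} {Ψ g : Equiv.Perm Plane} {a b c d e f : ℝ}

theorem IsNormalForm.isNormalizable (h : IsNormalForm G) : IsNormalizable G :=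
  ⟨1, one_mem _, by
    have h1 : conjBy 1 G = G := by ext g; simp [mem_conjBy]
    rwa [h1]⟩

theorem IsNormalizable.of_conjBy (h : IsNormalizable (conjBy Ψ G)) (hΨ : Ψ ∈ smoothPerms) :
    IsNormalizable G := by
  obtain ⟨Φ, hΦ, h⟩ := h
  exact ⟨Ψ * Φ, mul_mem hΨ hΦ, by rwa [conjBy_conjBy] at h⟩

/-- A group of translations with a horizontal element `(x, 0)` is generated by a minimal horizontal
element and, unless all elements are horizontal, one more element of minimal height. -/
theorem ActsProperly.isNormalForm_of_horizontal (hG : ActsProperly G)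
    (ht : ∀ g ∈ G, ∃ c d, IsAff g 1 0 0 1 c d) {x : ℝ} (hx : x ≠ 0) (hxG : x ∈ horizontals G) :
    IsNormalForm G := by
  obtain ⟨a, ha⟩ := hG.exists_horizontals
  obtain ⟨y, hy⟩ := hG.exists_heights hx hxG
  have ha0 : a ≠ 0 := by
    rintro rfl
    rw [ha] at hxG
    simp at hxG
    exact hx hxG
  have haG : upperAff 0 1 a 0 ∈ G := by
    have : a ∈ horizontals G := ha ▸ AddSubgroup.mem_zmultiples a
    exact this
  have hyG : y ∈ heights G := hy ▸ AddSubgroup.mem_zmultiples y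
  obtain ⟨s, hs, k, w, hsw⟩ := mem_heights.1 hyG
  obtain ⟨w', y', h1⟩ := ht s hs
  obtain ⟨-, rfl, -, -, rfl, rfl⟩ := hsw.unique h1
  have hsG : (w, y) ∈ translations G := hsw.mem_translations hs
  have key : ∀ g ∈ G, ∃ m n : ℤ, IsAff g 1 0 0 1 (m * a + n * w) (n * y) := fun g hg => by
    obtain ⟨c, d, h⟩ := ht g hg
    have hd : d ∈ heights G := mem_heights.2 ⟨g, hg, 0, c, h⟩
    rw [hy] at hd
    obtain ⟨n, rfl⟩ := hd
    have h2 : (c, n • y) - n • (w, y) ∈ translations G :=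
      sub_mem (h.mem_translations hg) (zsmul_mem hsG n)
    have h3 : c - n * w ∈ horizontals G := by
      rw [mem_horizontals, ← mem_translations]
      convert h2 using 1
      ext <;> simp
    rw [ha] at h3
    obtain ⟨m, hm⟩ := h3
    refine ⟨m, n, ?_⟩
    have h4 : c = m * a + n * w := by
      have : (m : ℝ) * a = c - n * w := by simpa using hm
      linarith
    rw [← h4]
    simpa using h
  by_cases hy0 : y = 0
  · have h1 : G = Subgroup.closure {upperAff 0 1 a 0} := by
      refine le_antisymm (fun g hg => ?_) ((Subgroup.closure_le _).2 (by simpa using haG))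
      obtain ⟨c, d, h⟩ := ht g hg
      have hd : d ∈ heights G := mem_heights.2 ⟨g, hg, 0, c, h⟩
      rw [hy, hy0] at hd
      obtain rfl : d = 0 := by simpa using hd
      have h3 : c ∈ horizontals G := h.mem_translations hg
      rw [ha] at h3
      have h4 : AddSubgroup.zmultiples a ≤ horizontals (Subgroup.closure {upperAff 0 1 a 0}) := by
        rw [AddSubgroup.zmultiples_le, mem_horizontals]
        exact Subgroup.subset_closure rfl
      exact h.mem_translations_iff.1 (h4 h3)
    rw [h1]
    exact .cyclic 1 a ha0
  · have h1 : G = torusGroup a 0 w y := by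
      refine le_antisymm (fun g hg => ?_) ((Subgroup.closure_le _).2 ?_)
      · obtain ⟨m, n, h⟩ := key g hg
        have h5 : (a, 0) ∈ translations (torusGroup a 0 w y) :=
          Subgroup.subset_closure (Or.inl rfl)
        have h6 : (w, y) ∈ translations (torusGroup a 0 w y) :=
          Subgroup.subset_closure (Or.inr rfl)
        refine h.mem_translations_iff.1 ?_
        convert add_mem (zsmul_mem h5 m) (zsmul_mem h6 n) using 1
        ext <;> simp
      · rintro _ (rfl | rfl)
        exacts [haG, hsG]
    rw [h1]
    exact .torus _ _ _ _ (by simpa using ⟨ha0, hy0⟩)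

/-- Conjugation with a linear map `M` takes an affine map with linear part `A` to an affine map
with linear part `A'`, where `A M = M A'`. -/
theorem IsAff.conj_linPerm {u v w z a' b' c' d' : ℝ} (hD : u * z - v * w ≠ 0)
    (hg : IsAff g a b c d e f) (h00 : a * u + b * v = u * a' + w * c')
    (h10 : c * u + d * v = v * a' + z * c') (h01 : a * w + b * z = u * b' + w * d')
    (h11 : c * w + d * z = v * b' + z * d') :
    IsAff ((linPerm u v w z hD)⁻¹ * g * linPerm u v w z hD) a' b' c' d'
      ((z * e - w * f) / (u * z - v * w)) ((u * f - v * e) / (u * z - v * w)) := fun p => by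
  have he : u * ((z * e - w * f) / (u * z - v * w)) + w * ((u * f - v * e) / (u * z - v * w)) =
      e := by
    obtain ⟨D, hD'⟩ : ∃ D, D = u * z - v * w := ⟨_, rfl⟩
    rw [← hD'] at hD ⊢
    field_simp
    rw [hD']; ring
  have hf : v * ((z * e - w * f) / (u * z - v * w)) + z * ((u * f - v * e) / (u * z - v * w)) =
      f := by
    obtain ⟨D, hD'⟩ : ∃ D, D = u * z - v * w := ⟨_, rfl⟩
    rw [← hD'] at hD ⊢
    field_simp
    rw [hD']; ring
  generalize (z * e - w * f) / (u * z - v * w) = e' at *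
  generalize (u * f - v * e) / (u * z - v * w) = f' at *
  rw [mul_assoc, Equiv.Perm.mul_apply, Equiv.Perm.inv_eq_iff_eq, Equiv.Perm.mul_apply, hg]
  simp only [linPerm_apply]
  ext i; fin_cases i
  · simp; linear_combination p 0 * h00 + p 1 * h01 - he
  · simp; linear_combination p 0 * h10 + p 1 * h11 - hf

/-- A similarity takes one of the translation vectors to `(1, 0)`. -/
theorem ActsProperly.isNormalizable_of_translations (hG : ActsProperly G)
    (ht : ∀ g ∈ G, ∃ c d, IsAff g 1 0 0 1 c d) : IsNormalizable G := by
  by_cases h : ∀ g ∈ G, g = 1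
  · obtain rfl := (Subgroup.eq_bot_iff_forall G).2 h
    exact IsNormalForm.bot.isNormalizable
  push Not at h
  obtain ⟨g, hg, hg1⟩ := h
  obtain ⟨u, v, h⟩ := ht g hg
  have huv : u * u + v * v ≠ 0 := fun h0 => by
    obtain rfl : u = 0 := by nlinarith [sq_nonneg u, sq_nonneg v]
    obtain rfl : v = 0 := by nlinarith [sq_nonneg v]
    exact hg1 (h.eq isAff_one)
  have hD : u * u - v * (-v) ≠ 0 := by simpa using huv
  have hmem := linPerm_mem hD
  refine (IsNormalForm.isNormalizable ?_).of_conjBy hmem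
  refine (hG.conjBy hmem).isNormalForm_of_horizontal (fun g' hg' => ?_) one_ne_zero ?_
  · obtain ⟨c, d, h2⟩ := ht _ hg'
    have h3 := h2.conj_linPerm hD (a' := 1) (b' := 0) (c' := 0) (d' := 1) (by ring) (by ring)
      (by ring) (by ring)
    refine ⟨(u * c - -v * d) / (u * u - v * -v), (u * d - v * c) / (u * u - v * -v), ?_⟩
    convert h3 using 1
    simp [mul_assoc]
  · have h3 := (h.conj_linPerm hD (a' := 1) (b' := 0) (c' := 0) (d' := 1) (by ring) (by ring)
      (by ring) (by ring)).mem_translations (conj_mem_conjBy hg)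
    have h4 : (u * u - -v * v) / (u * u - v * -v) = 1 := by
      rw [div_eq_one_iff_eq hD]; ring
    have h5 : (u * v - v * u) / (u * u - v * -v) = 0 := by
      rw [div_eq_zero_iff]; left; ring
    rwa [h4, h5] at h3

/-- If all elements have the form `(x, y) ↦ (x + c, ±y + d)` and `(x, y) ↦ (x + c, -y)` occurs, then
the translation vectors form a product lattice and `c` is half of a horizontal period. -/
theorem ActsProperly.isNormalForm_of_reflection (hG : ActsProperly G)
    (ht : ∀ g ∈ G, ∃ c d, IsAff g 1 0 0 1 c d ∨ IsAff g 1 0 0 (-1) c d) {r : Equiv.Perm Plane}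
    (hr : r ∈ G) {c : ℝ} (hrc : IsAff r 1 0 0 (-1) c 0) : IsNormalForm G := by
  have hc0 := hG.ne_zero_of_reflection hr hrc
  have h2c : 2 * c ∈ horizontals G := IsAff.mem_translations (g := r * r) (by
    simpa [two_mul] using hrc.mul hrc) (mul_mem hr hr)
  obtain ⟨x, hx⟩ := hG.exists_horizontals
  have h2c' := h2c
  rw [hx] at h2c'
  obtain ⟨m, hm⟩ := h2c'
  have hm : m * x = 2 * c := by simpa using hm
  have hxG : x ∈ horizontals G := hx ▸ AddSubgroup.mem_zmultiples x
  -- a glide reflection never has zero translation part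
  have hne : ∀ p ∈ translations G, c + p.1 ≠ 0 := fun p hp =>
    hG.ne_zero_of_reflection (mul_mem hr hp)
      (by simpa [add_comm] using hrc.mul (isAff_upperAff 0 1 p.1 p.2) : IsAff _ _ _ _ _ (c + p.1)
          (-p.2))
  have hH : ∀ n : ℤ, (n * x, (0 : ℝ)) ∈ translations G := fun n => by
    have : n • x ∈ horizontals G := zsmul_mem hxG n
    rwa [zsmul_eq_mul] at this
  have hodd : ∃ j : ℤ, m = 2 * j + 1 := by
    rcases Int.even_or_odd m with ⟨j, hj⟩ | h
    · refine absurd ?_ (hne _ (hH (-j)))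
      have : (m : ℝ) = j + j := by rw [hj]; push_cast; ring
      rw [this] at hm
      push_cast
      linarith
    · exact h
  obtain ⟨j, hj⟩ := hodd
  have hcx : c = x / 2 + j * x := by
    have : (m : ℝ) = 2 * j + 1 := by rw [hj]; push_cast; ring
    rw [this] at hm
    linarith
  have hx0 : x / 2 ≠ 0 := fun h0 => hc0 (by rw [hcx]; rw [div_eq_zero_iff] at h0; simp_all)
  have hprod : ∀ p ∈ translations G, p.1 ∈ horizontals G := fun p hp => by
    have h1 : (p.1, p.2) + (p.1, -p.2) ∈ translations G := by
      refine add_mem hp ?_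
      refine IsAff.mem_translations (g := r * upperAff 0 1 p.1 p.2 * r⁻¹) (fun z => ?_)
        (mul_mem (mul_mem hr hp) (inv_mem hr))
      obtain ⟨z, rfl⟩ := r.surjective z
      rw [Equiv.Perm.mul_apply, Equiv.Perm.mul_apply, Equiv.Perm.inv_def, r.symm_apply_apply, hrc,
          hrc,
        upperAff_apply]
      ext i; fin_cases i <;> simp <;> ring
    have h2 : p.1 + p.1 ∈ horizontals G := by
      have h3 : ((p.1, p.2) + (p.1, -p.2) : ℝ × ℝ) = (p.1 + p.1, 0) := by ext <;> simp
      rwa [h3] at h1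
    rw [hx] at h2
    obtain ⟨n, hn⟩ := h2
    have hn : n * x = p.1 + p.1 := by simpa using hn
    rcases Int.even_or_odd n with ⟨l, hl⟩ | ⟨l, hl⟩
    · have h4 : p.1 = l * x := by
        have : (n : ℝ) = l + l := by rw [hl]; push_cast; ring
        rw [this] at hn
        linarith
      rw [h4]
      exact hH l
    · refine absurd ?_ (hne _ (add_mem hp (hH (-(l + j + 1)))))
      have : (n : ℝ) = 2 * l + 1 := by rw [hl]; push_cast; ring
      rw [this] at hn
      push_cast
      simp only [Prod.fst_add]
      linarith
  have hvert : ∀ p ∈ translations G, (0, p.2) ∈ translations G := fun p hp => by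
    have h1 := sub_mem hp (hprod p hp)
    have h2 : p - (AddMonoidHom.inl ℝ ℝ) p.1 = (0, p.2) := by ext <;> simp
    rwa [h2] at h1
  obtain ⟨y, hy⟩ := hG.exists_heights (mul_ne_zero two_ne_zero hc0) h2c
  have hyG : (0, y) ∈ translations G := by
    have : y ∈ heights G := hy ▸ AddSubgroup.mem_zmultiples y
    obtain ⟨s, hs, k, w, hsw⟩ := mem_heights.1 this
    obtain ⟨w', y', h1 | h1⟩ := ht s hs
    · obtain ⟨-, rfl, -, -, rfl, rfl⟩ := hsw.unique h1
      exact hvert _ (hsw.mem_translations hs)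
    · have := (hsw.unique h1).2.2.2.1
      norm_num at this
  have hr' : upperAff 0 (-1) (x / 2) 0 ∈ G := by
    have h1 := mul_mem hr (hH (-j))
    rw [← IsAff.eq_upperAff (ε := -1) (g := r * upperAff 0 1 ((-j : ℤ) * x) 0)]
    · exact h1
    · have h2 := hrc.mul (isAff_upperAff 0 1 ((-j : ℤ) * x) 0)
      have h3 : -(j * x) + c = x / 2 := by rw [hcx]; ring
      simpa [h3] using h2
  have h1 : G = Subgroup.closure {upperAff 0 (-1) (x / 2) 0, upperAff 0 1 0 y} := by
    refine le_antisymm ?_ ((Subgroup.closure_le _).2 ?_)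
    · obtain ⟨H, hH'⟩ : ∃ H, H = Subgroup.closure {upperAff 0 (-1) (x / 2) 0, upperAff 0 1 0 y} :=
        ⟨_, rfl⟩
      rw [← hH']
      have hs : upperAff 0 (-1) (x / 2) 0 ∈ H := hH' ▸ Subgroup.subset_closure (Or.inl rfl)
      have hxH : (x, 0) ∈ translations H := IsAff.mem_translations (by
        simpa using (isAff_upperAff 0 (-1) (x / 2) 0).mul (isAff_upperAff 0 (-1) (x / 2) 0))
        (mul_mem hs hs)
      have hyH : (0, y) ∈ translations H := hH' ▸ Subgroup.subset_closure (Or.inr rfl)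
      have htr : ∀ g ∈ G, ∀ c d, IsAff g 1 0 0 1 c d → g ∈ H := fun g hg c d h => by
        have h2 := hprod _ (h.mem_translations hg)
        have h3 : d ∈ heights G := mem_heights.2 ⟨g, hg, 0, c, h⟩
        rw [hx] at h2
        rw [hy] at h3
        obtain ⟨m, hm⟩ := h2
        obtain ⟨n, hn⟩ := h3
        refine h.mem_translations_iff.1 ?_
        convert add_mem (zsmul_mem hxH m) (zsmul_mem hyH n) using 1
        ext
        · simpa using hm.symm
        · simpa using hn.symm
      intro g hg
      obtain ⟨c', d', h | h⟩ := ht g hg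
      · exact htr g hg _ _ h
      · have h4 := htr _ (mul_mem hr' hg) _ _
          (by simpa using (isAff_upperAff 0 (-1) (x / 2) 0).mul h : IsAff _ 1 0 0 1 (c' + x / 2)
              (-d'))
        exact (mul_mem_cancel_left hs).1 h4
    · rintro _ (rfl | rfl)
      exacts [hr', hyG]
  rw [h1]
  by_cases hy0 : y = 0
  · have h2 : upperAff 0 1 0 y = 1 := (isAff_upperAff 0 1 0 y).eq (by simpa [hy0] using isAff_one)
    rw [h2, Set.pair_comm, Subgroup.closure_insert_one]
    exact .cyclic (-1) _ hx0
  · have h2 : kleinGroup 0 y 0 (x / 2) =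
        Subgroup.closure {upperAff 0 (-1) (x / 2) 0, upperAff 0 1 0 y} := by
      simp [kleinGroup]
    rw [← h2]
    exact .klein _ _ hx0 hy0

end NormalForms

/-! ### Reduction of affine groups to normal form -/

section Reduction

variable {G : Subgroup (Equiv.Perm Plane)} {Ψ g : Equiv.Perm Plane} {a b c d e f : ℝ}

/-- A linear shear and a vertical shift remove the shear part of all orientation reversing elements
and the vertical translation part of one of them. -/
theorem ActsProperly.isNormalizable_of_not_shear (hG : ActsProperly G)
    (ht : ∀ g ∈ G, (∃ c d, IsAff g 1 0 0 1 c d) ∨ ∃ k c d, IsAff g 1 k 0 (-1) c d) :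
    IsNormalizable G := by
  by_cases h : ∀ g ∈ G, ∃ c d, IsAff g 1 0 0 1 c d
  · exact hG.isNormalizable_of_translations h
  push Not at h
  obtain ⟨r, hr, hr'⟩ := h
  obtain ⟨k₀, c₀, d₀, hrk⟩ := (ht r hr).resolve_left (by push Not; exact hr')
  have hk : ∀ g ∈ G, ∀ k c d, IsAff g 1 k 0 (-1) c d → k = k₀ := fun g hg k c d hgk => by
    have h1 := hrk.mul hgk
    rcases ht _ (mul_mem hr hg) with ⟨c', d', h2⟩ | ⟨k', c', d', h2⟩
    · have := (h1.unique h2).2.1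
      linarith
    · have := (h1.unique h2).2.2.2.1
      norm_num at this
  set Ψ := shearPerm 1 1 one_ne_zero one_ne_zero 0 (-k₀ / 2) * upperAff 0 1 0 (d₀ / 2) with hΨ
  have hΨz : ∀ z, Ψ z = !₂[z 0 - k₀ / 2 * (z 1 + d₀ / 2), z 1 + d₀ / 2] := fun z => by
    rw [hΨ, Equiv.Perm.mul_apply, shearPerm_apply, upperAff_apply]
    ext i; fin_cases i <;> simp
    ring
  have hmem : Ψ ∈ smoothPerms := mul_mem (shearPerm_mem _ _ _ _) (upperAff_mem_smoothPerms _ _ _ _)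
  have h1 : ∀ g g' : Equiv.Perm Plane, (∀ z, Ψ (g' z) = g (Ψ z)) → ∀ c d,
      IsAff g 1 0 0 1 c d → IsAff g' 1 0 0 1 (c + k₀ / 2 * d) d := fun g g' h c d hg z => by
    refine Ψ.injective ((h z).trans ?_)
    rw [hg, hΨz, hΨz]
    ext i; fin_cases i <;> simp <;> ring
  have h2 : ∀ g g' : Equiv.Perm Plane, (∀ z, Ψ (g' z) = g (Ψ z)) → ∀ c d,
      IsAff g 1 k₀ 0 (-1) c d → IsAff g' 1 0 0 (-1) (c + k₀ / 2 * d) (d - d₀) :=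
    fun g g' h c d hg z => by
      refine Ψ.injective ((h z).trans ?_)
      rw [hg, hΨz, hΨz]
      ext i; fin_cases i <;> simp <;> ring
  refine (IsNormalForm.isNormalizable ?_).of_conjBy hmem
  refine (hG.conjBy hmem).isNormalForm_of_reflection (c := c₀ + k₀ / 2 * d₀) (fun g' hg' => ?_)
    (conj_mem_conjBy hr) ?_
  · obtain ⟨g, hg, h⟩ := exists_of_mem_conjBy hg'
    rcases ht g hg with ⟨c, d, h3⟩ | ⟨k, c, d, h3⟩
    · exact ⟨_, _, Or.inl (h1 g g' h c d h3)⟩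
    · obtain rfl := hk g hg k c d h3
      exact ⟨_, _, Or.inr (h2 g g' h c d h3)⟩
  · have := h2 r (Ψ⁻¹ * r * Ψ) (fun z => by simp) c₀ d₀ hrk
    rwa [sub_self] at this

/-- In a free and proper group the shear parts of the maps `(x, y) ↦ (x + k y + c, y + d)` are
proportional to their vertical translation parts: commutators of such maps are horizontal
translations, and if there are nontrivial ones, then the vertical translation parts form a cyclic
group. -/
theorem ActsProperly.exists_slope (hG : ActsProperly G) :
    ∃ κ : ℝ, ∀ k d, (k, d) ∈ slopes G → k = κ * d := by
  have hzero : ∀ k, (k, 0) ∈ slopes G → k = 0 := by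
    rintro k ⟨g, hg, c, h⟩
    exact hG.eq_zero_of_fixed_height hg h
  have hcomm : ∀ k d k' d', (k, d) ∈ slopes G → (k', d') ∈ slopes G →
      k * d' - k' * d ∈ horizontals G := by
    rintro k d k' d' ⟨g, hg, c, h⟩ ⟨g', hg', c', h'⟩
    have h1 : upperAff 0 1 (k * d' - k' * d) 0 = g * g' * (g' * g)⁻¹ := by
      rw [eq_mul_inv_iff_mul_eq]
      refine ((isAff_upperAff _ _ _ _).mul (h'.mul h)).eq ?_
      convert h.mul h' using 1 <;> simp <;> ring
    rw [mem_horizontals, h1]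
    exact mul_mem (mul_mem hg hg') (inv_mem (mul_mem hg' hg))
  obtain ⟨x, hx⟩ := hG.exists_horizontals
  by_cases hx0 : x = 0
  · by_cases hd : ∃ k d, (k, d) ∈ slopes G ∧ d ≠ 0
    · obtain ⟨k₀, d₀, h0, hd0⟩ := hd
      refine ⟨k₀ / d₀, fun k d h => ?_⟩
      have h1 := hcomm _ _ _ _ h h0
      rw [hx, hx0] at h1
      have h2 : k * d₀ - k₀ * d = 0 := by simpa using h1
      field_simp
      linarith
    · push Not at hd
      refine ⟨0, fun k d h => ?_⟩
      obtain rfl := hd k d h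
      rw [hzero k h, zero_mul]
  · obtain ⟨y, hy⟩ := hG.exists_heights hx0 (hx ▸ AddSubgroup.mem_zmultiples x)
    have hyG : y ∈ heights G := hy ▸ AddSubgroup.mem_zmultiples y
    obtain ⟨⟨k₀, y'⟩, h0, rfl⟩ := hyG
    simp only [AddMonoidHom.coe_snd] at hy
    refine ⟨k₀ / y', fun k d h => ?_⟩
    have hd : d ∈ heights G := ⟨_, h, rfl⟩
    rw [hy] at hd
    obtain ⟨n, rfl⟩ := hd
    have h1 : (k, n • y') - n • (k₀, y') = (k - n * k₀, 0) := by ext <;> simp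
    have h2 := hzero _ (h1 ▸ sub_mem h (zsmul_mem h0 n))
    by_cases hy0 : y' = 0
    · subst hy0
      simp only [smul_zero, mul_zero]
      exact hzero k (by simpa using h)
    · simp only [zsmul_eq_mul]
      field_simp
      linarith

/-- The quadratic shear `(x, y) ↦ (x + κ y² / 2, y)` turns the orientation preserving elements into
translations. -/
theorem ActsProperly.isNormalizable_of_upper (hG : ActsProperly G)
    (ht : ∀ g ∈ G, ∃ k c d, IsAff g 1 k 0 1 c d ∨ IsAff g 1 k 0 (-1) c d) :
    IsNormalizable G := by
  obtain ⟨κ, hκ⟩ := hG.exists_slope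
  have hmem := shearPerm_mem one_ne_zero one_ne_zero (κ / 2) 0
  refine IsNormalizable.of_conjBy ?_ hmem
  refine (hG.conjBy hmem).isNormalizable_of_not_shear fun g' hg' => ?_
  obtain ⟨g, hg, h⟩ := exists_of_mem_conjBy hg'
  obtain ⟨k, c, d, h1 | h1⟩ := ht g hg
  · obtain rfl := hκ k d ⟨g, hg, c, h1⟩
    refine Or.inl ⟨c - κ / 2 * d ^ 2, d, fun z => Equiv.injective _ ((h z).trans ?_)⟩
    rw [h1, shearPerm_apply, shearPerm_apply]
    ext i; fin_cases i <;> simp; ring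
  · refine Or.inr ⟨k + κ * d, c - κ / 2 * d ^ 2, d, fun z => Equiv.injective _ ((h z).trans ?_)⟩
    rw [h1, shearPerm_apply, shearPerm_apply]
    ext i; fin_cases i <;> simp; ring

/-- A linear part without eigenvalue `1` would give a fixed point. -/
theorem ActsProperly.mul_eq_of_isAff (hG : ActsProperly G) (hg : g ∈ G)
    (h : IsAff g a b c d e f) : (a - 1) * (d - 1) = b * c := by
  by_contra hne
  have hΔ : (a - 1) * (d - 1) - b * c ≠ 0 := sub_ne_zero.2 hne
  obtain ⟨D, hD⟩ : ∃ D, D = (a - 1) * (d - 1) - b * c := ⟨_, rfl⟩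
  rw [← hD] at hΔ
  have h1 := hG.eq_one g hg !₂[(b * f - e * (d - 1)) / D, (c * e - f * (a - 1)) / D] (by
    rw [h]
    ext i; fin_cases i
    · simp; field_simp; rw [hD]; ring
    · simp; field_simp; rw [hD]; ring)
  subst h1
  obtain ⟨rfl, rfl, rfl, rfl, -, -⟩ := h.unique isAff_one
  simp at hne

/-- If `t` has linear part `(1 1; 0 1)`, then all linear parts have the form `(1 k; 0 ±1)`. A linear
part `(-1 k; 0 1)` is impossible, because the commutator with `t` would have a fixed point. -/
theorem ActsProperly.isNormalizable_of_unipotent (hG : ActsProperly G)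
    (ht : ∀ g ∈ G, ∃ a b c d e f, IsAff g a b c d e f ∧ (a * d - b * c = 1 ∨ a * d - b * c = -1))
    {t : Equiv.Perm Plane} (htG : t ∈ G) {e₀ f₀ : ℝ} (ht1 : IsAff t 1 1 0 1 e₀ f₀) :
    IsNormalizable G := by
  refine hG.isNormalizable_of_upper fun g hg => ?_
  obtain ⟨a, b, c, d, e, f, h, hdet⟩ := ht g hg
  have h1 := hG.mul_eq_of_isAff hg h
  have h2 := hG.mul_eq_of_isAff (mul_mem htG hg) (ht1.mul h)
  obtain rfl : c = 0 := by linarith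
  have ha : (a - 1) * (d - 1) = 0 := by linarith
  rcases mul_eq_zero.1 ha with h3 | h3
  · obtain rfl : a = 1 := by linarith
    rcases hdet with h4 | h4
    · obtain rfl : d = 1 := by linarith
      exact ⟨_, _, _, Or.inl h⟩
    · obtain rfl : d = -1 := by linarith
      exact ⟨_, _, _, Or.inr h⟩
  · obtain rfl : d = 1 := by linarith
    rcases hdet with h4 | h4
    · obtain rfl : a = 1 := by linarith
      exact ⟨_, _, _, Or.inl h⟩
    · obtain rfl : a = -1 := by linarith
      exfalso
      have h5 := ht1.mul h
      have h6 := h.mul ht1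
      have h7 := hG.eq_one ((g * t)⁻¹ * (t * g))
        (mul_mem (inv_mem (mul_mem hg htG)) (mul_mem htG hg)) !₂[0, (b * f₀ - f - 2 * e₀) / 2] (by
          rw [Equiv.Perm.mul_apply, Equiv.Perm.inv_eq_iff_eq, h5, h6]
          ext i; fin_cases i
          · simp; ring
          · simp; ring)
      rw [inv_mul_eq_one] at h7
      have h8 := (h6.unique (h7 ▸ h5)).2.1
      linarith

/-- A group of affine maps with determinants `±1` that acts freely and properly on the plane can be
brought to normal form by a change of coordinates. -/
theorem ActsProperly.isNormalizable (hG : ActsProperly G)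
    (ht : ∀ g ∈ G, ∃ a b c d e f, IsAff g a b c d e f ∧ (a * d - b * c = 1 ∨ a * d - b * c = -1)) :
    IsNormalizable G := by
  by_cases hu : ∀ g ∈ G, ∀ a b c d e f, IsAff g a b c d e f → a * d - b * c = 1 →
      a = 1 ∧ b = 0 ∧ c = 0 ∧ d = 1
  · by_cases h : ∀ g ∈ G, ∃ c d, IsAff g 1 0 0 1 c d
    · exact hG.isNormalizable_of_translations h
    push Not at h
    obtain ⟨r, hr, hr'⟩ := h
    obtain ⟨a, b, c, d, e, f, hra, hdet⟩ := ht r hr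
    have hdet' : a * d - b * c = -1 := hdet.resolve_left fun h1 => by
      obtain ⟨rfl, rfl, rfl, rfl⟩ := hu r hr _ _ _ _ _ _ hra h1
      exact hr' _ _ hra
    obtain rfl : d = -a := by linarith [hG.mul_eq_of_isAff hr hra]
    -- every element is a translation, or has the same linear part as `r`
    have hall : ∀ g ∈ G, ∃ e' f', IsAff g 1 0 0 1 e' f' ∨ IsAff g a b c (-a) e' f' := by
      intro g hg
      obtain ⟨a', b', c', d', e', f', h, hd | hd⟩ := ht g hg
      · obtain ⟨rfl, rfl, rfl, rfl⟩ := hu g hg _ _ _ _ _ _ h hd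
        exact ⟨_, _, Or.inl h⟩
      · obtain ⟨h1, h2, h3, h4⟩ := hu _ (mul_mem hr hg) _ _ _ _ _ _ (hra.mul h) (by
          linear_combination (a' * d' - b' * c') * hdet' - hd)
        have ha' : a' = a := by linear_combination a * h1 + b * h3 - a' * (-hdet')
        have hb' : b' = b := by linear_combination a * h2 + b * h4 - b' * (-hdet')
        have hc' : c' = c := by linear_combination c * h1 - a * h3 - c' * (-hdet')
        have hd' : d' = -a := by linear_combination c * h2 - a * h4 - d' * (-hdet')
        subst ha' hb' hc' hd'
        exact ⟨_, _, Or.inr h⟩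
    -- a basis of eigenvectors of the linear part of `r`
    obtain ⟨u, v, w, z, hD, h1, h2, h3, h4⟩ : ∃ u v w z : ℝ, u * z - v * w ≠ 0 ∧
        a * u + b * v = u ∧ c * u + -a * v = v ∧ a * w + b * z = -w ∧ c * w + -a * z = -z := by
      by_cases hc : c = 0
      · by_cases hb : b = 0
        · subst hc hb
          have ha : (a - 1) * (a + 1) = 0 := by linarith
          rcases mul_eq_zero.1 ha with h1 | h1
          · obtain rfl : a = 1 := by linarith
            exact ⟨1, 0, 0, 1, by norm_num, by norm_num, by norm_num, by norm_num, by norm_num⟩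
          · obtain rfl : a = -1 := by linarith
            exact ⟨0, 1, 1, 0, by norm_num, by norm_num, by norm_num, by norm_num, by norm_num⟩
        · refine ⟨b, 1 - a, -b, a + 1, ?_, by ring, ?_, by ring, ?_⟩
          · intro h0
            exact hb (by linarith)
          · linarith
          · linarith
      · refine ⟨a + 1, c, 1 - a, -c, ?_, ?_, by ring, ?_, by ring⟩
        · intro h0
          exact hc (by linarith)
        · linarith
        · linarith
    have hmem := linPerm_mem hD
    refine IsNormalizable.of_conjBy ?_ hmem
    refine (hG.conjBy hmem).isNormalizable_of_upper fun g' hg' => ?_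
    have hg2 : (linPerm u v w z hD)⁻¹ * (linPerm u v w z hD * g' * (linPerm u v w z hD)⁻¹) *
        linPerm u v w z hD = g' := by group
    obtain ⟨e', f', h5 | h5⟩ := hall _ (mem_conjBy.1 hg')
    · have h6 := h5.conj_linPerm hD (a' := 1) (b' := 0) (c' := 0) (d' := 1) (by ring) (by ring)
        (by ring) (by ring)
      rw [hg2] at h6
      exact ⟨_, _, _, Or.inl h6⟩
    · have h6 := h5.conj_linPerm hD (a' := 1) (b' := 0) (c' := 0) (d' := -1) (by linarith)
        (by linarith) (by linarith) (by linarith)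
      rw [hg2] at h6
      exact ⟨_, _, _, Or.inr h6⟩
  · push Not at hu
    obtain ⟨t, htG, a, b, c, d, e, f, h, hdet, hne⟩ := hu
    have hE := hG.mul_eq_of_isAff htG h
    obtain rfl : d = 2 - a := by linarith
    -- a basis in which the linear part of `t` is `(1 1; 0 1)`
    obtain ⟨u, v, w, z, hD, h1, h2, h3, h4⟩ : ∃ u v w z : ℝ, u * z - v * w ≠ 0 ∧
        a * u + b * v = u ∧ c * u + (2 - a) * v = v ∧ a * w + b * z = u + w ∧
        c * w + (2 - a) * z = v + z := by
      by_cases hb : b = 0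
      · subst hb
        obtain rfl : a = 1 := by nlinarith [sq_nonneg (a - 1)]
        have hc : c ≠ 0 := fun hc => hne rfl rfl hc (by norm_num)
        exact ⟨0, c, 1, 0, by simpa using hc, by ring, by ring, by ring, by ring⟩
      · exact ⟨b, 1 - a, 0, 1, by simpa using hb, by ring, by linarith, by ring, by ring⟩
    have hmem := linPerm_mem hD
    refine IsNormalizable.of_conjBy ?_ hmem
    refine (hG.conjBy hmem).isNormalizable_of_unipotent (fun g' hg' => ?_) (conj_mem_conjBy htG)
      (h.conj_linPerm hD (a' := 1) (b' := 1) (c' := 0) (d' := 1) (by linarith) (by linarith)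
        (by linarith) (by linarith))
    have hg2 : (linPerm u v w z hD)⁻¹ * (linPerm u v w z hD * g' * (linPerm u v w z hD)⁻¹) *
        linPerm u v w z hD = g' := by group
    obtain ⟨a', b', c', d', e', f', h5, h6⟩ := ht _ (mem_conjBy.1 hg')
    clear h1 h2 h3 h4 hmem hE hne hdet h
    obtain ⟨D, hDD⟩ : ∃ D, D = u * z - v * w := ⟨_, rfl⟩
    have hD' : D ≠ 0 := hDD ▸ hD
    have h7 := h5.conj_linPerm hD
      (a' := (z * (a' * u + b' * v) - w * (c' * u + d' * v)) / D)
      (c' := (u * (c' * u + d' * v) - v * (a' * u + b' * v)) / D)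
      (b' := (z * (a' * w + b' * z) - w * (c' * w + d' * z)) / D)
      (d' := (u * (c' * w + d' * z) - v * (a' * w + b' * z)) / D)
      (by field_simp; rw [hDD]; ring) (by field_simp; rw [hDD]; ring)
      (by field_simp; rw [hDD]; ring) (by field_simp; rw [hDD]; ring)
    rw [hg2] at h7
    refine ⟨_, _, _, _, _, _, h7, ?_⟩
    have h8 : (z * (a' * u + b' * v) - w * (c' * u + d' * v)) / D *
        ((u * (c' * w + d' * z) - v * (a' * w + b' * z)) / D) -
        (z * (a' * w + b' * z) - w * (c' * w + d' * z)) / D *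
        ((u * (c' * u + d' * v) - v * (a' * u + b' * v)) / D) = a' * d' - b' * c' := by
      field_simp; rw [hDD]; ring
    rwa [h8]

end Reduction

/-! ### Quotients homeomorphic to the torus and to the Klein bottle -/

section Homeomorphisms

/-- Quotients of one space by the same equivalence relation are homeomorphic. -/
theorem nonempty_homeomorph_of_fibers {X Y Z : Type*} [TopologicalSpace X] [TopologicalSpace Y]
    [TopologicalSpace Z] {f : X → Y} {g : X → Z} (hf : Topology.IsQuotientMap f)
    (hg : Topology.IsQuotientMap g) (h : ∀ x x', f x = f x' ↔ g x = g x') : Nonempty (Y ≃ₜ Z) := by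
  have hker : Setoid.ker f = Setoid.ker g := Setoid.ext h
  have e : Quotient (Setoid.ker g) ≃ₜ Z :=
    Topology.IsQuotientMap.homeomorph (f := ⟨g, hg.continuous⟩) hg
  rw [← hker] at e
  exact ⟨(Topology.IsQuotientMap.homeomorph (f := ⟨f, hf.continuous⟩) hf).symm.trans e⟩

variable {B : Type*} [TopologicalSpace B] [ChartedSpace Plane B]

theorem exists_mem_stdTorusGroup_iff (z z' : Plane) :
    (∃ g ∈ stdTorusGroup, g z = z') ↔ ∃ m n : ℤ, z' = !₂[z 0 + m, z 1 + n] := by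
  constructor
  · rintro ⟨g, hg, rfl⟩
    have h1 : ∃ m n : ℤ, IsAff g 1 0 0 1 m n := by
      induction hg using Subgroup.closure_induction with
      | mem g hg =>
        rcases hg with rfl | rfl
        · exact ⟨1, 0, by simpa using isAff_upperAff 0 1 1 0⟩
        · exact ⟨0, 1, by simpa using isAff_upperAff 0 1 0 1⟩
      | one => exact ⟨0, 0, by simpa using isAff_one⟩
      | mul g g' _ _ h h' =>
        obtain ⟨m, n, h⟩ := h
        obtain ⟨m', n', h'⟩ := h'
        exact ⟨m' + m, n' + n, by simpa using h.mul h'⟩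
      | inv g _ h =>
        obtain ⟨m, n, h⟩ := h
        refine ⟨-m, -n, fun z => ?_⟩
        rw [Equiv.Perm.inv_eq_iff_eq, h]
        ext i; fin_cases i <;> simp
    obtain ⟨m, n, h⟩ := h1
    exact ⟨m, n, by rw [h]; simp⟩
  · rintro ⟨m, n, rfl⟩
    have h1 : ((1 : ℝ), (0 : ℝ)) ∈ translations stdTorusGroup :=
        Subgroup.subset_closure (Or.inl rfl)
    have h2 : ((0 : ℝ), (1 : ℝ)) ∈ translations stdTorusGroup :=
        Subgroup.subset_closure (Or.inr rfl)
    have h3 := add_mem (zsmul_mem h1 m) (zsmul_mem h2 n)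
    exact ⟨_, h3, by rw [upperAff_apply]; simp⟩

theorem IsQuotientBy.isQuotientMap {G : Subgroup (Equiv.Perm Plane)} {q : Plane → B}
    (hq : IsQuotientBy G q) : Topology.IsQuotientMap q :=
  hq.isCoveringMap.isQuotientMap hq.surjective

/-- Both spaces are quotients of the plane by the same equivalence relation. -/
theorem IsQuotientBy.nonempty_homeomorph_torus {q : Plane → B} (hq : IsQuotientBy stdTorusGroup q) :
    Nonempty (B ≃ₜ Torus) := by
  let p : Plane → AddCircle (1 : ℝ) × AddCircle (1 : ℝ) := fun z => (z 0, z 1)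
  have hc : Continuous p := by
    refine Continuous.prodMk ?_ ?_
    · exact (AddCircle.continuous_mk' (1 : ℝ)).comp (by fun_prop)
    · exact (AddCircle.continuous_mk' (1 : ℝ)).comp (by fun_prop)
  have hs : Function.Surjective p := by
    rintro ⟨a, b⟩
    obtain ⟨a, rfl⟩ := QuotientAddGroup.mk_surjective a
    obtain ⟨b, rfl⟩ := QuotientAddGroup.mk_surjective b
    exact ⟨!₂[a, b], rfl⟩
  have ho : IsOpenMap p := by
    have h1 : IsOpenMap (Prod.map (QuotientAddGroup.mk : ℝ → AddCircle (1 : ℝ))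
        (QuotientAddGroup.mk : ℝ → AddCircle (1 : ℝ))) :=
      QuotientAddGroup.isOpenMap_coe.prodMap QuotientAddGroup.isOpenMap_coe
    let e : Plane ≃ₜ ℝ × ℝ :=
      { toFun := fun z => (z 0, z 1)
        invFun := fun p => !₂[p.1, p.2]
        left_inv := fun z => mk_coord z
        right_inv := fun p => rfl
        continuous_toFun := by fun_prop
        continuous_invFun := by fun_prop }
    exact h1.comp e.isOpenMap
  have hcoe : ∀ a b : ℝ, (a : AddCircle (1 : ℝ)) = b ↔ ∃ m : ℤ, b = a + m := fun a b => by
    rw [eq_comm, ← sub_eq_zero, ← AddCircle.coe_sub, AddCircle.coe_eq_zero_iff]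
    refine exists_congr fun m => ?_
    rw [zsmul_eq_mul, mul_one]
    constructor <;> intro h <;> linarith
  have h := nonempty_homeomorph_of_fibers hq.isQuotientMap (ho.isQuotientMap hc hs) fun z z' => by
    rw [hq.fibers, exists_mem_stdTorusGroup_iff, Prod.ext_iff, hcoe, hcoe]
    constructor
    · rintro ⟨m, n, rfl⟩
      exact ⟨⟨m, rfl⟩, ⟨n, rfl⟩⟩
    · rintro ⟨⟨m, hm⟩, ⟨n, hn⟩⟩
      refine ⟨m, n, ?_⟩
      rw [← hm, ← hn, mk_coord]
  have e := AddCircle.homeomorphCircle (one_ne_zero (α := ℝ))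
  exact h.map fun f => f.trans (e.prodCongr e)

/-- Both spaces are quotients of the plane by the same equivalence relation. -/
theorem IsQuotientBy.nonempty_homeomorph_klein {q : Plane → B} (hq : IsQuotientBy stdKleinGroup q) :
    Nonempty (B ≃ₜ KleinBottle) := by
  refine nonempty_homeomorph_of_fibers (g := (Quotient.mk _ : Plane → KleinBottle))
    hq.isQuotientMap isQuotientMap_quotient_mk' fun z z' => ?_
  rw [hq.fibers, eq_comm (a := Quotient.mk _ z), Quotient.eq]
  constructor
  · rintro ⟨g, hg, rfl⟩
    exact ⟨⟨g, hg⟩, rfl⟩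
  · rintro ⟨⟨g, hg⟩, h⟩
    exact ⟨g, hg, h⟩

end Homeomorphisms

/-! ### Deck transformations -/

section Deck

variable {B : Type*} [TopologicalSpace B] {q : C(Plane, B)}

/-- The group of the homeomorphisms of the plane over `B`. -/
def deckGroup (q : C(Plane, B)) : Subgroup (Equiv.Perm Plane) where
  carrier := {g | Continuous g ∧ Continuous g.symm ∧ ∀ z, q (g z) = q z}
  mul_mem' := fun ⟨h1, h2, h3⟩ ⟨h1', h2', h3'⟩ =>
    ⟨h1.comp h1', h2'.comp h2, fun z => (h3 _).trans (h3' z)⟩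
  one_mem' := ⟨continuous_id, continuous_id, fun _ => rfl⟩
  inv_mem' := fun {g} h => ⟨h.2.1, h.1, fun z => by
    rw [← h.2.2 (g⁻¹ z)]
    exact congrArg q (g.apply_symm_apply z)⟩

/-- The deck group acts transitively on the fibres, since the plane is simply connected. -/
theorem exists_mem_deckGroup (hq : IsCoveringMap q) {z z' : Plane} (h : q z = q z') :
    ∃ g ∈ deckGroup q, g z = z' := by
  obtain ⟨f, ⟨hf0, hf⟩, -⟩ := hq.existsUnique_continuousMap_lifts q z z' h.symm
  obtain ⟨f', ⟨hf0', hf'⟩, -⟩ := hq.existsUnique_continuousMap_lifts q z' z h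
  have h1 : f' ∘ f = id := hq.eq_of_comp_eq (f'.continuous.comp f.continuous) continuous_id (by
    rw [← Function.comp_assoc, hf', hf]; rfl) z (by simp [hf0, hf0'])
  have h2 : f ∘ f' = id := hq.eq_of_comp_eq (f.continuous.comp f'.continuous) continuous_id (by
    rw [← Function.comp_assoc, hf, hf']; rfl) z' (by simp [hf0, hf0'])
  exact ⟨⟨f, f', congrFun h1, congrFun h2⟩, ⟨f.continuous, f'.continuous, congrFun hf⟩, hf0⟩

/-- A deck transformation with a fixed point is the identity, by uniqueness of lifts. -/
theorem deckGroup_eq_one (hq : IsCoveringMap q) {g : Equiv.Perm Plane} (hg : g ∈ deckGroup q)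
    {z : Plane} (hz : g z = z) : g = 1 :=
  DFunLike.coe_injective (hq.eq_of_comp_eq hg.1 continuous_id (funext hg.2.2) z hz)

theorem actsProperly_deckGroup [T2Space B] (hq : IsCoveringMap q) : ActsProperly (deckGroup q) := by
  refine ⟨fun g hg z hz => deckGroup_eq_one hq hg hz, fun z K hK => ?_⟩
  have h1 : (K ∩ q ⁻¹' {q z}).Finite := by
    refine (hK.inter_right (isClosed_singleton.preimage q.continuous)).finite ?_
    have h2 : IsDiscrete (q ⁻¹' {q z}) :=
      isDiscrete_iff_discreteTopology.2 ((hq (q z)).1)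
    exact h2.mono inter_subset_right
  refine Set.Finite.of_finite_image (f := fun g : Equiv.Perm Plane => g z) (h1.subset ?_) ?_
  · rintro _ ⟨g, ⟨hg, hgK⟩, rfl⟩
    exact ⟨hgK, hg.2.2 z⟩
  · intro g hg g' hg' h
    have h2 := deckGroup_eq_one hq (mul_mem (inv_mem hg'.1) hg.1) (z := z) (by
      rw [Equiv.Perm.mul_apply, Equiv.Perm.inv_eq_iff_eq]
      exact h)
    exact (inv_mul_eq_one.1 h2).symm

variable [ChartedSpace Plane B] {P : CotangentLattice B}

theorem contDiff_of_comp_eq (hq : IsLocalDiffeomorph 𝓘(ℝ, Plane) 𝓘(ℝ, Plane) ∞ q)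
    {g : Plane → Plane} (hg : Continuous g) (h : ∀ z, q (g z) = q z) : ContDiff ℝ ∞ g := by
  refine contDiff_iff_contDiffAt.2 fun z => ?_
  have hl := (hq (g z)).localInverse_contMDiffAt
  rw [h z] at hl
  have h1 := contMDiffAt_iff_contDiffAt.1 (hl.comp z hq.contMDiff.contMDiffAt)
  refine h1.congr_of_eventuallyEq ?_
  filter_upwards [hg.continuousAt.eventually (hq (g z)).localInverse_eventuallyEq_left] with w hw
  have h2 : (hq (g z)).localInverse (q (g w)) = g w := hw
  rw [← h2, h w]
  rfl

theorem IsLatticeCover.deckGroup_le (hq : IsLatticeCover P q) : deckGroup q ≤ smoothPerms :=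
  fun _ hg => ⟨contDiff_of_comp_eq hq.isLocalDiffeomorph hg.1 hg.2.2,
    contDiff_of_comp_eq hq.isLocalDiffeomorph hg.2.1 ((deckGroup q).inv_mem hg).2.2⟩

theorem IsLatticeCover.isQuotientBy (hq : IsLatticeCover P q) : IsQuotientBy (deckGroup q) q :=
  ⟨hq.isCoveringMap, hq.surjective, hq.isLocalDiffeomorph, fun z _ =>
    ⟨exists_mem_deckGroup hq.isCoveringMap, fun ⟨_, hg, h⟩ => h ▸ (hg.2.2 z).symm⟩⟩

/-- The linear part of a deck transformation does not depend on the point, since the lattice is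
discrete. -/
theorem IsLatticeCover.exists_covec_comp_fderiv (hq : IsLatticeCover P q) {g : Equiv.Perm Plane}
    (hg : g ∈ deckGroup q) (p : ℤ × ℤ) :
    ∃ p', ∀ z, (covec p).comp (fderiv ℝ g z) = covec p' := by
  have hmem : ∀ z, (covec p).comp (fderiv ℝ g z) ∈ stdLattice := fun z =>
    hq.comp_fderiv_mem (hq.deckGroup_le hg) hg.2.2 (mem_stdLattice.2 ⟨p, rfl⟩)
  have hloc : IsLocallyConstant fun z => (covec p).comp (fderiv ℝ g z) := by
    refine (IsLocallyConstant.iff_eventually_eq _).2 fun z => ?_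
    refine eventually_eq_of_mem_stdLattice ?_ (Eventually.of_forall hmem)
    have h1 : Continuous (fderiv ℝ g) := (hq.deckGroup_le hg).1.continuous_fderiv (by simp)
    exact (continuous_const.clm_comp h1).continuousAt
  obtain ⟨p', hp'⟩ := mem_stdLattice.1 (hmem 0)
  exact ⟨p', fun z => by
    rw [hp']
    exact hloc.apply_eq_of_isPreconnected isPreconnected_univ trivial trivial⟩

theorem fderiv_symm_comp_fderiv {g : Equiv.Perm Plane} (hg : g ∈ smoothPerms) (z : Plane) :
    (fderiv ℝ g.symm (g z)).comp (fderiv ℝ g z) = ContinuousLinearMap.id ℝ Plane := by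
  rw [← fderiv_comp z (hg.2.differentiable (by simp) _) (hg.1.differentiable (by simp) _),
    Equiv.symm_comp_self, fderiv_id]

theorem IsLatticeCover.exists_isTwist (hq : IsLatticeCover P q) {t : Plane ≃ₜ Plane}
    (ht : t.toEquiv ∈ deckGroup q) : ∃ τ, IsTwist t τ := by
  choose σ hσ using fun p => hq.exists_covec_comp_fderiv ht p
  choose τ hτ using fun p => hq.exists_covec_comp_fderiv ((deckGroup q).inv_mem ht) p
  have hsm := hq.deckGroup_le ht
  have h1 : ∀ p z, (covec (τ p)).comp (fderiv ℝ t z) = covec p := fun p z => by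
    rw [← hτ p (t z), ContinuousLinearMap.comp_assoc]
    exact (congrArg (fun L => (covec p).comp L) (fderiv_symm_comp_fderiv hsm z)).trans
      (ContinuousLinearMap.comp_id _)
  have h2 : ∀ p z, (covec (σ p)).comp (fderiv ℝ t.symm z) = covec p := fun p z => by
    rw [← hσ p (t.symm z), ContinuousLinearMap.comp_assoc]
    exact (congrArg (fun L => (covec p).comp L)
      (fderiv_symm_comp_fderiv (smoothPerms.inv_mem hsm) z)).trans (ContinuousLinearMap.comp_id _)
  refine ⟨⟨⟨τ, σ, fun p => ?_, fun p => ?_⟩, fun p p' => ?_⟩, hsm, h1⟩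
  · exact covec_injective ((hσ _ 0).symm.trans (h1 p 0))
  · exact covec_injective ((hτ _ 0).symm.trans (h2 p 0))
  · refine covec_injective ?_
    change covec (τ (p + p')) = covec (τ p + τ p')
    rw [map_add, ← hτ p 0, ← hτ p' 0, ← hτ _ 0, map_add, ContinuousLinearMap.add_comp]

theorem IsLatticeCover.exists_isAff_int (hq : IsLatticeCover P q) {g : Equiv.Perm Plane}
    (hg : g ∈ deckGroup q) : ∃ (a b c d : ℤ) (e f : ℝ), IsAff g a b c d e f := by
  have key : ∀ p, ∃ p' : ℤ × ℤ, ∃ r, ∀ z, covec p (g z) = covec p' z + r := fun p => by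
    obtain ⟨p', hp'⟩ := hq.exists_covec_comp_fderiv hg p
    have hsm := (hq.deckGroup_le hg).1
    have hd : ∀ z, HasFDerivAt (fun z => covec p (g z) - covec p' z) (0 : Plane →L[ℝ] ℝ) z :=
        fun z => by
      have h1 := (covec p).hasFDerivAt.comp z (hsm.differentiable (by simp) z).hasFDerivAt
      have h2 := h1.sub (covec p').hasFDerivAt
      rw [hp' z, sub_self] at h2
      exact h2
    refine ⟨p', covec p (g 0) - covec p' 0, fun z => ?_⟩
    have h3 := is_const_of_fderiv_eq_zero (𝕜 := ℝ) (fun z => (hd z).differentiableAt)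
      (fun z => (hd z).fderiv) z 0
    linarith
  obtain ⟨⟨a, b⟩, e, h0⟩ := key (1, 0)
  obtain ⟨⟨c, d⟩, f, h1⟩ := key (0, 1)
  refine ⟨a, b, c, d, e, f, fun z => ?_⟩
  have h0 := h0 z
  have h1 := h1 z
  simp [covec_apply] at h0 h1
  ext i; fin_cases i <;> simp [h0, h1]

theorem IsLatticeCover.exists_isAff (hq : IsLatticeCover P q) {g : Equiv.Perm Plane}
    (hg : g ∈ deckGroup q) : ∃ a b c d e f : ℝ, IsAff g a b c d e f ∧
      (a * d - b * c = 1 ∨ a * d - b * c = -1) := by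
  obtain ⟨a, b, c, d, e, f, h⟩ := hq.exists_isAff_int hg
  obtain ⟨a', b', c', d', e', f', h'⟩ := hq.exists_isAff_int (inv_mem hg)
  refine ⟨a, b, c, d, e, f, h, ?_⟩
  have h1 := h.mul h'
  rw [mul_inv_cancel] at h1
  obtain ⟨h2, h3, h4, h5, -, -⟩ := h1.unique isAff_one
  norm_cast at h2 h3 h4 h5
  have h6 : (a * d - b * c) * (a' * d' - b' * c') = 1 := by
    linear_combination (a * b' + b * d') * (-h4) + h2 * (c * b' + d * d') + h5
  have h7 := Int.isUnit_iff.1 (IsUnit.of_mul_eq_one _ h6)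
  rcases h7 with h7 | h7
  · left; exact_mod_cast h7
  · right; exact_mod_cast h7

end Deck

/-! ### Complete lattices -/

section Complete

variable {B : Type*} [TopologicalSpace B] [ChartedSpace Plane B]
  {P : CotangentLattice B} {q : C(Plane, B)}

/-- The inverse of the developing map of a complete lattice, composed with the universal covering,
presents the surface as a quotient of the plane. -/
theorem CotangentLattice.IsComplete.exists_isLatticeCover (h : P.IsComplete) :
    ∃ q : C(Plane, B), IsLatticeCover P q := by
  obtain ⟨-, U, _, _, _, _, p, f, hp, hsurj, hloc, hlat⟩ := h
  refine ⟨⟨p ∘ f.symm, hp.continuous.comp f.symm.continuous⟩,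
    hp.comp_homeomorph f.symm.toHomeomorph, hsurj.comp f.symm.surjective, fun z => ?_, fun z => ?_⟩
  · exact IsLocalDiffeomorphAt.comp (K := 𝓘(ℝ, Plane)) (P := B)
      (f.symm.isLocalDiffeomorph z) (hloc (f.symm z))
  · have hs := f.symm.contMDiff.mdifferentiable (by simp) z
    have hA : ∀ v : Plane, mfderiv 𝓘(ℝ, Plane) 𝓘(ℝ, Plane) (p ∘ f.symm) z v =
        mfderiv 𝓘(ℝ, Plane) 𝓘(ℝ, Plane) p (f.symm z) (mfderiv 𝓘(ℝ, Plane) 𝓘(ℝ, Plane) f.symm z v) :=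
      fun v => mfderiv_comp_apply z (hloc.mdifferentiable (by simp) (f.symm z)) hs v
    have hB : ∀ v : Plane, mfderiv 𝓘(ℝ, Plane) 𝓘(ℝ, Plane) f (f.symm z)
        (mfderiv 𝓘(ℝ, Plane) 𝓘(ℝ, Plane) f.symm z v) = v := fun v => by
      have h1 := mfderiv_comp_apply z (f.contMDiff.mdifferentiable (by simp) (f.symm z)) hs v
      have h2 : (f : U → Plane) ∘ f.symm = id := funext f.apply_symm_apply
      rw [h2, mfderiv_id] at h1
      exact h1.symm
    have key : ∀ (α : Cotangent (p (f.symm z))) (ℓ : Plane →L[ℝ] ℝ),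
        codiff p (f.symm z) α = codiff f (f.symm z) ℓ → codiff (p ∘ f.symm) z α = ℓ := by
      intro α ℓ h
      refine ContinuousLinearMap.ext fun v => ?_
      have h1 := congrArg (fun L : Plane →L[ℝ] ℝ => L
          (mfderiv 𝓘(ℝ, Plane) 𝓘(ℝ, Plane) f.symm z v)) h
      have h2 : (α : Plane →L[ℝ] ℝ) (mfderiv 𝓘(ℝ, Plane) 𝓘(ℝ, Plane) (p ∘ f.symm) z v) = ℓ v :=
        (congrArg (α : Plane →L[ℝ] ℝ) (hA v)).trans (h1.trans (congrArg ℓ (hB v)))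
      exact h2
    ext ℓ
    constructor
    · intro hℓ
      have h1 : codiff f (f.symm z) ℓ ∈ (P.fiber (p (f.symm z))).map (codiff p (f.symm z)) := by
        rw [← hlat]
        exact ⟨ℓ, hℓ, rfl⟩
      obtain ⟨α, hα, h⟩ := h1
      exact ⟨α, hα, key α ℓ h⟩
    · rintro ⟨α, hα, rfl⟩
      have h1 : codiff p (f.symm z) α ∈ stdLattice.map (codiff f (f.symm z)) := by
        rw [hlat]
        exact ⟨α, hα, rfl⟩
      obtain ⟨ℓ, hℓ, h⟩ := h1
      exact (key α ℓ h.symm).symm ▸ hℓ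

variable [IsManifold 𝓘(ℝ, Plane) ∞ B]

/-- If the deck group becomes `⟨(x, y) ↦ (x + c, ±y)⟩` in the coordinates `Ψ`, then the first of
these coordinates, divided by `c`, is a height function for the generator. -/
theorem IsLatticeCover.subsingleton_latticeH2_of_cyclic (hq : IsLatticeCover P q)
    {Ψ : Equiv.Perm Plane} {ε : ℤˣ} {c : ℝ} (hc : c ≠ 0)
    (h : Subgroup.closure {upperAff 0 ε c 0} = conjBy Ψ (deckGroup q)) :
    Subsingleton (LatticeH2 P) := by
  have hG : Subgroup.closure {Ψ * upperAff 0 ε c 0 * Ψ⁻¹} = deckGroup q := by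
    rw [← map_conjBy (Ψ := Ψ) (G := deckGroup q), ← h, MonoidHom.map_closure, Set.image_singleton]
    rfl
  have ht : Ψ * upperAff 0 ε c 0 * Ψ⁻¹ ∈ deckGroup q := hG ▸ Subgroup.subset_closure rfl
  let t : Plane ≃ₜ Plane := ⟨Ψ * upperAff 0 ε c 0 * Ψ⁻¹, ht.1, ht.2.1⟩
  obtain ⟨τ, hτ⟩ := hq.exists_isTwist (t := t) ht
  refine hq.subsingleton_latticeH2 hτ (i := fun z => ⌊(Ψ.symm z) 0 / c⌋) (fun z => ?_) ?_
  · have h1 : Ψ.symm (t z) = upperAff 0 ε c 0 (Ψ.symm z) := Ψ.symm_apply_apply _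
    rw [h1, ← floor_div_add _ hc, upperAff_apply]
    simp
  · have h1 : Subgroup.closure {t.toEquiv} = deckGroup q := hG
    rw [h1]
    exact hq.isQuotientBy.fibers

/-- On a surface with a complete lattice, other than the torus and the Klein bottle, both
cohomology groups vanish. -/
theorem IsLatticeCover.subsingleton_of_not_torus_of_not_klein [T2Space B]
    (hq : IsLatticeCover P q)
    (hT : IsEmpty (B ≃ₜ Torus)) (hK : IsEmpty (B ≃ₜ KleinBottle)) :
    Subsingleton (LatticeH2 P) ∧ Subsingleton (DeRhamH2 B) := by
  obtain ⟨Ψ, hΨ, hN⟩ := (actsProperly_deckGroup hq.isCoveringMap).isNormalizable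
    fun _ => hq.exists_isAff
  have hQ : IsQuotientBy (conjBy Ψ (deckGroup q)) (q ∘ Ψ) :=
    hq.isQuotientBy.comp_perm hΨ map_conjBy.symm
  obtain ⟨H, hH⟩ : ∃ H, H = conjBy Ψ (deckGroup q) := ⟨_, rfl⟩
  rw [← hH] at hN hQ
  cases hN with
  | bot =>
    refine ⟨hq.subsingleton_latticeH2_of_injective fun z z' h => ?_, ?_⟩
    · obtain ⟨g, hg, h1⟩ := (hQ.fibers (Ψ.symm z) (Ψ.symm z')).1 (by simpa using h)
      rw [Subgroup.mem_bot.1 hg] at h1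
      exact Ψ.symm.injective h1
    · rw [← Subgroup.closure_empty] at hQ
      exact hQ.subsingleton_deRhamH2_of_horizontal fun g hg => absurd hg (notMem_empty g)
  | cyclic ε c hc =>
    refine ⟨hq.subsingleton_latticeH2_of_cyclic hc hH,
      hQ.subsingleton_deRhamH2_of_horizontal ?_⟩
    rintro _ rfl
    exact ⟨ε, c, rfl⟩
  | torus u v w z h =>
    obtain ⟨e⟩ := (hQ.torus h).nonempty_homeomorph_torus
    exact hT.elim e
  | klein x y hx hy =>
    obtain ⟨e⟩ := (hQ.klein hy hx).nonempty_homeomorph_klein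
    exact hK.elim e

end Complete

/-! ### Vanishing de Rham cohomology -/

section Vanishing

variable {B : Type*} [TopologicalSpace B] [ChartedSpace Plane B] {P : CotangentLattice B}

theorem latticedH2_eq_bot [Subsingleton (DeRhamH2 B)] :
    latticedH2 P = ⊥ ∧ Subsingleton (DeRhamH2 B ⧸ latticedH2 P) :=
  ⟨Subsingleton.elim _ _, (QuotientAddGroup.mk_surjective (s := latticedH2 P)).subsingleton⟩

end Vanishing

end LagrangianFibration

end

open LagrangianFibration

theorem theorem16 {B : Type*} [TopologicalSpace B] [T2Space B] [SecondCountableTopology B]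
    [ChartedSpace Plane B] [IsManifold 𝓘(ℝ, Plane) ∞ B] (P : CotangentLattice B) :
    -- 1) bases other than the torus and the Klein bottle
    (P.IsComplete → IsEmpty (B ≃ₜ Torus) → IsEmpty (B ≃ₜ KleinBottle) →
      Subsingleton (LatticeH2 P) ∧ Subsingleton (DeRhamH2 B ⧸ latticedH2 P)) ∧
    -- 2) the series `𝕋²_{u,v;w,z}`
    (∀ (u v w z : ℝ) (q : Plane → B), u * z - v * w ≠ 0 →
      IsPresentation P (torusGroup u v w z) q →
      Nonempty (LatticeH2 P ≃+ ℤ × ℤ) ∧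
      ∃ Φ : DeRhamH2 B ≃ₗ[ℝ] ℝ,
        (∀ η : closedTwoForms B, Φ (Submodule.Quotient.mk η) =
          integralOver q (parallelogram !₂[u, v] !₂[w, z]) η) ∧
        (latticedH2 P).map Φ.toLinearMap.toAddMonoidHom =
          AddSubgroup.closure ({u, v, w, z} : Set ℝ)) ∧
    -- 3) the series `𝕋²_{n,y;x}`
    (∀ (n : ℕ) (y x : ℝ) (q : Plane → B), 0 < y → 0 < x →
      IsPresentation P (shearTorusGroup n y x) q →
      Nonempty (LatticeH2 P ≃+ ℤ × ZMod n) ∧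
      ∃ Φ : DeRhamH2 B ≃ₗ[ℝ] ℝ,
        (∀ η : closedTwoForms B, Φ (Submodule.Quotient.mk η) =
          integralOver q (parallelogram !₂[x, 0] !₂[0, y]) η) ∧
        (latticedH2 P).map Φ.toLinearMap.toAddMonoidHom =
          AddSubgroup.closure ({x, y} : Set ℝ)) ∧
    -- 4) the series `𝕂²_{m,y;0,x}`
    (∀ (m : ℕ) (y x : ℝ) (q : Plane → B), 0 < y → 0 < x →
      IsPresentation P (kleinGroup m y 0 x) q →
      Nonempty (LatticeH2 P ≃+ ZMod 2 × ZMod m) ∧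
      latticedH2 P = ⊥ ∧ Subsingleton (DeRhamH2 B ⧸ latticedH2 P)) ∧
    -- 5) the series `𝕂²_{2m,y;1,x}`
    (∀ (m : ℕ) (y x : ℝ) (q : Plane → B), 0 < y → 0 < x →
      IsPresentation P (kleinGroup (2 * m) y 1 x) q →
      Nonempty (LatticeH2 P ≃+ ZMod (4 * m)) ∧
      latticedH2 P = ⊥ ∧ Subsingleton (DeRhamH2 B ⧸ latticedH2 P)) := by
  refine ⟨fun h hT hK => ?_, fun u v w z q hdet hq => ?_, fun n y x q hy hx hq => ?_,
    fun m y x q hy hx hq => ?_, fun m y x q hy hx hq => ?_⟩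
  · obtain ⟨q, hq⟩ := h.exists_isLatticeCover
    obtain ⟨h1, h2⟩ := hq.subsingleton_of_not_torus_of_not_klein hT hK
    exact ⟨h1, latticedH2_eq_bot.2⟩
  · exact ⟨latticeH2_torus hdet hq, deRham_torus hdet hq⟩
  · exact ⟨latticeH2_shearTorus hy hx hq, deRham_shearTorus hy hx hq⟩
  · have := (hq.isQuotientBy.klein hy.ne' hx.ne').subsingleton_deRhamH2_klein
    exact ⟨latticeH2_klein_zero hy hx hq, latticedH2_eq_bot⟩
  · have := (hq.isQuotientBy.klein hy.ne' hx.ne').subsingleton_deRhamH2_klein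
    exact ⟨latticeH2_klein_one hy hx hq, latticedH2_eq_bot⟩
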